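/- Let $k$ be a perfect field with algebraic closure $\bar k$, let $r\le n$, and let $F_1,\dots,F_r,G\in k[X_1,\dots,X_n]$ be such that $F_1,\dots,F_r$ form a regular sequence in the localization $k[X_1,\dots,X_n]_G$ (in particular they generate a proper ideal there) and, for $1\le s\le r$, the ideal generated by $F_1,\dots,F_s$ in $k[X_1,\dots,X_n]_G$ is radical. For $1\le s\le r$ let $V_s\subset\mathbb{A}^n=\bar k^n$ be the Zariski closure of $\{F_1=0,\dots,F_s=0,\ G\ne 0\}$, let $\bar k[V_s]=\bar k[X_1,\dots,X_n]/I(V_s)$ be its coordinate ring, and let $\delta_s=\deg V_s$, that is, the sum over the irreducible $k$-components $C$ of $V_s$ of the maximal cardinality of a finite intersection $C\cap L$ with $L\subset\mathbb{A}^n$ an affine linear subspace of codimension $\dim C$. Then for each $1\le s\le r$ there is a nonzero polynomial $A_s\in k[\Lambda]$ in the entries of an $(n-s+1)\times n$ matrix $\Lambda$ of indeterminates, of total degree at most $2(n-s+1)\delta_s^2$, with the following property. Let $\lambda\in\bar k^{(n-s+1)\times n}$ satisfy $A_s(\lambda)\ne 0$, and let $Y_i=\lambda_{i,1}X_1+\dots+\lambda_{i,n}X_n$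 for $1\le i\le n-s+1$. Then: 1. The map $\pi_s:V_s\to\mathbb{A}^{n-s}$ defined by $Y_1,\dots,Y_{n-s}$ is a finite morphism, that is, for each irreducible component $C$ of $V_s$ over $\bar k$, the restriction of $\pi_s$ to $C$ is dominant and $\bar k[C]$ is integral over $\bar k[Y_1,\dots,Y_{n-s}]$. 2. Put $R_s=\bar k[Y_1,\dots,Y_{n-s}]$, viewed as a polynomial ring mapping to $\bar k[V_s]$, and $K_s=\bar k(Y_1,\dots,Y_{n-s})$. The linear form $Y_{n-s+1}$ induces a primitive element of $K_s\hookrightarrow K_s\otimes_{R_s}\bar k[V_s]$, that is, $K_s\otimes_{R_s}\bar k[V_s]$ is a finite-dimensional $K_s$-vector space and the minimal polynomial over $K_s$ of the image of $Y_{n-s+1}$ has degree $\dim_{K_s}\bigl(K_s\otimes_{R_s}\bar k[V_s]\bigr)$. -/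

import Mathlib

open scoped TensorProduct

noncomputable section

namespace NoetherPrim

open MvPolynomial

/-- `F₁, …, F_r` form a reduced regular sequence on `{G ≠ 0}`: they are a regular sequence in the
localization `k[X]_G` and, for `1 ≤ s ≤ r`, the ideal `(F₁, …, F_s)_G` is radical in `k[X]_G`. -/
structure IsReducedRegularSequence {k : Type*} [Field k] {n r : ℕ}
    (F : Fin r → MvPolynomial (Fin n) k) (G : MvPolynomial (Fin n) k) : Prop where
  regular : RingTheory.Sequence.IsRegular (Localization.Away G)
    (List.ofFn fun i => algebraMap (MvPolynomial (Fin n) k) (Localization.Away G) (F i))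
  radical : ∀ s : ℕ, 1 ≤ s → s ≤ r →
    (Ideal.span ((fun i => algebraMap (MvPolynomial (Fin n) k) (Localization.Away G) (F i)) ''
      {i : Fin r | (i : ℕ) < s})).IsRadical

/-- The Zariski closure of a subset of affine space `K^m`. -/
def zariskiClosure {K : Type*} [Field K] {m : ℕ} (S : Set (Fin m → K)) : Set (Fin m → K) :=
  zeroLocus K (vanishingIdeal K S)

/-- `V_s`: the Zariski closure in `K^n` of `{F₁ = 0, …, F_s = 0, G ≠ 0}`. -/
def closedVariety {k : Type*} [Field k] (K : Type*) [Field K] [Algebra k K] {n r : ℕ}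
    (F : Fin r → MvPolynomial (Fin n) k) (G : MvPolynomial (Fin n) k) (s : ℕ) :
    Set (Fin n → K) :=
  zariskiClosure {x | (∀ i : Fin r, (i : ℕ) < s → aeval x (F i) = 0) ∧ aeval x G ≠ 0}

/-- The coordinate ring `k[V] = k[X] / I(V)`, where `I(V) ⊆ k[X]` and `V ⊆ K^n`. -/
abbrev CoordRing (k : Type*) [Field k] {K : Type*} [Field K] [Algebra k K] {n : ℕ}
    (V : Set (Fin n → K)) : Type _ :=
  MvPolynomial (Fin n) k ⧸ (vanishingIdeal k V : Ideal (MvPolynomial (Fin n) k))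

/-- The irreducible `k`-components of a `k`-variety `V ⊆ K^n`. -/
def components (k : Type*) [Field k] {K : Type*} [Field K] [Algebra k K] {n : ℕ}
    (V : Set (Fin n → K)) : Set (Set (Fin n → K)) :=
  (fun p => zeroLocus K p) '' (vanishingIdeal k V : Ideal (MvPolynomial (Fin n) k)).minimalPrimes

/-- The degree of an irreducible `k`-variety `C ⊆ K^n`: the maximal number of points of a finite
intersection `C ∩ L`, where `L` is an affine linear subspace of `K^n` of codimension `dim C`. -/
def irreducibleDegree (k : Type*) [Field k] {K : Type*} [Field K] [Algebra k K] {n : ℕ}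
    (C : Set (Fin n → K)) : ℕ :=
  sSup {N : ℕ | ∃ L : AffineSubspace K (Fin n → K), (L : Set (Fin n → K)).Nonempty ∧
    (Module.finrank K L.direction : WithBot ℕ∞) + ringKrullDim (CoordRing k C) = n ∧
    (C ∩ (L : Set (Fin n → K))).Finite ∧ (C ∩ (L : Set (Fin n → K))).ncard = N}

/-- The degree of a `k`-variety: the sum of the degrees of its irreducible `k`-components. -/
def varietyDegree (k : Type*) [Field k] {K : Type*} [Field K] [Algebra k K] {n : ℕ}
    (V : Set (Fin n → K)) : ℕ :=
  ∑ᶠ C ∈ components k V, irreducibleDegree k C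

/-- The regular map `K^n → K^m` with polynomial coordinates `f₁, …, f_m`. -/
def polyMap {K : Type*} [Field K] {n m : ℕ} (f : Fin m → MvPolynomial (Fin n) K)
    (x : Fin n → K) : Fin m → K :=
  fun j => eval x (f j)

/-- The homomorphism `K[Y₁, …, Y_m] → K[V]`, `Y_j ↦ f_j mod I(V)`, dual to `polyMap f` on `V`. -/
def comorphism {K : Type*} [Field K] {n m : ℕ} (V : Set (Fin n → K))
    (f : Fin m → MvPolynomial (Fin n) K) : MvPolynomial (Fin m) K →ₐ[K] CoordRing K V :=
  aeval fun j => Ideal.Quotient.mk (vanishingIdeal K V) (f j)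

/-- The map `V → K^m` given by `f₁, …, f_m` is a finite morphism: its restriction to each
irreducible component `C` of `V` is dominant, and `K[C]` is integral over `K[Y₁, …, Y_m]`. -/
def IsFiniteMorphism {K : Type*} [Field K] {n m : ℕ} (V : Set (Fin n → K))
    (f : Fin m → MvPolynomial (Fin n) K) : Prop :=
  ∀ C ∈ components K V,
    zariskiClosure (polyMap f '' C) = Set.univ ∧ (comorphism C f).toRingHom.IsIntegral

/-- For a domain `R` with fraction field `Q` and a ring homomorphism `φ : R → B`, the element
`b : B` induces a primitive element of the extension `Q → Q ⊗_R B`: the space `Q ⊗_R B` is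
finite-dimensional and the minimal polynomial of `1 ⊗ b` over `Q` has degree `dim_Q (Q ⊗_R B)`. -/
def InducesPrimitiveElement {R B : Type*} [CommRing R] [IsDomain R] [CommRing B]
    (φ : R →+* B) (b : B) : Prop :=
  letI : Algebra R B := φ.toAlgebra
  Module.Finite (FractionRing R) (FractionRing R ⊗[R] B) ∧
    (minpoly (FractionRing R) ((1 : FractionRing R) ⊗ₜ[R] b)).natDegree =
      Module.finrank (FractionRing R) (FractionRing R ⊗[R] B)

/-- The linear form `λ_i · X` attached to the `i`-th row of a matrix. -/
def linForm {K : Type*} [Field K] {m n : ℕ} (lam : Matrix (Fin m) (Fin n) K) (i : Fin m) :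
    MvPolynomial (Fin n) K :=
  ∑ j, C (lam i j) * X j

end NoetherPrim

end

-- Write `d = n - s` and `V = V_s`. Krull's height theorem bounds the codimension of each component
-- of `V` by `s` from above, and the regular sequence bounds it from below, so `V` is pure of
-- dimension `d`, over `k` and over `K`.
--
-- Consider `d + 1` generic linear forms on `V`, with coefficient matrix `Λ` and values `T_0, …,
-- T_d`. The relations between coefficients and values form the kernel of `K[Λ, T] → K[V][Λ]`. On a
-- component of dimension `d` the first `d` values are algebraically independent over `K(Λ)`, so no
-- nonzero polynomial free of the last value `T = T_d` is a zero divisor modulo this ideal. By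
-- Gauss's lemma the ideal is principal (`exists_chowIdeal_eq_span`). Its generator `F` is the Chow
-- form; let `e` be its degree in `T`.
--
-- Row operations multiply `F` by constants. Hence `F` has degree `e` in each row (coefficients
-- together with value), total degree at most `(d + 1) e`, and a leading coefficient in `T` that
-- involves only coefficients of the first `d` rows. If that leading coefficient survives at `λ`,
-- replacing the last row by unit vectors yields integral equations for the coordinates, and
-- counting dimensions gives dominance (`IsChowForm.isFiniteMorphism`).
--
-- Differentiating `F(Λ, ΛX) = 0` gives `∂F/∂Λ_{d,j} + X_j ∂F/∂T = 0` on `V`. If the resultant of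
-- `F` and `∂F/∂T` does not vanish identically at `λ`, Bézout turns this into `r X_j ∈ R[Y]` with `r
-- ≠ 0` in the polynomial ring `R` of the first `d` forms and `Y` the last form, so `Y` is primitive
-- (`IsChowForm.inducesPrimitiveElement`). The generic resultant is nonzero because `F` is
-- squarefree and its prime factors have nonzero `T`-derivative.
--
-- As `k` is perfect and `V` is Galois stable, `F` can be taken over `k`. Let `A` be the product of
-- one nonzero coefficient, with respect to the values, of the leading coefficient and one of the
-- resultant: its degree is at most `(1 + (2e - 1)) (d + 1) e = 2 (d + 1) e²` when `e > 0`. Finally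
-- `e ≤ δ_s`: for suitable `λ` the specialized `F` has `e` distinct roots in `T`, each attained at a
-- point of `V` on one affine space of codimension `d` meeting `V` in finitely many points. The
-- degree is a supremum in `ℕ`, so this comparison also needs a uniform bound on finite linear
-- sections, which comes from Zariski's main theorem.

universe u v w

/-! ### Transcendence degree, Krull dimension and codimension. -/

open Cardinal Algebra Algebra.IsAlgebraic in
/-- Integral injective extensions do not change the transcendence degree. -/
theorem Algebra.lift_trdeg_eq_of_isIntegral {k : Type u} {A : Type v} {B : Type w} [Field k] [CommRing A]
    [CommRing B] [IsDomain B] [Algebra k A] [Algebra k B] (g : A →ₐ[k] B)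
    (hg : Function.Injective g) (hi : g.toRingHom.IsIntegral) :
    lift.{v} (Algebra.trdeg k B) = lift.{w} (Algebra.trdeg k A) := by
  let _ := g.toRingHom.toAlgebra
  have : IsScalarTower k A B := IsScalarTower.of_algebraMap_eq fun x => (g.commutes x).symm
  have : FaithfulSMul A B := (faithfulSMul_iff_algebraMap_injective A B).2 hg
  have : IsDomain A := hg.isDomain g.toRingHom
  have : Algebra.IsIntegral A B := ⟨hi⟩
  rw [← lift_trdeg_add_eq k A B, trdeg_eq_zero (R := A) (A := B)]
  simp

/-- Incomparability makes contraction of primes strictly monotone, which bounds `dim B` above.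
Conversely a prime over a maximal ideal of maximal height has at least that height, by going-down
for an integrally closed base. -/
theorem ringKrullDim_eq_of_isIntegral {A B : Type*} [CommRing A] [CommRing B] [IsDomain B]
    [IsNoetherianRing A] [IsNoetherianRing B] [IsIntegrallyClosed A] [FiniteRingKrullDim A]
    [Algebra A B] [FaithfulSMul A B] [Algebra.IsIntegral A B] :
    ringKrullDim B = ringKrullDim A := by
  apply le_antisymm
  · refine Order.krullDim_le_of_strictMono (PrimeSpectrum.comap (algebraMap A B)) ?_
    intro p q hpq
    have h : p.asIdeal < q.asIdeal := hpq
    exact Ideal.comap_lt_comap_of_integral_mem_sdiff (R := A) h.le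
      (Set.exists_of_ssubset h).choose_spec (Algebra.IsIntegral.isIntegral _)
  · obtain ⟨m, hm, hm'⟩ := Ideal.exists_isMaximal_height (R := A)
    obtain ⟨Q, -, hQ, hQm⟩ := Ideal.exists_ideal_over_prime_of_isIntegral (S := B) m ⊥ (by
      rw [← RingHom.ker_eq_comap_bot, (RingHom.injective_iff_ker_eq_bot _).1
        (FaithfulSMul.algebraMap_injective A B)]; exact bot_le)
    have : Q.LiesOver m := ⟨hQm.symm⟩
    rw [← hm']
    refine le_trans ?_ (Ideal.height_le_ringKrullDim_of_isPrime (I := Q))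
    rw [Ideal.height_eq_height_add_of_liesOver_of_hasGoingDown m Q]
    exact_mod_cast le_self_add

theorem height_le_height_comap_of_isIntegral {A B : Type*} [CommRing A] [CommRing B]
    [IsNoetherianRing A] [IsNoetherianRing B]
    [Algebra A B] [Algebra.HasGoingDown A B] (Q : Ideal B) [Q.IsPrime] :
    (Q.comap (algebraMap A B)).height ≤ Q.height := by
  have : Q.LiesOver (Q.comap (algebraMap A B)) := ⟨rfl⟩
  rw [Ideal.height_eq_height_add_of_liesOver_of_hasGoingDown (Q.comap (algebraMap A B)) Q]
  exact le_self_add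

/-- The coordinate functions other than `i` are algebraically independent modulo a polynomial
involving the `i`-th variable. -/
theorem MvPolynomial.le_trdeg_quotient_span_singleton {k : Type*} [Field k] {m : ℕ}
    (g : MvPolynomial (Fin (m + 1)) k) (hg : Prime g) :
    (m : Cardinal) ≤ Algebra.trdeg k (MvPolynomial (Fin (m + 1)) k ⧸ Ideal.span {g}) := by
  classical
  obtain ⟨i, hi⟩ : ∃ i, g.degreeOf i ≠ 0 := by
    by_contra! h
    obtain ⟨c, hc⟩ : ∃ c, g = C c := by
      refine ⟨g.coeff 0, ?_⟩
      rw [← totalDegree_eq_zero_iff_eq_C, totalDegree_eq_zero_iff]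
      intro s hs j
      have := degreeOf_le_iff.1 (h j).le s hs
      omega
    refine hg.not_isUnit ?_
    have : c ≠ 0 := by rintro rfl; exact hg.ne_zero (by simp [hc])
    rw [hc]
    exact this.isUnit.map C
  have key : AlgebraicIndependent k
      (fun j : Fin m => (Ideal.Quotient.mk (Ideal.span {g}) (X (i.succAbove j)))) := by
    rw [algebraicIndependent_iff]
    intro P hP
    have h1 : aeval (fun j : Fin m => (Ideal.Quotient.mk (Ideal.span {g}) (X (i.succAbove j)))) P
        = Ideal.Quotient.mk (Ideal.span {g}) (rename i.succAbove P) := by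
      have : (aeval (fun j : Fin m => (Ideal.Quotient.mk (Ideal.span {g}) (X (i.succAbove j)))))
        = (Ideal.Quotient.mkₐ k (Ideal.span {g})).comp (rename i.succAbove) := by
        ext j; simp
      rw [this]; rfl
    rw [h1, Ideal.Quotient.eq_zero_iff_mem, Ideal.mem_span_singleton] at hP
    obtain ⟨h, hh⟩ := hP
    by_contra hP0
    have hR : rename i.succAbove P ≠ 0 := by
      rwa [Ne, map_eq_zero_iff _ (rename_injective _ Fin.succAbove_right_injective)]
    have h0 : h ≠ 0 := by rintro rfl; exact hR (by simp [hh])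
    have h2 : (rename i.succAbove P).degreeOf i = 0 := by
      by_contra hne
      have hmem : i ∈ (rename i.succAbove P).vars := by
        rw [degreeOf_def] at hne
        rw [vars_def, Multiset.mem_toFinset]
        exact Multiset.count_ne_zero.1 hne
      have := vars_rename i.succAbove P hmem
      simp only [Finset.mem_image] at this
      obtain ⟨j, -, hj⟩ := this
      exact Fin.succAbove_ne i j hj
    rw [hh, degreeOf_mul_eq hg.ne_zero h0] at h2
    omega
  simpa using key.lift_cardinalMk_le_trdeg

/-- Noether normalization: both invariants are preserved by integral extensions, and both count the
variables of a polynomial ring. -/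
theorem exists_trdeg_eq_and_ringKrullDim_eq (k A : Type*) [Field k] [CommRing A] [IsDomain A]
    [Algebra k A] [Algebra.FiniteType k A] :
    ∃ m : ℕ, Algebra.trdeg k A = m ∧ ringKrullDim A = m := by
  obtain ⟨m, g, hg, hi⟩ := exists_integral_inj_algHom_of_fg k A
  refine ⟨m, ?_, ?_⟩
  · have := Algebra.lift_trdeg_eq_of_isIntegral g hg hi
    simp only [MvPolynomial.trdeg_of_isDomain, Cardinal.mk_fin, Cardinal.lift_natCast] at this
    exact_mod_cast (Cardinal.lift_eq_nat_iff.1 this)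
  · have : IsNoetherianRing A := Algebra.FiniteType.isNoetherianRing k A
    let _ := g.toRingHom.toAlgebra
    have : FaithfulSMul (MvPolynomial (Fin m) k) A :=
      (faithfulSMul_iff_algebraMap_injective _ _).2 hg
    have : Algebra.IsIntegral (MvPolynomial (Fin m) k) A := ⟨hi⟩
    have hdim : ringKrullDim (MvPolynomial (Fin m) k) = m := by
      simp [MvPolynomial.ringKrullDim_of_isNoetherianRing]
    have : FiniteRingKrullDim (MvPolynomial (Fin m) k) := by
      rw [finiteRingKrullDim_iff_ne_bot_and_top, hdim]
      exact ⟨WithBot.coe_ne_bot, fun h => ENat.natCast_ne_top m (WithBot.coe_injective h)⟩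
    rw [ringKrullDim_eq_of_isIntegral (A := MvPolynomial (Fin m) k), hdim]

/-- Krull's principal ideal theorem in terms of the transcendence degree. -/
theorem trdeg_le_trdeg_quotient_add_one {k A : Type*} [Field k] [CommRing A] [IsDomain A]
    [Algebra k A] [Algebra.FiniteType k A] (f : A) (q : Ideal A)
    (hq : q ∈ (Ideal.span {f}).minimalPrimes) :
    Algebra.trdeg k A ≤ Algebra.trdeg k (A ⧸ q) + 1 := by
  have : q.IsPrime := hq.1.1
  have : IsNoetherianRing A := Algebra.FiniteType.isNoetherianRing k A
  obtain ⟨m, g, hg, hi⟩ := exists_integral_inj_algHom_of_fg k A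
  have hm := Algebra.lift_trdeg_eq_of_isIntegral g hg hi
  simp only [MvPolynomial.trdeg_of_isDomain, Cardinal.mk_fin, Cardinal.lift_natCast] at hm
  have hm : Algebra.trdeg k A = m := by exact_mod_cast (Cardinal.lift_eq_nat_iff.1 hm)
  let _ := g.toRingHom.toAlgebra
  have : FaithfulSMul (MvPolynomial (Fin m) k) A :=
    (faithfulSMul_iff_algebraMap_injective _ _).2 hg
  have : Algebra.IsIntegral (MvPolynomial (Fin m) k) A := ⟨hi⟩
  have hh : q.height ≤ 1 := Ideal.height_le_one_of_isPrincipal_of_mem_minimalPrimes _ q hq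
  set p := q.comap g.toRingHom with hp
  have : p.IsPrime := Ideal.comap_isPrime _ _
  have hph : p.height ≤ 1 :=
    (height_le_height_comap_of_isIntegral (A := MvPolynomial (Fin m) k) q).trans hh
  have hquot := Algebra.lift_trdeg_eq_of_isIntegral
    (Ideal.quotientMapₐ (I := p) q g le_rfl)
    (Ideal.quotientMap_injective (I := q) (f := g.toRingHom))
    (hi.quotient)
  rw [hm]
  by_cases hp0 : p = ⊥
  · have h1 : Algebra.trdeg k (MvPolynomial (Fin m) k ⧸ p) = m := by
      rw [hp0, ← (AlgEquiv.quotientBot k (MvPolynomial (Fin m) k)).symm.trdeg_eq]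
      simp
    rw [h1] at hquot
    simp only [Cardinal.lift_natCast] at hquot
    rw [Cardinal.lift_eq_nat_iff.1 hquot]
    exact le_self_add
  -- A nonzero prime of height at most one in a factorial ring is generated by a prime element, so
  -- its quotient keeps transcendence degree at least `m - 1`.
  · obtain ⟨a, hap, ha⟩ := Ideal.IsPrime.exists_mem_prime_of_ne_bot ‹p.IsPrime› hp0
    have hpa : Ideal.span {a} = p := by
      have : (Ideal.span {a}).IsPrime := (Ideal.span_singleton_prime ha.ne_zero).2 ha
      by_contra hne
      have hlt : Ideal.span {a} < p :=
        lt_of_le_of_ne (by rwa [Ideal.span_singleton_le_iff_mem]) hne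
      have h2 := Ideal.height_add_one_le_of_lt_of_isPrime hlt
      have h3 := Ideal.height_add_one_le_of_lt_of_isPrime
        (I := (⊥ : Ideal (MvPolynomial (Fin m) k))) (J := Ideal.span {a})
        (bot_lt_iff_ne_bot.2 (by simpa using ha.ne_zero))
      have : (2 : ℕ∞) ≤ 1 := by
        calc (2 : ℕ∞) = 0 + 1 + 1 := by norm_num
          _ ≤ (Ideal.span {a}).height + 1 := by
              gcongr; exact le_trans (by gcongr; exact bot_le) h3
          _ ≤ p.height := h2
          _ ≤ 1 := hph
      exact absurd this (by decide)
    obtain _ | m := m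
    · simp
    · have h1 := MvPolynomial.le_trdeg_quotient_span_singleton a ha
      rw [hpa] at h1
      have h2 : ((m : ℕ) : Cardinal) ≤ Algebra.trdeg k (A ⧸ q) := by
        have h3 := Cardinal.lift_le.2 h1
        rw [← hquot] at h3
        simp only [Cardinal.lift_natCast] at h3
        exact Cardinal.nat_le_lift_iff.1 h3
      push_cast
      gcongr

/-- A prime ideal that is minimal over an ideal with `s` generators has codimension at most `s`. -/
theorem trdeg_le_trdeg_quotient_add_card {k A : Type*} [Field k] [CommRing A] [IsDomain A]
    [Algebra k A] [Algebra.FiniteType k A] (S : Finset A) (q : Ideal A)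
    (hq : q ∈ (Ideal.span (S : Set A)).minimalPrimes) :
    Algebra.trdeg k A ≤ Algebra.trdeg k (A ⧸ q) + S.card := by
  classical
  induction S using Finset.induction generalizing q with
  | empty =>
    have : q = ⊥ := by
      have := hq.1.1
      simp only [Finset.coe_empty, Ideal.span_empty] at hq
      exact le_bot_iff.1 (hq.2 ⟨Ideal.isPrime_bot, le_rfl⟩ bot_le)
    subst this
    rw [← (AlgEquiv.quotientBot k A).symm.trdeg_eq]
    simp
  | insert a S ha ih =>
    have := hq.1.1
    obtain ⟨p, hp, hpq⟩ := Ideal.exists_minimalPrimes_le (I := Ideal.span (S : Set A)) (J := q)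
      ((Ideal.span_mono (by simp)).trans hq.1.2)
    have := hp.1.1
    have h1 := ih p hp
    have hQ : q.map (Ideal.Quotient.mk p) ∈
        (Ideal.span {Ideal.Quotient.mk p a}).minimalPrimes := by
      have hcq : (q.map (Ideal.Quotient.mk p)).comap (Ideal.Quotient.mk p) = q := by
        rw [Ideal.comap_map_of_surjective _ Ideal.Quotient.mk_surjective,
          ← RingHom.ker_eq_comap_bot, Ideal.mk_ker, sup_eq_left.2 hpq]
      refine ⟨⟨Ideal.map_isPrime_of_surjective Ideal.Quotient.mk_surjective (by simpa using hpq),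
        ?_⟩, ?_⟩
      · rw [Ideal.span_singleton_le_iff_mem]
        exact Ideal.mem_map_of_mem _ (hq.1.2 (Ideal.subset_span (by simp)))
      · rintro Q ⟨hQ, haQ⟩ hQq
        rw [Ideal.map_le_iff_le_comap]
        refine hq.2 ⟨Ideal.comap_isPrime _ _, ?_⟩ ?_
        · rw [Ideal.span_le]
          intro x hx
          simp only [Finset.coe_insert, Set.mem_insert_iff, Finset.mem_coe] at hx
          rw [SetLike.mem_coe, Ideal.mem_comap]
          obtain rfl | hx := hx
          · exact haQ (Ideal.subset_span rfl)
          · have : x ∈ p := hp.1.2 (Ideal.subset_span hx)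
            rw [Ideal.Quotient.eq_zero_iff_mem.2 this]
            exact Q.zero_mem
        · calc Q.comap (Ideal.Quotient.mk p) ≤ _ := Ideal.comap_mono hQq
            _ = q := hcq
    have h2 := trdeg_le_trdeg_quotient_add_one (k := k) _ _ hQ
    replace h2 := h2.trans_eq
      congr($((DoubleQuot.quotQuotEquivQuotOfLEₐ k hpq).trdeg_eq) + 1)
    rw [Finset.card_insert_of_notMem ha]
    calc _ ≤ _ := h1
      _ ≤ Algebra.trdeg k (A ⧸ q) + 1 + (S.card : Cardinal) := by gcongr
      _ = _ := by push_cast; ring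

theorem trdeg_quotient_add_one_le_of_lt {k A : Type*} [Field k] [CommRing A]
    [Algebra k A] [Algebra.FiniteType k A] (p q : Ideal A) [p.IsPrime] [q.IsPrime] (h : p < q) :
    Algebra.trdeg k (A ⧸ q) + 1 ≤ Algebra.trdeg k (A ⧸ p) := by
  obtain ⟨m, hm, hm'⟩ := exists_trdeg_eq_and_ringKrullDim_eq k (A ⧸ p)
  obtain ⟨m₂, hm₂, hm₂'⟩ := exists_trdeg_eq_and_ringKrullDim_eq k (A ⧸ q)
  obtain ⟨r, hrq, hrp⟩ := Set.exists_of_ssubset h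
  have h1 := ringKrullDim_succ_le_of_surjective (Ideal.Quotient.factor h.le)
    (Ideal.Quotient.factor_surjective h.le) (r := Ideal.Quotient.mk p r)
    (mem_nonZeroDivisors_of_ne_zero fun h0 => hrp (Ideal.Quotient.eq_zero_iff_mem.1 h0))
    (by rw [Ideal.Quotient.factor_mk]; exact Ideal.Quotient.eq_zero_iff_mem.2 hrq)
  rw [hm', hm₂'] at h1
  rw [hm, hm₂]
  exact_mod_cast h1

open RingTheory.Sequence in
/-- A prime ideal containing a regular sequence of length `s` has codimension at least `s`. -/
theorem RingTheory.Sequence.IsWeaklyRegular.trdeg_quotient_add_le {k A : Type*} [Field k]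
    [CommRing A] [IsDomain A] [Algebra k A] [Algebra.FiniteType k A] {rs : List A}
    (hrs : IsWeaklyRegular A rs) (s : ℕ) (hs : s ≤ rs.length) (q : Ideal A) [q.IsPrime]
    (hq : ∀ a ∈ rs.take s, a ∈ q) :
    Algebra.trdeg k (A ⧸ q) + s ≤ Algebra.trdeg k A := by
  induction s generalizing q with
  | zero =>
    simpa using trdeg_le_of_surjective (Ideal.Quotient.mkₐ k q)
      (Ideal.Quotient.mkₐ_surjective k q)
  | succ s ih =>
    obtain ⟨p, hp, hpq⟩ := Ideal.exists_minimalPrimes_le (I := Ideal.ofList (rs.take s)) (J := q)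
      (by
        rw [Ideal.ofList, Ideal.span_le]
        intro a ha
        exact hq a (List.take_subset_take_left _ (Nat.le_succ s) ha))
    have := hp.1.1
    have h1 := ih (by omega) p fun a ha => hp.1.2 (Ideal.subset_span ha)
    have hreg := (isWeaklyRegular_iff_Fin A rs).1 hrs ⟨s, by omega⟩
    have hmem : rs[s] ∈ q := hq _ (List.mem_take_iff_getElem.2 ⟨s, by omega, rfl⟩)
    -- The next element is a nonzerodivisor modulo the previous ones, so it avoids every minimal
    -- prime over them.
    have hnot : rs[s] ∉ p := by
      intro hsp
      have hI : Ideal.ofList (rs.take s) • (⊤ : Submodule A A) = Ideal.ofList (rs.take s) := by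
        simp
      rw [Ideal.minimalPrimes_eq_comap] at hp
      obtain ⟨P, hP, rfl⟩ := hp
      refine Set.disjoint_left.1 (Ideal.disjoint_nonZeroDivisors_of_mem_minimalPrimes hP)
        (Ideal.mem_comap.1 hsp) ?_
      rw [SetLike.mem_coe, mem_nonZeroDivisors_iff_right]
      intro x hx
      obtain ⟨x, rfl⟩ := Ideal.Quotient.mk_surjective x
      rw [← map_mul, Ideal.Quotient.eq_zero_iff_mem] at hx
      rw [Ideal.Quotient.eq_zero_iff_mem, ← hI, ← Submodule.Quotient.mk_eq_zero]
      refine hreg.right_eq_zero_of_smul ?_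
      rw [← Submodule.Quotient.mk_smul, Submodule.Quotient.mk_eq_zero]
      simpa [mul_comm] using hx
    have h2 := trdeg_quotient_add_one_le_of_lt (k := k) p q
      (lt_of_le_of_ne hpq fun h => hnot (h ▸ hmem))
    calc Algebra.trdeg k (A ⧸ q) + ((s + 1 : ℕ) : Cardinal)
        = Algebra.trdeg k (A ⧸ q) + 1 + s := by push_cast; ring
      _ ≤ Algebra.trdeg k (A ⧸ p) + s := by gcongr
      _ ≤ _ := h1

noncomputable section

namespace NoetherPrim

open MvPolynomial

/-! ### Pure dimension of `V_s`, over `k` and over its algebraic closure. -/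

section Variety

variable {k K : Type*} [Field k] [Field K] [Algebra k K] {n r : ℕ}

theorem vanishingIdeal_closedVariety (F : Fin r → MvPolynomial (Fin n) k)
    (G : MvPolynomial (Fin n) k) (s : ℕ) (f : MvPolynomial (Fin n) k) :
    f ∈ (vanishingIdeal k (closedVariety K F G s) : Ideal (MvPolynomial (Fin n) k)) ↔
      ∀ x : Fin n → K, (∀ i : Fin r, (i : ℕ) < s → aeval x (F i) = 0) → aeval x G ≠ 0 →
        aeval x f = 0 := by
  rw [mem_vanishingIdeal_iff]
  constructor
  · intro h x hx hG
    exact h x fun g hg => hg x ⟨hx, hG⟩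
  · intro h x hx
    have : map (algebraMap k K) f ∈ (vanishingIdeal K {x : Fin n → K |
        (∀ i : Fin r, (i : ℕ) < s → aeval x (F i) = 0) ∧ aeval x G ≠ 0} :
        Ideal (MvPolynomial (Fin n) K)) := by
      intro y hy
      rw [aeval_map_algebraMap]
      exact h y hy.1 hy.2
    simpa [aeval_map_algebraMap] using hx _ this

theorem closedVariety_map (F : Fin r → MvPolynomial (Fin n) k)
    (G : MvPolynomial (Fin n) k) (s : ℕ) :
    closedVariety K (fun i => map (algebraMap k K) (F i)) (map (algebraMap k K) G) s =
      closedVariety K F G s := by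
  simp only [closedVariety, aeval_map_algebraMap]

theorem zeroLocus_vanishingIdeal_closedVariety (F : Fin r → MvPolynomial (Fin n) k)
    (G : MvPolynomial (Fin n) k) (s : ℕ) :
    zeroLocus K (vanishingIdeal K (closedVariety K F G s)) = closedVariety K F G s := by
  refine le_antisymm ?_ (zeroLocus_vanishingIdeal_le _)
  intro x hx f hf
  refine hx f ?_
  intro y hy
  exact hy f hf

variable [IsAlgClosed K]

/-- By the Nullstellensatz `I(V_s)` is, up to radical, `(F_1, …, F_s)` saturated by `G`. Its minimal
primes are therefore open to both estimates: Krull's in `k[X]`, and the one from the regular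
sequence in `k[X]_G`. -/
theorem mem_minimalPrimes_vanishingIdeal_closedVariety {F : Fin r → MvPolynomial (Fin n) k}
    {G : MvPolynomial (Fin n) k} {s : ℕ} {p : Ideal (MvPolynomial (Fin n) k)}
    (hp : p ∈ (vanishingIdeal k (closedVariety K F G s) :
      Ideal (MvPolynomial (Fin n) k)).minimalPrimes) :
    p ∈ (Ideal.span (F '' {i : Fin r | (i : ℕ) < s})).minimalPrimes ∧ G ∉ p := by
  set I : Ideal (MvPolynomial (Fin n) k) := vanishingIdeal k (closedVariety K F G s) with hI
  have hG : G ∉ p := by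
    intro hGp
    obtain ⟨y, hy, hyG⟩ := Ideal.exists_mul_mem_of_mem_minimalPrimes hp hGp
    refine hy ?_
    rw [hI, vanishingIdeal_closedVariety] at hyG ⊢
    intro x hx hxG
    have := hyG x hx hxG
    rw [map_mul] at this
    exact (mul_eq_zero.1 this).resolve_left hxG
  refine ⟨⟨⟨hp.1.1, ?_⟩, ?_⟩, hG⟩
  · refine le_trans ?_ hp.1.2
    rw [Ideal.span_le]
    rintro _ ⟨i, hi, rfl⟩
    rw [SetLike.mem_coe, hI, vanishingIdeal_closedVariety]
    exact fun x hx _ => hx i hi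
  · rintro q ⟨hq, hFq⟩ hqp
    refine hp.2 ⟨hq, fun f hf => ?_⟩ hqp
    rw [hI, vanishingIdeal_closedVariety] at hf
    have h1 : f * G ∈ (Ideal.span (F '' {i : Fin r | (i : ℕ) < s})).radical := by
      rw [← vanishingIdeal_zeroLocus_eq_radical (K := K)]
      intro x hx
      rw [map_mul]
      by_cases hxG : aeval x G = 0
      · rw [hxG, mul_zero]
      · rw [hf x (fun i hi => hx _ (Ideal.subset_span ⟨i, hi, rfl⟩)) hxG, zero_mul]
    have h2 : f * G ∈ q := (hq.radical_le_iff.2 hFq) h1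
    exact (hq.mem_or_mem h2).resolve_right fun h => hG (hqp h)

theorem le_trdeg_of_mem_minimalPrimes {F : Fin r → MvPolynomial (Fin n) k} {s : ℕ}
    {p : Ideal (MvPolynomial (Fin n) k)}
    (hp : p ∈ (Ideal.span (F '' {i : Fin r | (i : ℕ) < s})).minimalPrimes) :
    (n : Cardinal) ≤ Algebra.trdeg k (MvPolynomial (Fin n) k ⧸ p) + s := by
  classical
  set S : Finset (MvPolynomial (Fin n) k) :=
    (Finset.univ.filter fun i : Fin r => (i : ℕ) < s).image F with hS
  have hS' : (S : Set (MvPolynomial (Fin n) k)) = F '' {i : Fin r | (i : ℕ) < s} := by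
    simp [hS]
  rw [← hS'] at hp
  have h1 := trdeg_le_trdeg_quotient_add_card (k := k) S p hp
  have hcard : S.card ≤ s := by
    refine Finset.card_image_le.trans ?_
    rw [← Finset.card_range s]
    refine Finset.card_le_card_of_injOn (fun i : Fin r => (i : ℕ)) ?_ Fin.val_injective.injOn
    intro i hi
    simpa using hi
  rw [trdeg_of_isDomain] at h1
  simp only [Cardinal.mk_fin, Cardinal.lift_natCast] at h1
  refine h1.trans ?_
  gcongr

open Algebra Algebra.IsAlgebraic in
-- The sequence is regular only after inverting `G`; since `G ∉ p`, the prime survives there, its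
-- quotient does not shrink, and the ambient ring still has transcendence degree `n`.
theorem trdeg_quotient_add_le_of_regular {F : Fin r → MvPolynomial (Fin n) k}
    {G : MvPolynomial (Fin n) k} (hF : RingTheory.Sequence.IsWeaklyRegular (Localization.Away G)
    (List.ofFn fun i => algebraMap (MvPolynomial (Fin n) k) (Localization.Away G) (F i)))
    {s : ℕ} (hs : s ≤ r)
    {p : Ideal (MvPolynomial (Fin n) k)} [hp : p.IsPrime] (hG : G ∉ p)
    (hFp : ∀ i : Fin r, (i : ℕ) < s → F i ∈ p) :
    Algebra.trdeg k (MvPolynomial (Fin n) k ⧸ p) + s ≤ n := by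
  have hG0 : G ≠ 0 := fun h => hG (h ▸ p.zero_mem)
  have hM : Submonoid.powers G ≤ nonZeroDivisors (MvPolynomial (Fin n) k) :=
    powers_le_nonZeroDivisors_of_noZeroDivisors hG0
  have hdisj : Disjoint (Submonoid.powers G : Set (MvPolynomial (Fin n) k)) p :=
    (Ideal.disjoint_powers_iff_notMem G hp.isRadical).2 hG
  have hdom : IsDomain (Localization.Away G) := IsLocalization.isDomain_of_le_nonZeroDivisors _ hM
  have hft : Algebra.FiniteType (MvPolynomial (Fin n) k) (Localization.Away G) :=
    IsLocalization.finiteType_of_monoid_fg (Submonoid.powers G) _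
  have : Algebra.FiniteType k (Localization.Away G) :=
    Algebra.FiniteType.trans (S := MvPolynomial (Fin n) k) inferInstance hft
  set P := p.map (algebraMap (MvPolynomial (Fin n) k) (Localization.Away G)) with hP
  have hPp : P.IsPrime := IsLocalization.isPrime_of_isPrime_disjoint (Submonoid.powers G) _ p hp hdisj
  have h1 := hF.trdeg_quotient_add_le (k := k) s (by simpa using hs) P (by
    intro a ha
    obtain ⟨j, hj, rfl⟩ := List.mem_take_iff_getElem.1 ha
    simp only [List.getElem_ofFn]
    exact Ideal.mem_map_of_mem _ (hFp _ (by simp at hj ⊢; omega)))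
  have hcomap : P.comap (algebraMap (MvPolynomial (Fin n) k) (Localization.Away G)) = p :=
    IsLocalization.under_map_of_isPrime_disjoint (Submonoid.powers G) _ hp hdisj
  have h2 : Algebra.trdeg k (MvPolynomial (Fin n) k ⧸ p) ≤
      Algebra.trdeg k (Localization.Away G ⧸ P) :=
    trdeg_le_of_injective (Ideal.quotientMapₐ (I := p) P
      (IsScalarTower.toAlgHom k (MvPolynomial (Fin n) k) (Localization.Away G)) hcomap.ge)
      (Ideal.quotientMap_injective' (H := hcomap.ge) hcomap.le)
  have h3 : Algebra.trdeg k (Localization.Away G) = n := by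
    have hinj : FaithfulSMul (MvPolynomial (Fin n) k) (Localization.Away G) :=
      (faithfulSMul_iff_algebraMap_injective _ _).2 (IsLocalization.injective _ hM)
    have : Algebra.IsAlgebraic (MvPolynomial (Fin n) k) (Localization.Away G) :=
      IsLocalization.isAlgebraic _ (Submonoid.powers G)
    rw [← trdeg_add_eq k (MvPolynomial (Fin n) k) (A := Localization.Away G),
      trdeg_eq_zero (R := MvPolynomial (Fin n) k)]
    simp
  calc _ ≤ Algebra.trdeg k (Localization.Away G ⧸ P) + s := by gcongr
    _ ≤ _ := h1
    _ = n := h3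

theorem trdeg_of_mem_minimalPrimes_vanishingIdeal {F : Fin r → MvPolynomial (Fin n) k}
    {G : MvPolynomial (Fin n) k} (hF : IsReducedRegularSequence F G)
    {s : ℕ} (hs : s ≤ r) {p : Ideal (MvPolynomial (Fin n) k)}
    (hp : p ∈ (vanishingIdeal k (closedVariety K F G s) :
      Ideal (MvPolynomial (Fin n) k)).minimalPrimes) :
    Algebra.trdeg k (MvPolynomial (Fin n) k ⧸ p) = (n - s : ℕ) := by
  obtain ⟨h1, h2⟩ := mem_minimalPrimes_vanishingIdeal_closedVariety hp
  have := h1.1.1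
  have h3 := le_trdeg_of_mem_minimalPrimes h1
  have h4 := trdeg_quotient_add_le_of_regular hF.regular.toIsWeaklyRegular hs h2
    fun i hi => h1.1.2 (Ideal.subset_span ⟨i, hi, rfl⟩)
  obtain ⟨m, hm, -⟩ := exists_trdeg_eq_and_ringKrullDim_eq k (MvPolynomial (Fin n) k ⧸ p)
  rw [hm] at h3 h4 ⊢
  norm_cast at h3 h4 ⊢
  omega

theorem ringKrullDim_of_mem_minimalPrimes_vanishingIdeal {F : Fin r → MvPolynomial (Fin n) k}
    {G : MvPolynomial (Fin n) k} (hF : IsReducedRegularSequence F G)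
    {s : ℕ} (hs : s ≤ r) {p : Ideal (MvPolynomial (Fin n) k)}
    (hp : p ∈ (vanishingIdeal k (closedVariety K F G s) :
      Ideal (MvPolynomial (Fin n) k)).minimalPrimes) :
    ringKrullDim (MvPolynomial (Fin n) k ⧸ p) = (n - s : ℕ) := by
  have := hp.1.1
  have h := trdeg_of_mem_minimalPrimes_vanishingIdeal hF hs hp
  obtain ⟨m, hm, hm'⟩ := exists_trdeg_eq_and_ringKrullDim_eq k (MvPolynomial (Fin n) k ⧸ p)
  rw [hm] at h
  norm_cast at h
  rw [hm', h]

/-- `K[X]` is integral over `k[X]`, so passing to the contracted prime preserves the transcendence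
degree over `k`; and a family independent over `K` is independent over `k`. -/
theorem trdeg_quotient_le_of_isAlgebraic [Algebra.IsAlgebraic k K]
    (q : Ideal (MvPolynomial (Fin n) K)) [q.IsPrime] {m : ℕ}
    (h : Algebra.trdeg k (MvPolynomial (Fin n) k ⧸ q.comap (map (algebraMap k K))) = m) :
    Algebra.trdeg K (MvPolynomial (Fin n) K ⧸ q) ≤ m := by
  have hint : (map (σ := Fin n) (algebraMap k K)).IsIntegral := by
    intro x
    induction x using MvPolynomial.induction_on with
    | C a =>
      obtain ⟨P, hP, hPa⟩ := Algebra.IsIntegral.isIntegral (R := k) a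
      refine ⟨P.map C, hP.map _, ?_⟩
      rw [Polynomial.eval₂_map]
      have : (map (σ := Fin n) (algebraMap k K)).comp C = C.comp (algebraMap k K) := by
        ext; simp
      rw [this, ← Polynomial.hom_eval₂, hPa, map_zero]
    | add p q hp hq => exact hp.add _ hq
    | mul_X p i hp => exact hp.mul _ (map_X (algebraMap k K) i ▸
        RingHom.isIntegralElem_map _)
  set g : MvPolynomial (Fin n) k →ₐ[k] MvPolynomial (Fin n) K := mapAlgHom (Algebra.ofId k K)
  have hg : g.toRingHom = map (algebraMap k K) := by ext <;> simp [g]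
  have hgi : g.toRingHom.IsIntegral := hg ▸ hint
  have h1 := Algebra.lift_trdeg_eq_of_isIntegral (k := k)
    (Ideal.quotientMapₐ (I := q.comap g.toRingHom) q g le_rfl)
    (Ideal.quotientMap_injective (I := q) (f := g.toRingHom))
    hgi.quotient
  have h0 : Algebra.trdeg k (MvPolynomial (Fin n) k ⧸ q.comap g.toRingHom) = m := by
    rw [← h, hg]
  rw [h0] at h1
  simp only [Cardinal.lift_natCast] at h1
  rw [← Cardinal.lift_eq_nat_iff.1 h1, Algebra.trdeg]
  refine ciSup_le' fun s => ?_
  exact (s.2.restrictScalars (FaithfulSMul.algebraMap_injective k K)).cardinalMk_le_trdeg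

/-- Krull's bound applies directly over `K`. Regularity is known only over `k`, so the other bound
is taken at the contracted prime and transferred. -/
theorem trdeg_of_mem_minimalPrimes_vanishingIdeal' [Algebra.IsAlgebraic k K]
    {F : Fin r → MvPolynomial (Fin n) k}
    {G : MvPolynomial (Fin n) k} (hF : IsReducedRegularSequence F G) (hrn : r ≤ n)
    {s : ℕ} (hs : s ≤ r) {p : Ideal (MvPolynomial (Fin n) K)}
    (hp : p ∈ (vanishingIdeal K (closedVariety K F G s)).minimalPrimes) :
    Algebra.trdeg K (MvPolynomial (Fin n) K ⧸ p) = (n - s : ℕ) := by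
  have hp' := hp
  rw [← closedVariety_map] at hp
  obtain ⟨h1, h2⟩ := mem_minimalPrimes_vanishingIdeal_closedVariety hp
  have := h1.1.1
  have h3 := le_trdeg_of_mem_minimalPrimes h1
  have h4 := trdeg_quotient_add_le_of_regular hF.regular.toIsWeaklyRegular hs
    (p := p.comap (map (algebraMap k K))) h2
    fun i hi => h1.1.2 (Ideal.subset_span ⟨i, hi, rfl⟩)
  obtain ⟨m, hm, -⟩ := exists_trdeg_eq_and_ringKrullDim_eq k
    (MvPolynomial (Fin n) k ⧸ p.comap (map (algebraMap k K)))
  obtain ⟨m', hm', -⟩ := exists_trdeg_eq_and_ringKrullDim_eq K (MvPolynomial (Fin n) K ⧸ p)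
  have h5 := trdeg_quotient_le_of_isAlgebraic (k := k) p hm
  rw [hm'] at h3 h5 ⊢
  rw [hm] at h4
  norm_cast at h3 h4 h5 ⊢
  omega

end Variety

end NoetherPrim

end

/-! ### The ideal of relations between generic linear forms and their values. -/

noncomputable section

namespace NoetherPrim

open MvPolynomial

/-- The variables of a Chow form: `(i, some j)` is the `j`-th coefficient of the `i`-th linear form
and `(i, none)` is its value. -/
abbrev ChowVar (d n : ℕ) : Type := Fin (d + 1) × Option (Fin n)

/-- The variable for the value of the last linear form. -/
abbrev ChowVar.top (d n : ℕ) : ChowVar d n := (Fin.last d, none)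

/-- The family of coordinates with coefficients `lam` and values `y`. -/
def chowCoord {R : Type*} {d n : ℕ} (lam : Matrix (Fin (d + 1)) (Fin n) R) (y : Fin (d + 1) → R) :
    ChowVar d n → R :=
  fun b => b.2.elim (y b.1) (lam b.1)

@[simp] theorem chowCoord_some {R : Type*} {d n : ℕ} (lam : Matrix (Fin (d + 1)) (Fin n) R)
    (y : Fin (d + 1) → R) (i : Fin (d + 1)) (j : Fin n) : chowCoord lam y (i, some j) = lam i j :=
  rfl

@[simp] theorem chowCoord_none {R : Type*} {d n : ℕ} (lam : Matrix (Fin (d + 1)) (Fin n) R)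
    (y : Fin (d + 1) → R) (i : Fin (d + 1)) : chowCoord lam y (i, none) = y i :=
  rfl

theorem chowCoord_eta {R : Type*} {d n : ℕ} (z : ChowVar d n → R) :
    chowCoord (.of fun i j => z (i, some j)) (fun i => z (i, none)) = z := by
  ext ⟨i, j⟩
  cases j <;> rfl

section

variable {K : Type*} [Field K] {d n : ℕ}

open Matrix in
/-- The ideal of the relations between the coefficients of `d + 1` linear forms and their values at
the points of `V`. -/
def chowIdeal (d : ℕ) (V : Set (Fin n → K)) : Ideal (MvPolynomial (ChowVar d n) K) :=
  vanishingIdeal K {z | ∃ lam : Matrix (Fin (d + 1)) (Fin n) K, ∃ x ∈ V,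
    z = chowCoord lam (lam *ᵥ x)}

open Matrix in
theorem mem_chowIdeal {V : Set (Fin n → K)} {P : MvPolynomial (ChowVar d n) K} :
    P ∈ chowIdeal d V ↔ ∀ lam : Matrix (Fin (d + 1)) (Fin n) K, ∀ x ∈ V,
      eval (chowCoord lam (lam *ᵥ x)) P = 0 := by
  simp only [chowIdeal, mem_vanishingIdeal_iff, Set.mem_ofPred_eq, forall_exists_index, and_imp,
    aeval_eq_eval]
  constructor
  · intro h lam x hx
    exact h _ lam x hx rfl
  · rintro h _ lam x hx rfl
    exact h lam x hx

/-- The homomorphism evaluating the last group of variables at the generic linear forms. -/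
def chowHom (d : ℕ) (J : Ideal (MvPolynomial (Fin n) K)) :
    MvPolynomial (ChowVar d n) K →ₐ[K]
      MvPolynomial (Fin (d + 1) × Fin n) (MvPolynomial (Fin n) K ⧸ J) :=
  aeval (chowCoord (.of fun i j => X (i, j))
    (fun i => ∑ j, X (i, j) * C (Ideal.Quotient.mk J (X j))))

theorem chowHom_X_some (J : Ideal (MvPolynomial (Fin n) K)) (i : Fin (d + 1)) (j : Fin n) :
    chowHom d J (X (i, some j)) = X (i, j) := by
  simp [chowHom]

theorem chowHom_X_none (J : Ideal (MvPolynomial (Fin n) K)) (i : Fin (d + 1)) :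
    chowHom d J (X (i, none)) = ∑ j, X (i, j) * C (Ideal.Quotient.mk J (X j)) := by
  simp [chowHom]

/-- Evaluation of the coordinate ring at a point. -/
def evalQuot (J : Ideal (MvPolynomial (Fin n) K)) (x : Fin n → K) (hx : x ∈ zeroLocus K J) :
    (MvPolynomial (Fin n) K ⧸ J) →ₐ[K] K :=
  Ideal.Quotient.liftₐ J (aeval x) hx

@[simp] theorem evalQuot_mk (J : Ideal (MvPolynomial (Fin n) K)) (x : Fin n → K)
    (hx : x ∈ zeroLocus K J) (f : MvPolynomial (Fin n) K) :
    evalQuot J x hx (Ideal.Quotient.mk J f) = eval x f :=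
  rfl

open Matrix in
theorem eval_map_chowHom (J : Ideal (MvPolynomial (Fin n) K)) (x : Fin n → K)
    (hx : x ∈ zeroLocus K J) (lam : Matrix (Fin (d + 1)) (Fin n) K)
    (P : MvPolynomial (ChowVar d n) K) :
    eval (fun ij => lam ij.1 ij.2) (map (evalQuot J x hx).toRingHom (chowHom d J P)) =
      eval (chowCoord lam (lam *ᵥ x)) P := by
  have : ((aeval (R := K) (fun ij : Fin (d + 1) × Fin n => lam ij.1 ij.2)).comp
      ((mapAlgHom (evalQuot J x hx)).comp (chowHom d J))) =
      aeval (chowCoord lam (lam *ᵥ x)) := by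
    ext ⟨i, j⟩
    cases j with
    | none => simp [chowHom_X_none, mulVec, dotProduct]
    | some j => simp [chowHom_X_some]
  exact congr($this P)

/-- A polynomial in `Λ` over the coordinate ring vanishes as soon as it does at all points and all
matrices. Writing the ideal as a kernel gives its primality for irreducible sets and makes
integrality arguments available. -/
theorem ker_chowHom [Infinite K] (J : Ideal (MvPolynomial (Fin n) K))
    (hJ : vanishingIdeal K (zeroLocus K J) = J) :
    RingHom.ker (chowHom d J) = chowIdeal d (zeroLocus K J) := by
  ext P
  rw [RingHom.mem_ker, mem_chowIdeal]
  constructor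
  · intro h lam x hx
    rw [← eval_map_chowHom J x hx, h, map_zero, map_zero]
  · intro h
    have h1 : ∀ x (hx : x ∈ zeroLocus K J),
        map (evalQuot J x hx).toRingHom (chowHom d J P) = 0 := by
      intro x hx
      apply MvPolynomial.funext
      intro z
      have := h (.of fun i j => z (i, j)) x hx
      rw [← eval_map_chowHom J x hx] at this
      simpa using this
    ext s
    rw [coeff_zero]
    obtain ⟨f, hf⟩ := Ideal.Quotient.mk_surjective (coeff s (chowHom d J P))
    rw [← hf, Ideal.Quotient.eq_zero_iff_mem, ← hJ]
    intro x hx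
    have := congr(coeff s $(h1 x hx))
    rw [coeff_map, ← hf, coeff_zero] at this
    simpa using this

theorem chowIdeal_isPrime [IsAlgClosed K] (q : Ideal (MvPolynomial (Fin n) K)) [q.IsPrime] :
    (chowIdeal d (zeroLocus K q)).IsPrime := by
  have := IsAlgClosed.instInfinite (K := K)
  rw [← ker_chowHom q (IsPrime.vanishingIdeal_zeroLocus q)]
  exact RingHom.ker_isPrime _

theorem exists_algebraicIndependent_coord (q : Ideal (MvPolynomial (Fin n) K)) [q.IsPrime]
    (hq : Algebra.trdeg K (MvPolynomial (Fin n) K ⧸ q) = d) :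
    ∃ κ : Fin d → Fin n, AlgebraicIndependent K
      (fun i => Ideal.Quotient.mk q (X (κ i) : MvPolynomial (Fin n) K)) := by
  set s : Set (MvPolynomial (Fin n) K ⧸ q) :=
    Set.range fun j => Ideal.Quotient.mk q (X j : MvPolynomial (Fin n) K) with hs
  have hadj : Algebra.adjoin K s = ⊤ := by
    have h1 : s = Ideal.Quotient.mkₐ K q '' Set.range X := by
      rw [hs, ← Set.range_comp]; rfl
    rw [h1, ← AlgHom.map_adjoin, adjoin_range_X, Algebra.map_top, AlgHom.range_eq_top]
    exact Ideal.Quotient.mkₐ_surjective K q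
  have : Algebra.IsAlgebraic (Algebra.adjoin K s) (MvPolynomial (Fin n) K ⧸ q) := by
    constructor
    intro x
    exact isAlgebraic_algebraMap (⟨x, hadj ▸ Algebra.mem_top⟩ : Algebra.adjoin K s)
  obtain ⟨t, hts, ht⟩ := exists_isTranscendenceBasis_subset (R := K) s
  have hcard := ht.cardinalMk_eq_trdeg
  rw [hq] at hcard
  obtain ⟨e⟩ : Nonempty (Fin d ≃ t) := by
    have : Cardinal.mk t = Cardinal.lift (Cardinal.mk (Fin d)) := by simp [hcard]
    rw [← Cardinal.lift_mk_eq']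
    simp [hcard]
  choose κ hκ using fun i => hts (e i).2
  refine ⟨κ, ?_⟩
  have h2 := ht.1.comp e e.injective
  convert h2 using 2 with i
  exact hκ i

open Matrix in
-- This expresses the independence of `d` generic forms on a set of dimension `d`. The matrix is
-- degenerated along a line to one whose first `d` rows select independent coordinates; a nonzero
-- relation would degenerate, after division by a power of the parameter, to a nonzero relation
-- between those coordinates.
theorem eq_zero_of_mem_chowIdeal_of_degreeOf_eq_zero [IsAlgClosed K]
    (q : Ideal (MvPolynomial (Fin n) K)) [q.IsPrime]
    (hq : Algebra.trdeg K (MvPolynomial (Fin n) K ⧸ q) = d)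
    {P : MvPolynomial (ChowVar d n) K} (hP : P ∈ chowIdeal d (zeroLocus K q))
    (hdeg : P.degreeOf (ChowVar.top d n) = 0) : P = 0 := by
  classical
  have := IsAlgClosed.instInfinite (K := K)
  rw [mem_chowIdeal] at hP
  obtain ⟨κ, hκ⟩ := exists_algebraicIndependent_coord q hq
  have hvars : ChowVar.top d n ∉ P.vars := by
    rwa [vars_def, Multiset.mem_toFinset, ← Multiset.count_eq_zero, ← degreeOf_def]
  have hP' : ∀ (lam : Matrix (Fin (d + 1)) (Fin n) K) (x) (_ : x ∈ zeroLocus K q)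
      (y : Fin (d + 1) → K), (∀ i : Fin d, y i.castSucc = (lam *ᵥ x) i.castSucc) →
      eval (chowCoord lam y) P = 0 := by
    intro lam x hx y hy
    rw [← hP lam x hx]
    refine eval₂Hom_congr' rfl ?_ rfl
    rintro ⟨i, j⟩ hb -
    cases j with
    | some j => rfl
    | none =>
      induction i using Fin.lastCases with
      | last => exact absurd hb hvars
      | cast i => exact hy i
  by_contra hP0
  obtain ⟨z, hz⟩ : ∃ z, eval z P ≠ 0 := by
    by_contra! h
    exact hP0 (MvPolynomial.funext fun z => by rw [h z, map_zero])
  -- The line `E + τ M` joins the coordinate rows at `τ = 0` to the coefficients of `z` at `τ = 1`,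
  -- where `P` does not vanish; hence `Ψ P ≠ 0`.
  set E : Matrix (Fin (d + 1)) (Fin n) K :=
    fun i => Fin.lastCases 0 (fun i => Pi.single (κ i) 1) i with hE
  set M : Matrix (Fin (d + 1)) (Fin n) K := fun i j => z (i, some j) - E i j with hM
  set Ψ : MvPolynomial (ChowVar d n) K →ₐ[K] Polynomial (MvPolynomial (Fin d) K) :=
    aeval (chowCoord (.of fun i j => Polynomial.C (C (E i j)) + Polynomial.X * Polynomial.C (C (M i j)))
      (fun i => Fin.lastCases (Polynomial.C (C (z (Fin.last d, none))))
        (fun i => Polynomial.C (X i)) i)) with hΨ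
  have hp0 : Ψ P ≠ 0 := by
    intro h0
    refine hz ?_
    have h1 : ((aeval (R := K) fun i : Fin d => z (i.castSucc, none)).toRingHom.comp
        ((Polynomial.evalRingHom 1).comp Ψ.toRingHom)) = (aeval (R := K) z).toRingHom := by
      apply MvPolynomial.ringHom_ext
      · intro r; simp [hΨ]
      · rintro ⟨i, j⟩
        cases j with
        | some j => simp [hΨ, hM]
        | none =>
          induction i using Fin.lastCases with
          | last => simp [hΨ]
          | cast i => simp [hΨ]
    have := congr($h1 P)
    simpa [h0] using this.symm
  -- Removing the largest power of `τ` leaves a nonzero value at `τ = 0`.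
  set r := (Ψ P).natTrailingDegree with hr
  obtain ⟨p', hp'⟩ : Polynomial.X ^ r ∣ Ψ P := by
    rw [Polynomial.X_pow_dvd_iff]
    intro e he
    exact Polynomial.coeff_eq_zero_of_lt_natTrailingDegree he
  have hc : p'.coeff 0 ≠ 0 := by
    have h1 : (Ψ P).coeff r = p'.coeff 0 := by
      rw [hp', Polynomial.coeff_X_pow_mul', if_pos le_rfl, Nat.sub_self]
    rw [← h1]
    exact Polynomial.trailingCoeff_nonzero_iff_nonzero.2 hp0
  refine hc ?_
  rw [algebraicIndependent_iff] at hκ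
  refine hκ _ ?_
  have h2 : aeval (fun i => Ideal.Quotient.mk q (X (κ i) : MvPolynomial (Fin n) K)) (p'.coeff 0) =
      Ideal.Quotient.mk q (rename κ (p'.coeff 0)) := by
    have : aeval (fun i => Ideal.Quotient.mk q (X (κ i) : MvPolynomial (Fin n) K)) =
        (Ideal.Quotient.mkₐ K q).comp (rename κ) := by
      ext; simp
    rw [this]; rfl
  rw [h2, Ideal.Quotient.eq_zero_iff_mem, ← IsPrime.vanishingIdeal_zeroLocus (K := K) q]
  intro x hx
  rw [aeval_rename]
  -- For a point `x` of the set, `θ` replaces each value by that of the moving linear form at `x`,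
  -- so that `θ (Ψ P)` is `P` along a curve on which it vanishes.
  set θ : Polynomial (MvPolynomial (Fin d) K) →+* Polynomial K :=
    Polynomial.eval₂RingHom (aeval (R := K) fun i : Fin d =>
      Polynomial.C ((E *ᵥ x) i.castSucc) + Polynomial.X * Polynomial.C ((M *ᵥ x) i.castSucc)
      ).toRingHom Polynomial.X with hθ
  have h3 : θ (Ψ P) = 0 := by
    apply Polynomial.funext
    intro τ
    rw [Polynomial.eval_zero]
    set y : Fin (d + 1) → K := Fin.lastCases (z (Fin.last d, none))
      (fun i => ((E + τ • M) *ᵥ x) i.castSucc) with hy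
    have h4 : (Polynomial.evalRingHom τ).comp (θ.comp Ψ.toRingHom) =
        eval (chowCoord (E + τ • M) y) := by
      apply MvPolynomial.ringHom_ext
      · intro r; simp [hΨ, hθ]
      · rintro ⟨i, j⟩
        cases j with
        | some j => simp only [hΨ, hθ]; simp; ring
        | none =>
          induction i using Fin.lastCases with
          | last => simp [hΨ, hθ, hy]
          | cast i => simp [hΨ, hθ, hy, add_mulVec, smul_mulVec]; ring
    have h5 := congr($h4 P)
    rw [hP' _ x hx y (fun i => by simp [hy])] at h5
    exact h5
  rw [hp', map_mul, map_pow] at h3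
  have h6 : θ p' = 0 := by
    refine (mul_eq_zero.1 h3).resolve_left (pow_ne_zero _ ?_)
    simp [hθ, Polynomial.X_ne_zero]
  have h7 : (Polynomial.evalRingHom 0).comp θ =
      (eval (x ∘ κ)).comp (Polynomial.evalRingHom (0 : MvPolynomial (Fin d) K)) := by
    apply Polynomial.ringHom_ext
    · intro a
      induction a using MvPolynomial.induction_on with
      | C a => simp [hθ]
      | add p q hp hq => simp only [map_add, hp, hq]
      | mul_X p i hp =>
        rw [map_mul, map_mul, hp, map_mul]
        simp [hθ, hE, mulVec, dotProduct, Pi.single_apply]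
    · simp [hθ]
  have h8 := congr($h7 p')
  rw [RingHom.comp_apply, h6, map_zero] at h8
  simp only [RingHom.comp_apply, Polynomial.coe_evalRingHom, ← Polynomial.coeff_zero_eq_eval_zero]
    at h8
  exact h8.symm

end

end NoetherPrim

end

/-! ### Chow relations as polynomials in the last value, and their leading coefficients. -/

noncomputable section

namespace NoetherPrim

open MvPolynomial

section toTop

variable {R : Type*} [CommRing R] {d n : ℕ}

/-- The variables of a Chow form other than the value of the last linear form. -/
abbrev ChowVar' (d n : ℕ) : Type := {b : ChowVar d n // b ≠ ChowVar.top d n}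

/-- A Chow form as a polynomial in the value of the last linear form. -/
def toTop (R : Type*) [CommRing R] (d n : ℕ) :
    MvPolynomial (ChowVar d n) R ≃ₐ[R] Polynomial (MvPolynomial (ChowVar' d n) R) :=
  (renameEquiv R (Equiv.optionSubtypeNe (ChowVar.top d n)).symm).trans (optionEquivLeft R _)

@[simp] theorem toTop_X_top : toTop R d n (X (ChowVar.top d n)) = Polynomial.X := by
  simp [toTop, optionEquivLeft_X_none]

theorem toTop_X_of_ne (b : ChowVar' d n) : toTop R d n (X b.1) = Polynomial.C (X b) := by
  simp [toTop, Equiv.optionSubtypeNe_symm_of_ne b.2, optionEquivLeft_X_some]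

@[simp] theorem toTop_symm_X : (toTop R d n).symm Polynomial.X = X (ChowVar.top d n) := by
  rw [AlgEquiv.symm_apply_eq, toTop_X_top]

theorem toTop_symm_C (p : MvPolynomial (ChowVar' d n) R) :
    (toTop R d n).symm (Polynomial.C p) = rename Subtype.val p := by
  have : ((toTop R d n).symm.toAlgHom.toRingHom.comp Polynomial.C) =
      (rename (R := R) (Subtype.val : ChowVar' d n → ChowVar d n)).toRingHom := by
    apply MvPolynomial.ringHom_ext
    · intro r
      exact ((toTop R d n).symm.commutes r).trans
        ((rename (R := R) (Subtype.val : ChowVar' d n → ChowVar d n)).commutes r).symm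
    · intro b
      have := toTop_X_of_ne (R := R) b
      simp [← this]
  exact congr($this p)

theorem natDegree_toTop (P : MvPolynomial (ChowVar d n) R) :
    (toTop R d n P).natDegree = P.degreeOf (ChowVar.top d n) := by
  classical
  rw [degreeOf_eq_natDegree]
  rfl

/-- The multi-index on all variables given by the exponent of the last value and the other ones. -/
def topExp (e : ℕ) (t : ChowVar' d n →₀ ℕ) : ChowVar d n →₀ ℕ :=
  (t.optionElim e).equivMapDomain (Equiv.optionSubtypeNe (ChowVar.top d n))

@[simp] theorem topExp_top (e : ℕ) (t : ChowVar' d n →₀ ℕ) :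
    topExp e t (ChowVar.top d n) = e := by
  simp [topExp, Finsupp.equivMapDomain_apply]

theorem topExp_of_ne (e : ℕ) (t : ChowVar' d n →₀ ℕ) (b : ChowVar' d n) :
    topExp e t b.1 = t b := by
  simp [topExp, Finsupp.equivMapDomain_apply, Equiv.optionSubtypeNe_symm_of_ne b.2]

theorem coeff_coeff_toTop (P : MvPolynomial (ChowVar d n) R) (e : ℕ) (t : ChowVar' d n →₀ ℕ) :
    coeff t ((toTop R d n P).coeff e) = coeff (topExp e t) P := by
  simp only [toTop, AlgEquiv.trans_apply, optionEquivLeft_coeff_coeff, renameEquiv_apply]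
  have := coeff_rename_mapDomain (Equiv.optionSubtypeNe (ChowVar.top d n)).symm
    (Equiv.optionSubtypeNe (ChowVar.top d n)).symm.injective P (topExp e t)
  rw [← this, topExp, Finsupp.equivMapDomain_eq_mapDomain, ← Finsupp.mapDomain_comp]
  simp

theorem eval₂_toTop {S : Type*} [CommRing S] [Algebra R S]
    (φ : MvPolynomial (ChowVar d n) R →ₐ[R] S)
    (P : MvPolynomial (ChowVar d n) R) :
    (toTop R d n P).eval₂ (φ.comp (rename Subtype.val)).toRingHom (φ (X (ChowVar.top d n))) =
      φ P := by
  obtain ⟨p, rfl⟩ := (toTop R d n).symm.surjective P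
  rw [AlgEquiv.apply_symm_apply]
  have : (Polynomial.eval₂RingHom (φ.comp (rename Subtype.val)).toRingHom
      (φ (X (ChowVar.top d n)))) = φ.toRingHom.comp (toTop R d n).symm.toAlgHom.toRingHom := by
    apply Polynomial.ringHom_ext
    · intro a
      simp [toTop_symm_C]
    · simp
  exact congr($this p)

end toTop

theorem isIntegralElem_sum {ι R S : Type*} [CommRing R] [CommRing S] {f : R →+* S} (t : Finset ι)
    (g : ι → S) (hg : ∀ i ∈ t, f.IsIntegralElem (g i)) : f.IsIntegralElem (∑ i ∈ t, g i) := by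
  classical
  induction t using Finset.induction_on with
  | empty => simpa using f.isIntegralElem_zero
  | insert a t ha ih =>
    rw [Finset.sum_insert ha]
    exact RingHom.IsIntegralElem.add f (hg a (Finset.mem_insert_self a t))
      (ih fun i hi => hg i (Finset.mem_insert_of_mem hi))

section leading

variable {K : Type*} [Field K] {d n : ℕ}

/-- The `dn` coefficients and `d` values of the first `d` forms, together with one coordinate, are
`dn + d + 1` elements in a ring of transcendence degree `dn + d`. -/
theorem isAlgebraic_generic_linear_forms [IsAlgClosed K]
    (q : Ideal (MvPolynomial (Fin n) K)) [q.IsPrime]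
    (hq : Algebra.trdeg K (MvPolynomial (Fin n) K ⧸ q) = d)
    (j : Fin n) : ∃ p : Polynomial (MvPolynomial (Fin d × Option (Fin n)) K), p ≠ 0 ∧
      p.eval₂ ((chowHom d q).comp (rename (Prod.map Fin.castSucc id))).toRingHom
        (C (Ideal.Quotient.mk q (X j))) = 0 := by
  set y : Option (Fin d × Option (Fin n)) →
      MvPolynomial (Fin d × Fin n) (MvPolynomial (Fin n) K ⧸ q) := fun o => o.elim
    (C (Ideal.Quotient.mk q (X j)))
    (fun b => b.2.elim (∑ l, X (b.1, l) * C (Ideal.Quotient.mk q (X l))) (fun l => X (b.1, l)))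
    with hy
  have hnot : ¬ AlgebraicIndependent K y := by
    intro h
    have h1 := h.lift_cardinalMk_le_trdeg
    have h2 : Algebra.trdeg K (MvPolynomial (Fin d × Fin n) (MvPolynomial (Fin n) K ⧸ q)) = (d + d * n : ℕ) := by
      rw [← trdeg_add_eq K (MvPolynomial (Fin n) K ⧸ q), hq, trdeg_of_isDomain]
      simp
    rw [h2] at h1
    simp only [Cardinal.mk_option, Cardinal.mk_prod, Cardinal.mk_fin, Cardinal.lift_natCast,
      Cardinal.lift_add, Cardinal.lift_mul, Cardinal.lift_one] at h1
    norm_cast at h1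
    nlinarith
  rw [algebraicIndependent_iff] at hnot
  push Not at hnot
  obtain ⟨P, hP, hP0⟩ := hnot
  refine ⟨optionEquivLeft K _ P, by simpa using hP0, ?_⟩
  set ι : MvPolynomial (Fin d × Fin n) (MvPolynomial (Fin n) K ⧸ q) →ₐ[K]
      MvPolynomial (Fin (d + 1) × Fin n) (MvPolynomial (Fin n) K ⧸ q) :=
    (rename (R := MvPolynomial (Fin n) K ⧸ q) (Prod.map Fin.castSucc id)).restrictScalars K
  have key : (Polynomial.eval₂RingHom ((chowHom d q).comp (rename (Prod.map Fin.castSucc id))).toRingHom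
        (C (Ideal.Quotient.mk q (X j)))).comp (optionEquivLeft K _).toAlgHom.toRingHom =
      ι.toRingHom.comp (aeval y).toRingHom := by
    apply MvPolynomial.ringHom_ext
    · intro r
      simp [optionEquivLeft_C, ι]
    · rintro (_ | ⟨i, _ | l⟩)
      · simp [optionEquivLeft_X_none, ι, hy]
      · simp [optionEquivLeft_X_some, ι, hy, chowHom_X_none]
      · simp [optionEquivLeft_X_some, ι, hy, chowHom_X_some]
  have := congr($key P)
  simpa [hP] using this

/-- A nonzero `α` built from the first `d` rows makes every `α x_j` integral, hence also `α` times
the last generic form. Substituting `α T` into a monic equation for the latter gives a relation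
whose leading coefficient is a power of `α`. -/
theorem exists_mem_chowIdeal_leadingCoeff [IsAlgClosed K]
    (q : Ideal (MvPolynomial (Fin n) K)) [q.IsPrime]
    (hq : Algebra.trdeg K (MvPolynomial (Fin n) K ⧸ q) = d) :
    ∃ f ∈ chowIdeal d (zeroLocus K q), f ≠ 0 ∧
      ∀ b : ChowVar' d n, b.1.1 = Fin.last d → ((toTop K d n f).leadingCoeff).degreeOf b = 0 := by
  classical
  have := IsAlgClosed.instInfinite (K := K)
  set ψ : MvPolynomial (Fin d × Option (Fin n)) K →ₐ[K]
      MvPolynomial (Fin (d + 1) × Fin n) (MvPolynomial (Fin n) K ⧸ q) :=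
    (chowHom d q).comp (rename (Prod.map Fin.castSucc id)) with hψ
  set u : Fin d × Option (Fin n) → ChowVar' d n := fun b =>
    ⟨(b.1.castSucc, b.2), fun h => (Fin.castSucc_lt_last b.1).ne congr(($h).1)⟩ with hu
  have hu' : (Subtype.val ∘ u) = Prod.map Fin.castSucc id := rfl
  set ψ' : MvPolynomial (ChowVar' d n) K →ₐ[K]
      MvPolynomial (Fin (d + 1) × Fin n) (MvPolynomial (Fin n) K ⧸ q) := (chowHom d q).comp (rename Subtype.val) with hψ'
  have hψψ' : ψ = ψ'.comp (rename u) := by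
    rw [hψ, hψ', AlgHom.comp_assoc]
    congr 1
    apply algHom_ext
    intro b
    simp only [AlgHom.comp_apply, rename_X]
    rfl
  have hint : ∀ j, ∃ a : MvPolynomial (Fin d × Option (Fin n)) K, a ≠ 0 ∧
      ψ.toRingHom.IsIntegralElem (ψ a * C (Ideal.Quotient.mk q (X j))) := by
    intro j
    obtain ⟨p, hp, hp0⟩ := isAlgebraic_generic_linear_forms q hq j
    let _ := ψ.toRingHom.toAlgebra
    have : IsAlgebraic (MvPolynomial (Fin d × Option (Fin n)) K)
        (C (Ideal.Quotient.mk q (X j)) :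
        MvPolynomial (Fin (d + 1) × Fin n) (MvPolynomial (Fin n) K ⧸ q)) := ⟨p, hp, hp0⟩
    obtain ⟨a, ha, ha'⟩ := this.exists_integral_multiple
    refine ⟨a, ha, ?_⟩
    rw [Algebra.smul_def] at ha'
    exact ha'
  choose a ha0 ha using hint
  set α := ∏ j, a j with hα
  have hα0 : α ≠ 0 := Finset.prod_ne_zero_iff.2 fun j _ => ha0 j
  have hint2 : ∀ j, ψ'.toRingHom.IsIntegralElem
      (ψ' (rename u α) * C (Ideal.Quotient.mk q (X j))) := by
    intro j
    have h1 : ψ.toRingHom.IsIntegralElem (ψ α * C (Ideal.Quotient.mk q (X j))) := by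
      rw [hα, ← Finset.mul_prod_erase Finset.univ a (Finset.mem_univ j), map_mul,
        mul_comm (ψ (a j)), mul_assoc]
      exact RingHom.IsIntegralElem.mul (R := MvPolynomial (Fin d × Option (Fin n)) K)
        (S := MvPolynomial (Fin (d + 1) × Fin n) (MvPolynomial (Fin n) K ⧸ q))
        ψ.toRingHom (RingHom.isIntegralElem_map _) (ha j)
    have h2 : ψ.toRingHom = ψ'.toRingHom.comp (rename u).toRingHom := by rw [hψψ']; rfl
    obtain ⟨p, hp, hp0⟩ := h1
    refine ⟨p.map (rename u).toRingHom, hp.map _, ?_⟩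
    rw [Polynomial.eval₂_map, ← h2]
    rw [← hp0, hψψ']
    rfl
  have hint3 : ψ'.toRingHom.IsIntegralElem
      (ψ' (rename u α) * chowHom d q (X (ChowVar.top d n))) := by
    rw [chowHom_X_none, Finset.mul_sum]
    have : ∀ j, ψ' (rename u α) * (X (Fin.last d, j) * C (Ideal.Quotient.mk q (X j))) =
        ψ' (X ⟨(Fin.last d, some j), by simp⟩) *
          (ψ' (rename u α) * C (Ideal.Quotient.mk q (X j))) := by
      intro j
      simp only [hψ', AlgHom.comp_apply, rename_X, chowHom_X_some]
      ring
    simp only [this]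
    refine isIntegralElem_sum (R := MvPolynomial (ChowVar' d n) K)
      (S := MvPolynomial (Fin (d + 1) × Fin n) (MvPolynomial (Fin n) K ⧸ q)) (f := ψ'.toRingHom)
      _ _ fun j _ => ?_
    exact RingHom.IsIntegralElem.mul (R := MvPolynomial (ChowVar' d n) K)
      (S := MvPolynomial (Fin (d + 1) × Fin n) (MvPolynomial (Fin n) K ⧸ q)) ψ'.toRingHom (RingHom.isIntegralElem_map _) (hint2 j)
  obtain ⟨M, hM, hM0⟩ := hint3
  set α' := rename u α with hα'
  have hα'0 : α' ≠ 0 := by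
    rwa [hα', Ne, map_eq_zero_iff _ (rename_injective u ?_)]
    intro b c hbc
    have h1 := congr(($hbc).1)
    simp only [hu, Prod.mk.injEq, Fin.castSucc_inj] at h1
    exact Prod.ext h1.1 h1.2
  set f' := M.comp (Polynomial.C α' * Polynomial.X) with hf'
  have hlc : f'.leadingCoeff = α' ^ M.natDegree := by
    rw [hf', Polynomial.leadingCoeff_comp, hM.leadingCoeff]
    · simp
    · rw [Polynomial.natDegree_C_mul_X _ hα'0]; exact one_ne_zero
  refine ⟨(toTop K d n).symm f', ?_, ?_, ?_⟩
  · rw [← ker_chowHom q (IsPrime.vanishingIdeal_zeroLocus q), RingHom.mem_ker]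
    refine (eval₂_toTop (R := K)
      (S := MvPolynomial (Fin (d + 1) × Fin n) (MvPolynomial (Fin n) K ⧸ q)) (chowHom d q) _).symm.trans ?_
    rw [AlgEquiv.apply_symm_apply, hf', Polynomial.eval₂_comp]
    have h1 : ((Polynomial.C α' * Polynomial.X).eval₂ ψ'.toRingHom
        (chowHom d q (X (ChowVar.top d n)))) = ψ' α' * chowHom d q (X (ChowVar.top d n)) := by
      rw [Polynomial.eval₂_mul, Polynomial.eval₂_C, Polynomial.eval₂_X]
      rfl
    rw [← hM0, ← h1]
  · rw [Ne, map_eq_zero_iff _ (toTop K d n).symm.injective]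
    intro h0
    rw [h0, Polynomial.leadingCoeff_zero] at hlc
    exact pow_ne_zero _ hα'0 hlc.symm
  · intro b hb
    rw [AlgEquiv.apply_symm_apply, hlc]
    refine Nat.eq_zero_of_le_zero ((degreeOf_pow_le _ _ _).trans ?_)
    have : degreeOf b α' = 0 := by
      rw [degreeOf_def, Multiset.count_eq_zero, ← Multiset.mem_toFinset, ← vars_def]
      intro hmem
      have := vars_rename u α hmem
      rw [Finset.mem_image] at this
      obtain ⟨c, -, rfl⟩ := this
      exact (Fin.castSucc_lt_last c.1).ne hb
    simp [this]

end leading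

end NoetherPrim

end

/-! ### Consequences of Gauss's lemma over a factorial ring. -/

/-- The hypothesis says that `I` is contracted from the polynomial ring over the fraction field.
There Euclidean division shows that an element of least degree generates, and its primitive part
then generates over `A`. -/
theorem Polynomial.exists_eq_span_singleton_of_torsionFree {A : Type*} [CommRing A] [IsDomain A]
    [UniqueFactorizationMonoid A] (I : Ideal (Polynomial A))
    (hI : ∀ (c : A) (f : Polynomial A), c ≠ 0 → C c * f ∈ I → f ∈ I) :
    ∃ F, I = Ideal.span {F} := by
  classical
  by_cases h0 : I = ⊥
  · exact ⟨0, by simp [h0]⟩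
  let _ : StrongNormalizationMonoid A := UniqueFactorizationMonoid.strongNormalizationMonoid
  let _ : NormalizedGCDMonoid A := UniqueFactorizationMonoid.toNormalizedGCDMonoid A
  obtain ⟨f, hfI, hf0⟩ := Submodule.exists_mem_ne_zero_of_ne_bot h0
  have hex : ∃ m, ∃ f ∈ I, f ≠ 0 ∧ f.natDegree = m := ⟨_, f, hfI, hf0, rfl⟩
  obtain ⟨g, hgI, hg0, hg⟩ := Nat.find_spec hex
  have hmin : ∀ h ∈ I, h.natDegree < g.natDegree → h = 0 := by
    intro h hh hlt
    by_contra hne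
    exact Nat.find_min hex (hg ▸ hlt) ⟨h, hh, hne, rfl⟩
  set F := g.primPart with hF
  have hFI : F ∈ I := by
    refine hI g.content F (content_eq_zero_iff.not.2 hg0) ?_
    rwa [hF, ← eq_C_content_mul_primPart]
  have hFdeg : F.natDegree = g.natDegree := natDegree_primPart g
  have hFprim : F.IsPrimitive := isPrimitive_primPart g
  refine ⟨F, le_antisymm ?_ ((Ideal.span_singleton_le_iff_mem I).2 hFI)⟩
  intro h hh
  rw [Ideal.mem_span_singleton]
  set Q := FractionRing A
  refine IsPrimitive.dvd_of_fraction_map_dvd_fraction_map (K := Q) hFprim ?_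
  set φ := algebraMap A Q
  have hφ : Function.Injective φ := IsFractionRing.injective A Q
  set q := h.map φ / F.map φ with hq
  obtain ⟨b, hb, hbq⟩ := IsLocalization.integerNormalization_spec (nonZeroDivisors A) q
  set q' := IsLocalization.integerNormalization (nonZeroDivisors A) q
  have hb0 : b ≠ 0 := nonZeroDivisors.ne_zero hb
  have hr : (C b * h - F * q').map φ = C (φ b) * (h.map φ % F.map φ) := by
    rw [Polynomial.map_sub, Polynomial.map_mul, Polynomial.map_mul, hbq, Polynomial.map_C,
      Algebra.smul_def]
    have h1 := EuclideanDomain.div_add_mod (h.map φ) (F.map φ)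
    have h2 : algebraMap A (Polynomial Q) b = C (φ b) := rfl
    rw [h2]
    linear_combination (-C (φ b)) * h1
  -- The strict degree bound on remainders needs positive degree; a primitive constant is a unit.
  by_cases hd : F.natDegree = 0
  · have hu : IsUnit F := by
      rw [eq_C_of_natDegree_eq_zero hd] at hFprim ⊢
      exact isUnit_C.2 (hFprim _ dvd_rfl)
    obtain ⟨v, hv⟩ := hu.dvd (a := h)
    exact ⟨v.map φ, by rw [hv, Polynomial.map_mul]⟩
  have hz : C b * h - F * q' = 0 := by
    refine hmin _ (I.sub_mem (I.mul_mem_left _ hh) (I.mul_mem_right _ hFI)) ?_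
    rw [← natDegree_map_eq_of_injective hφ, hr, ← hFdeg]
    refine (natDegree_C_mul_le _ _).trans_lt ?_
    have := natDegree_mod_lt (h.map φ) (q := F.map φ)
      (by rwa [natDegree_map_eq_of_injective hφ])
    rwa [natDegree_map_eq_of_injective hφ F] at this
  rw [hz, Polynomial.map_zero, eq_comm, mul_eq_zero] at hr
  have hb' : C (φ b) ≠ 0 := by simpa [φ] using hb0
  exact EuclideanDomain.mod_eq_zero.1 (hr.resolve_left hb')

/-- A common irreducible factor over the fraction field has, after clearing denominators and
content, a primitive representative, which is a common prime factor over `A`. -/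
theorem Polynomial.isCoprime_map_of_forall_prime {A : Type*} [CommRing A] [IsDomain A]
    [UniqueFactorizationMonoid A] (Q : Type*) [Field Q] [Algebra A Q] [IsFractionRing A Q]
    {f g : Polynomial A} (hf : f ≠ 0)
    (h : ∀ z : Polynomial A, Prime z → z ∣ f → ¬ z ∣ g) :
    IsCoprime (f.map (algebraMap A Q)) (g.map (algebraMap A Q)) := by
  classical
  let _ : StrongNormalizationMonoid A := UniqueFactorizationMonoid.strongNormalizationMonoid
  let _ : NormalizedGCDMonoid A := UniqueFactorizationMonoid.toNormalizedGCDMonoid A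
  have hφ : Function.Injective (algebraMap A Q) := IsFractionRing.injective A Q
  refine isCoprime_of_irreducible_dvd ?_ ?_
  · rintro ⟨h0, -⟩
    exact hf ((Polynomial.map_eq_zero_iff hφ).1 h0)
  intro z hz hzf hzg
  obtain ⟨b, hb, hbz⟩ := IsLocalization.integerNormalization_spec (nonZeroDivisors A) z
  set w := IsLocalization.integerNormalization (nonZeroDivisors A) z
  have hb0 : b ≠ 0 := nonZeroDivisors.ne_zero hb
  have hw0 : w ≠ 0 := by
    rw [Ne, IsLocalization.integerNormalization_eq_zero_iff le_rfl]
    exact hz.ne_zero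
  have hassoc : Associated (w.primPart.map (algebraMap A Q)) z := by
    have h1 : C (algebraMap A Q b) * z =
        C (algebraMap A Q w.content) * w.primPart.map (algebraMap A Q) := by
      have h2 := congr(Polynomial.map (algebraMap A Q) $(eq_C_content_mul_primPart w))
      rw [hbz, Polynomial.map_mul, Polynomial.map_C, Algebra.smul_def] at h2
      exact h2
    have hu1 : IsUnit (C (algebraMap A Q b)) :=
      isUnit_C.2 (IsUnit.mk0 _ (by simpa using hb0))
    have hu2 : IsUnit (C (algebraMap A Q w.content)) :=
      isUnit_C.2 (IsUnit.mk0 _ (by simpa [content_eq_zero_iff] using hw0))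
    have h3 := (associated_unit_mul_left z _ hu1)
    rw [h1] at h3
    exact (associated_unit_mul_left _ _ hu2).symm.trans h3
  have hprim := isPrimitive_primPart w
  have hirr : Irreducible w.primPart := by
    rw [hprim.irreducible_iff_irreducible_map_fraction_map (K := Q)]
    exact hassoc.irreducible_iff.2 hz
  refine h w.primPart hirr.prime ?_ ?_
  · exact hprim.dvd_of_fraction_map_dvd_fraction_map (K := Q) (hassoc.dvd.trans hzf)
  · exact hprim.dvd_of_fraction_map_dvd_fraction_map (K := Q) (hassoc.dvd.trans hzg)

/-! ### Chow forms of closed sets of pure dimension. -/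

noncomputable section

namespace NoetherPrim

open MvPolynomial

section

variable {K : Type*} [Field K] {d n : ℕ}

/-- A closed subset of affine space all of whose irreducible components have dimension `d`. -/
structure IsPure (d : ℕ) (V : Set (Fin n → K)) : Prop where
  zeroLocus_eq : zeroLocus K (vanishingIdeal K V) = V
  trdeg_eq : ∀ q ∈ (vanishingIdeal K V).minimalPrimes,
    Algebra.trdeg K (MvPolynomial (Fin n) K ⧸ q) = d

theorem zeroLocus_minimalPrime_subset {V : Set (Fin n → K)}
    (hV : zeroLocus K (vanishingIdeal K V) = V) {q : Ideal (MvPolynomial (Fin n) K)}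
    (hq : q ∈ (vanishingIdeal K V).minimalPrimes) : zeroLocus K q ⊆ V := by
  rw [← hV]
  exact zeroLocus_anti_mono hq.1.2

theorem exists_minimalPrime_of_mem {V : Set (Fin n → K)} {x : Fin n → K} (hx : x ∈ V) :
    ∃ q ∈ (vanishingIdeal K V).minimalPrimes, x ∈ zeroLocus K q := by
  have : (RingHom.ker (eval x)).IsPrime := RingHom.ker_isPrime _
  obtain ⟨q, hq, hle⟩ := Ideal.exists_minimalPrimes_le (I := vanishingIdeal K V)
    (J := RingHom.ker (eval x)) (fun f hf => hf x hx)
  exact ⟨q, hq, fun f hf => hle hf⟩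

theorem mem_chowIdeal_iff_forall_minimalPrimes {V : Set (Fin n → K)}
    (hV : zeroLocus K (vanishingIdeal K V) = V) {P : MvPolynomial (ChowVar d n) K} :
    P ∈ chowIdeal d V ↔
      ∀ q ∈ (vanishingIdeal K V).minimalPrimes, P ∈ chowIdeal d (zeroLocus K q) := by
  simp only [mem_chowIdeal]
  constructor
  · intro h q hq lam x hx
    exact h lam x (zeroLocus_minimalPrime_subset hV hq hx)
  · intro h lam x hx
    obtain ⟨q, hq, hxq⟩ := exists_minimalPrime_of_mem hx
    exact h q hq lam x hxq

theorem degreeOf_toTop_symm_C (c : MvPolynomial (ChowVar' d n) K) :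
    ((toTop K d n).symm (Polynomial.C c)).degreeOf (ChowVar.top d n) = 0 := by
  rw [← natDegree_toTop, AlgEquiv.apply_symm_apply, Polynomial.natDegree_C]

/-- On each component the ideal is prime and contains no nonzero polynomial free of the last value,
which is the torsion-freeness needed for the ideal to be principal. -/
theorem exists_chowIdeal_eq_span [IsAlgClosed K] {V : Set (Fin n → K)} (hV : IsPure d V) :
    ∃ F, chowIdeal d V = Ideal.span {F} := by
  obtain ⟨F, hF⟩ := Polynomial.exists_eq_span_singleton_of_torsionFree
    ((chowIdeal d V).comap (toTop K d n).symm) (by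
      intro c f hc hcf
      rw [Ideal.mem_comap, mem_chowIdeal_iff_forall_minimalPrimes hV.zeroLocus_eq] at hcf ⊢
      intro q hq
      have := hq.1.1
      have h1 := hcf q hq
      have := chowIdeal_isPrime (d := d) q
      rw [map_mul] at h1
      refine (Ideal.IsPrime.mem_or_mem this h1).resolve_left fun h2 => hc ?_
      have h3 := eq_zero_of_mem_chowIdeal_of_degreeOf_eq_zero q (hV.trdeg_eq q hq) h2
        (degreeOf_toTop_symm_C c)
      simpa using h3)
  refine ⟨(toTop K d n).symm F, ?_⟩
  have h1 : (Ideal.span {F}).comap (toTop K d n) = chowIdeal d V := by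
    rw [← hF]
    ext P
    simp [Ideal.mem_comap]
  rw [← h1]
  ext P
  simp only [Ideal.mem_comap, Ideal.mem_span_singleton]
  constructor
  · rintro ⟨Q, hQ⟩
    exact ⟨(toTop K d n).symm Q, by rw [← map_mul, ← hQ, AlgEquiv.symm_apply_apply]⟩
  · rintro ⟨Q, rfl⟩
    exact ⟨toTop K d n Q, by rw [map_mul, AlgEquiv.apply_symm_apply]⟩

/-- A Chow form of `V`: a generator of the ideal `chowIdeal d V`. -/
def IsChowForm (V : Set (Fin n → K)) (F : MvPolynomial (ChowVar d n) K) : Prop :=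
  chowIdeal d V = Ideal.span {F}

theorem IsChowForm.mem_iff {V : Set (Fin n → K)} {F : MvPolynomial (ChowVar d n) K}
    (hF : IsChowForm V F) {P : MvPolynomial (ChowVar d n) K} : P ∈ chowIdeal d V ↔ F ∣ P := by
  rw [hF, Ideal.mem_span_singleton]

open Matrix in
theorem IsChowForm.eval_eq_zero {V : Set (Fin n → K)} {F : MvPolynomial (ChowVar d n) K}
    (hF : IsChowForm V F) (lam : Matrix (Fin (d + 1)) (Fin n) K) {x : Fin n → K} (hx : x ∈ V) :
    eval (chowCoord lam (lam *ᵥ x)) F = 0 :=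
  mem_chowIdeal.1 (hF.mem_iff.2 dvd_rfl) lam x hx

theorem exists_mem_chowIdeal_leadingCoeff_of_isPure [IsAlgClosed K] {V : Set (Fin n → K)}
    (hV : IsPure d V) :
    ∃ f ∈ chowIdeal d V, f ≠ 0 ∧
      ∀ b : ChowVar' d n, b.1.1 = Fin.last d → ((toTop K d n f).leadingCoeff).degreeOf b = 0 := by
  classical
  have hfin : (vanishingIdeal K V).minimalPrimes.Finite :=
    Ideal.finite_minimalPrimes_of_isNoetherianRing _ _
  have hex : ∀ q : hfin.toFinset, ∃ f ∈ chowIdeal d (zeroLocus K q.1), f ≠ 0 ∧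
      ∀ b : ChowVar' d n, b.1.1 = Fin.last d →
        ((toTop K d n f).leadingCoeff).degreeOf b = 0 := by
    rintro ⟨q, hq⟩
    rw [Set.Finite.mem_toFinset] at hq
    have := hq.1.1
    exact exists_mem_chowIdeal_leadingCoeff q (hV.trdeg_eq q hq)
  choose f hf hf0 hfd using hex
  refine ⟨∏ q, f q, ?_, Finset.prod_ne_zero_iff.2 fun q _ => hf0 q, ?_⟩
  · rw [mem_chowIdeal_iff_forall_minimalPrimes hV.zeroLocus_eq]
    intro q hq
    exact Ideal.mem_of_dvd _ (Finset.dvd_prod_of_mem f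
      (Finset.mem_univ (⟨q, hfin.mem_toFinset.2 hq⟩ : hfin.toFinset))) (hf ⟨q, hfin.mem_toFinset.2 hq⟩)
  · intro b hb
    have h1 : (toTop K d n (∏ q, f q)).leadingCoeff = ∏ q, (toTop K d n (f q)).leadingCoeff := by
      rw [← Polynomial.leadingCoeff_prod]
      exact congrArg _ (map_prod (toTop K d n) f Finset.univ)
    rw [h1]
    refine Nat.eq_zero_of_le_zero ((degreeOf_prod_le b Finset.univ _).trans ?_)
    exact (Finset.sum_eq_zero fun q _ => hfd q b hb).le

theorem IsChowForm.ne_zero [IsAlgClosed K] {V : Set (Fin n → K)}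
    (hV : IsPure d V) {F : MvPolynomial (ChowVar d n) K} (hF : IsChowForm V F) : F ≠ 0 := by
  rintro rfl
  obtain ⟨f, hf, hf0, -⟩ := exists_mem_chowIdeal_leadingCoeff_of_isPure hV
  exact hf0 (zero_dvd_iff.1 (hF.mem_iff.1 hf))

/-- The Chow form divides a relation with this property, and leading coefficients multiply while
degrees add. -/
theorem IsChowForm.degreeOf_leadingCoeff [IsAlgClosed K] {V : Set (Fin n → K)}
    (hV : IsPure d V) {F : MvPolynomial (ChowVar d n) K} (hF : IsChowForm V F)
    (b : ChowVar' d n) (hb : b.1.1 = Fin.last d) :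
    ((toTop K d n F).leadingCoeff).degreeOf b = 0 := by
  obtain ⟨f, hf, hf0, hfd⟩ := exists_mem_chowIdeal_leadingCoeff_of_isPure hV
  obtain ⟨g, rfl⟩ := hF.mem_iff.1 hf
  have h := hfd b hb
  rw [map_mul, Polynomial.leadingCoeff_mul, degreeOf_mul_eq] at h
  · exact (Nat.add_eq_zero_iff.1 h).1
  · simpa using left_ne_zero_of_mul hf0
  · simpa using right_ne_zero_of_mul hf0

end

end NoetherPrim

end

/-! ### Degree bounds under substitution, and weighted scaling of variables. -/

namespace MvPolynomial

variable {σ τ R : Type*} [CommRing R]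

theorem totalDegree_aeval_le_of_totalDegree_le_one (g : σ → MvPolynomial τ R)
    (hg : ∀ i, (g i).totalDegree ≤ 1) (P : MvPolynomial σ R) :
    (aeval g P).totalDegree ≤ P.totalDegree := by
  rw [aeval_def, eval₂_eq]
  refine totalDegree_finsetSum_le fun m hm => ?_
  refine (totalDegree_mul _ _).trans ?_
  rw [algebraMap_eq, totalDegree_C, zero_add]
  refine (totalDegree_finsetProd _ _).trans ?_
  refine le_trans ?_ (le_totalDegree hm)
  refine Finset.sum_le_sum fun i _ => ?_
  refine (totalDegree_pow _ _).trans ?_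
  simpa using Nat.mul_le_mul_left (m i) (hg i)

/-- The homomorphism multiplying the variable `X i` by `t ^ w i`. -/
noncomputable def scaleHom (R : Type*) [CommRing R] {σ : Type*} (w : σ → ℕ) :
    MvPolynomial σ R →ₐ[R] Polynomial (MvPolynomial σ R) :=
  aeval fun b => Polynomial.X ^ w b * Polynomial.C (X b)

variable [Fintype σ]

theorem scaleHom_monomial (w : σ → ℕ) (m : σ →₀ ℕ) (c : R) :
    scaleHom R w (monomial m c) = Polynomial.monomial (∑ b, w b * m b) (monomial m c) := by
  rw [scaleHom, aeval_monomial, Finsupp.prod_fintype _ _ (by simp)]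
  simp only [mul_pow, Finset.prod_mul_distrib, ← pow_mul, Finset.prod_pow_eq_pow_sum]
  rw [← Polynomial.C_mul_X_pow_eq_monomial, monomial_eq, Finsupp.prod_fintype _ _ (by simp)]
  simp only [map_mul, map_prod, map_pow]
  have : algebraMap R (Polynomial (MvPolynomial σ R)) c = Polynomial.C (C c) := rfl
  rw [this]
  ring

theorem coeff_coeff_scaleHom (w : σ → ℕ) (P : MvPolynomial σ R) (N : ℕ) (m : σ →₀ ℕ) :
    coeff m ((scaleHom R w P).coeff N) = if ∑ b, w b * m b = N then coeff m P else 0 := by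
  classical
  induction P using MvPolynomial.induction_on' with
  | monomial u a =>
    rw [scaleHom_monomial, Polynomial.coeff_monomial]
    by_cases hu : u = m
    · subst hu
      split_ifs <;> simp
    · have : ∀ a : R, coeff m (monomial u a) = 0 := fun a => by rw [coeff_monomial, if_neg hu]
      split_ifs <;> simp [this]
  | add p q hp hq =>
    rw [map_add, Polynomial.coeff_add, coeff_add, hp, hq, coeff_add]
    split_ifs <;> simp

theorem eval_map_scaleHom (w : σ → ℕ) (P : MvPolynomial σ R) (z : σ → R) (t : R) :
    ((scaleHom R w P).map (eval z)).eval t = eval (fun b => t ^ w b * z b) P := by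
  have : ((Polynomial.evalRingHom t).comp ((Polynomial.mapRingHom (eval z)).comp
      (scaleHom R w).toRingHom)) = eval (fun b => t ^ w b * z b) := by
    apply ringHom_ext
    · intro r
      have : algebraMap R (Polynomial (MvPolynomial σ R)) r = Polynomial.C (C r) := rfl
      simp [scaleHom, this]
    · intro i
      simp [scaleHom, mul_comm (z i)]
  exact congr($this P)

theorem coeff_aeval_scale (w : σ → ℕ) (P : MvPolynomial σ R) (t : R) (m : σ →₀ ℕ) :
    coeff m (aeval (fun b => C (t ^ w b) * X b) P : MvPolynomial σ R) =
      t ^ (∑ b, w b * m b) * coeff m P := by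
  classical
  induction P using MvPolynomial.induction_on' with
  | monomial u a =>
    have : (aeval (fun b => C (t ^ w b) * X b) (monomial u a) : MvPolynomial σ R) =
        C (t ^ (∑ b, w b * u b)) * monomial u a := by
      rw [aeval_monomial, Finsupp.prod_fintype _ _ (by simp), monomial_eq,
        Finsupp.prod_fintype _ _ (by simp)]
      simp only [mul_pow, Finset.prod_mul_distrib, ← map_pow, ← pow_mul]
      rw [← map_prod, Finset.prod_pow_eq_pow_sum, algebraMap_eq]
      ring
    rw [this, coeff_C_mul, coeff_monomial]
    split_ifs with h
    · rw [h]
    · simp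
  | add p q hp hq => rw [map_add, coeff_add, hp, hq, coeff_add, mul_add]

end MvPolynomial

/-! ### Homogeneity of Chow forms from row operations. -/

noncomputable section

namespace NoetherPrim

open MvPolynomial

section

variable {K : Type*} [Field K] {d n : ℕ}

/-- The action of a matrix on the polynomials in the coordinates of `d + 1` linear forms and
their values. -/
def chowAct (g : Matrix (Fin (d + 1)) (Fin (d + 1)) K) :
    MvPolynomial (ChowVar d n) K →ₐ[K] MvPolynomial (ChowVar d n) K :=
  aeval fun b => ∑ i, C (g b.1 i) * X (i, b.2)

theorem eval_chowAct (g : Matrix (Fin (d + 1)) (Fin (d + 1)) K) (z : ChowVar d n → K)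
    (P : MvPolynomial (ChowVar d n) K) :
    eval z (chowAct g P) = eval (fun b => ∑ i, g b.1 i * z (i, b.2)) P := by
  have : (aeval (R := K) z).comp (chowAct g) = aeval fun b => ∑ i, g b.1 i * z (i, b.2) := by
    ext b
    simp [chowAct]
  exact congr($this P)

theorem chowAct_chowAct [Infinite K] (g h : Matrix (Fin (d + 1)) (Fin (d + 1)) K)
    (P : MvPolynomial (ChowVar d n) K) : chowAct g (chowAct h P) = chowAct (h * g) P := by
  apply MvPolynomial.funext
  intro z
  simp only [eval_chowAct]
  congr 2
  ext b
  simp only [Matrix.mul_apply, Finset.mul_sum, Finset.sum_mul]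
  rw [Finset.sum_comm]
  simp only [mul_assoc]

theorem chowAct_one (P : MvPolynomial (ChowVar d n) K) : chowAct 1 P = P := by
  have : chowAct (n := n) (1 : Matrix (Fin (d + 1)) (Fin (d + 1)) K) = AlgHom.id K _ := by
    ext b
    simp [chowAct, Matrix.one_apply]
  rw [this, AlgHom.id_apply]

theorem totalDegree_chowAct_le (g : Matrix (Fin (d + 1)) (Fin (d + 1)) K)
    (P : MvPolynomial (ChowVar d n) K) : (chowAct g P).totalDegree ≤ P.totalDegree := by
  refine totalDegree_aeval_le_of_totalDegree_le_one _ (fun b => ?_) P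
  refine totalDegree_finsetSum_le fun i _ => ?_
  refine (totalDegree_mul _ _).trans ?_
  simp

open Matrix in
-- Row operations transform coefficients and values alike: `g (λ x) = (g λ) x`.
theorem chowAct_mem_chowIdeal {V : Set (Fin n → K)} (g : Matrix (Fin (d + 1)) (Fin (d + 1)) K)
    {P : MvPolynomial (ChowVar d n) K} (hP : P ∈ chowIdeal d V) : chowAct g P ∈ chowIdeal d V := by
  rw [mem_chowIdeal] at hP ⊢
  intro lam x hx
  rw [eval_chowAct, ← hP (g * lam) x hx]
  congr 2
  ext ⟨i, j⟩
  cases j with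
  | none => simp [← mulVec_mulVec, mulVec, dotProduct]
  | some j => simp [Matrix.mul_apply]

theorem eq_C_mul_of_dvd_of_totalDegree_le {σ : Type*} {P Q : MvPolynomial σ K} (h : P ∣ Q)
    (hd : Q.totalDegree ≤ P.totalDegree) : ∃ c, Q = C c * P := by
  obtain ⟨R, rfl⟩ := h
  by_cases hP : P = 0
  · exact ⟨0, by simp [hP]⟩
  by_cases hR : R = 0
  · exact ⟨0, by simp [hR]⟩
  rw [totalDegree_mul_of_isDomain hP hR] at hd
  have : R.totalDegree = 0 := by omega
  rw [totalDegree_eq_zero_iff_eq_C] at this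
  exact ⟨_, by rw [mul_comm, ← this]⟩

/-- The transformed form is a multiple of the generator and has no larger total degree, so the
cofactor is constant. -/
theorem IsChowForm.exists_chowAct_eq {V : Set (Fin n → K)} {F : MvPolynomial (ChowVar d n) K}
    (hF : IsChowForm V F) (g : Matrix (Fin (d + 1)) (Fin (d + 1)) K) :
    ∃ c : K, chowAct g F = C c * F :=
  eq_C_mul_of_dvd_of_totalDegree_le
    (hF.mem_iff.1 (chowAct_mem_chowIdeal g (hF.mem_iff.2 dvd_rfl))) (totalDegree_chowAct_le g F)

theorem IsChowForm.exists_chowAct_eq_of_mul_eq_one [Infinite K] {V : Set (Fin n → K)}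
    {F : MvPolynomial (ChowVar d n) K} (hF : IsChowForm V F) (hF0 : F ≠ 0)
    {g h : Matrix (Fin (d + 1)) (Fin (d + 1)) K} (hgh : h * g = 1) :
    ∃ c : K, c ≠ 0 ∧ chowAct g F = C c * F := by
  obtain ⟨c, hc⟩ := hF.exists_chowAct_eq g
  obtain ⟨c', hc'⟩ := hF.exists_chowAct_eq h
  refine ⟨c, ?_, hc⟩
  rintro rfl
  have := chowAct_chowAct g h F
  rw [hgh, chowAct_one, hc', map_mul, hc] at this
  exact hF0 (by simpa using this.symm)

theorem IsChowForm.exists_rename_eq [Infinite K] {V : Set (Fin n → K)}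
    {F : MvPolynomial (ChowVar d n) K} (hF : IsChowForm V F) (hF0 : F ≠ 0)
    (π : Equiv.Perm (Fin (d + 1))) :
    ∃ c : K, c ≠ 0 ∧ rename (Prod.map π id) F = C c * F := by
  have h1 : ∀ π : Equiv.Perm (Fin (d + 1)), chowAct (n := n)
      (.of fun i j => if j = π i then (1 : K) else 0) = rename (Prod.map π id) := by
    intro π
    ext b
    simp [chowAct, Prod.map]
  obtain ⟨c, hc⟩ := hF.exists_chowAct_eq (.of fun i j => if j = π i then (1 : K) else 0)
  rw [h1] at hc
  refine ⟨c, ?_, hc⟩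
  rintro rfl
  rw [C_0, zero_mul, map_eq_zero_iff _ (rename_injective _
    (π.injective.prodMap Function.injective_id))] at hc
  exact hF0 hc

theorem sum_indicator_mul (i : Fin (d + 1)) (m : ChowVar d n →₀ ℕ) :
    ∑ b : ChowVar d n, (if b.1 = i then 1 else 0) * m b = ∑ o, m (i, o) := by
  rw [Fintype.sum_prod_type, Finset.sum_eq_single i]
  · simp
  · intro j _ hj
    simp [hj]
  · simp

/-- Scaling row `i` by `t` multiplies a monomial by `t` to its degree in that row. Only a constant
factor may appear, so these powers agree for all `t` in an infinite field. -/
theorem IsChowForm.sum_group_eq [Infinite K] {V : Set (Fin n → K)}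
    {F : MvPolynomial (ChowVar d n) K} (hF : IsChowForm V F)
    (i : Fin (d + 1)) {m m' : ChowVar d n →₀ ℕ} (hm : m ∈ F.support) (hm' : m' ∈ F.support) :
    ∑ o, m (i, o) = ∑ o, m' (i, o) := by
  rw [mem_support_iff] at hm hm'
  set w : ChowVar d n → ℕ := fun b => if b.1 = i then 1 else 0 with hw
  have key : ∀ t : K, ∃ c : K, ∀ m, coeff m F ≠ 0 → t ^ (∑ o, m (i, o)) = c := by
    intro t
    obtain ⟨c, hc⟩ := hF.exists_chowAct_eq (Matrix.diagonal fun j => t ^ (if j = i then 1 else 0))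
    refine ⟨c, fun m hm => ?_⟩
    have h1 : chowAct (n := n) (Matrix.diagonal fun j => t ^ (if j = i then 1 else 0)) =
        aeval (fun b => C (t ^ w b) * X b) := by
      ext1 b
      simp only [chowAct, aeval_X, Matrix.diagonal_apply, hw]
      rw [Finset.sum_eq_single b.1]
      · simp
      · intro j _ hj
        simp [hj.symm]
      · simp
    have h2 := congr(coeff m $hc)
    rw [h1, coeff_aeval_scale, coeff_C_mul, sum_indicator_mul] at h2
    exact mul_right_cancel₀ hm h2
  have h3 : (Polynomial.X ^ (∑ o, m (i, o)) : Polynomial K) =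
      Polynomial.X ^ (∑ o, m' (i, o)) := by
    apply Polynomial.funext
    intro t
    obtain ⟨c, hc⟩ := key t
    simp only [Polynomial.eval_pow, Polynomial.eval_X, hc m hm, hc m' hm']
  have := congr(Polynomial.natDegree $h3)
  simpa using this

variable [IsAlgClosed K]

/-- A monomial of the leading term involves no coefficient of the last row, so its degree in that
row is the exponent of the last value. Permuting rows carries this to the others. -/
theorem IsChowForm.sum_group_eq_degreeOf {V : Set (Fin n → K)} (hV : IsPure d V)
    {F : MvPolynomial (ChowVar d n) K} (hF : IsChowForm V F)
    (i : Fin (d + 1)) {m : ChowVar d n →₀ ℕ} (hm : m ∈ F.support) :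
    ∑ o, m (i, o) = F.degreeOf (ChowVar.top d n) := by
  classical
  have := IsAlgClosed.instInfinite (K := K)
  have hF0 := hF.ne_zero hV
  have hlc : (toTop K d n F).leadingCoeff ≠ 0 := by simpa using hF0
  obtain ⟨t, ht⟩ := ne_zero_iff.1 hlc
  rw [Polynomial.leadingCoeff, natDegree_toTop, coeff_coeff_toTop] at ht
  have hlast : ∀ m ∈ F.support, ∑ o, m (Fin.last d, o) = F.degreeOf (ChowVar.top d n) := by
    intro m hm
    rw [hF.sum_group_eq (Fin.last d) hm (mem_support_iff.2 ht), Fintype.sum_option, topExp_top]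
    convert add_zero _
    refine Finset.sum_eq_zero fun j _ => ?_
    have h1 := hF.degreeOf_leadingCoeff hV ⟨(Fin.last d, some j), by simp⟩ rfl
    have h2 : t ∈ ((toTop K d n F).leadingCoeff).support := by
      rw [mem_support_iff, Polynomial.leadingCoeff, natDegree_toTop, coeff_coeff_toTop]
      exact ht
    have h3 := monomial_le_degreeOf ⟨(Fin.last d, some j), by simp⟩ h2
    rw [h1] at h3
    rw [← Nat.eq_zero_of_le_zero h3]
    exact topExp_of_ne _ t ⟨(Fin.last d, some j), by simp⟩
  set π : Equiv.Perm (Fin (d + 1)) := Equiv.swap i (Fin.last d)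
  obtain ⟨c, hc, hcF⟩ := hF.exists_rename_eq hF0 π
  have hinj : Function.Injective (Prod.map π (id : Option (Fin n) → _)) :=
    π.injective.prodMap Function.injective_id
  have h4 : Finsupp.mapDomain (Prod.map π id) m ∈ F.support := by
    rw [mem_support_iff] at hm ⊢
    intro h0
    have h5 := coeff_rename_mapDomain _ hinj F m
    rw [hcF, coeff_C_mul, h0, mul_zero] at h5
    exact hm h5.symm
  rw [← hlast _ h4]
  refine Finset.sum_congr rfl fun o _ => ?_
  have : ((Fin.last d, o) : ChowVar d n) = Prod.map π id (i, o) := by simp [π]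
  rw [this, Finsupp.mapDomain_apply hinj]

theorem IsChowForm.totalDegree_le {V : Set (Fin n → K)} (hV : IsPure d V)
    {F : MvPolynomial (ChowVar d n) K} (hF : IsChowForm V F) :
    F.totalDegree ≤ (d + 1) * F.degreeOf (ChowVar.top d n) := by
  refine Finset.sup_le fun m hm => ?_
  rw [Finsupp.sum_fintype _ _ (fun _ => rfl), Fintype.sum_prod_type,
    Finset.sum_congr rfl fun i _ => hF.sum_group_eq_degreeOf hV i hm]
  simp

/-- Subtracting multiples of the last row annihilates all other values at a given point and changes
the form only by a nonzero constant. Scaling the values by `t` then yields a polynomial in `t` of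
degree at most that in the last value. -/
theorem IsChowForm.sum_none_le {V : Set (Fin n → K)} (hV : IsPure d V)
    {F : MvPolynomial (ChowVar d n) K} (hF : IsChowForm V F)
    {m : ChowVar d n →₀ ℕ} (hm : m ∈ F.support) :
    ∑ i, m (i, none) ≤ F.degreeOf (ChowVar.top d n) := by
  classical
  have := IsAlgClosed.instInfinite (K := K)
  have hF0 := hF.ne_zero hV
  by_contra! hlt
  set N := ∑ i, m (i, none) with hN
  set w : ChowVar d n → ℕ := fun b => if b.2 = none then 1 else 0 with hw
  have hwm : ∑ b, w b * m b = N := by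
    rw [Fintype.sum_prod_type, hN]
    refine Finset.sum_congr rfl fun i _ => ?_
    simp [hw]
  set H := (scaleHom K w F).coeff N with hH
  have hHm : coeff m H ≠ 0 := by
    rw [hH, coeff_coeff_scaleHom, if_pos hwm]
    exact mem_support_iff.1 hm
  -- The factor restricts attention to points whose last value is nonzero, as the row operation
  -- divides by it.
  suffices H * X (ChowVar.top d n) = 0 by
    rcases mul_eq_zero.1 this with h | h
    · exact hHm (by rw [h, coeff_zero])
    · exact X_ne_zero _ h
  apply MvPolynomial.funext
  intro z
  rw [map_mul, eval_X, map_zero]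
  by_cases hz : z (ChowVar.top d n) = 0
  · rw [hz, mul_zero]
  suffices h : eval z H = 0 by rw [h, zero_mul]
  set p := (scaleHom K w F).map (eval z) with hp
  have hpN : eval z H = p.coeff N := by rw [hp, Polynomial.coeff_map]
  rw [hpN]
  set c : Fin (d + 1) → K := fun i => if i = Fin.last d then 0 else
    z (i, none) / z (ChowVar.top d n) with hc
  set u : Matrix (Fin (d + 1)) (Fin (d + 1)) K :=
    .of fun i j => if j = Fin.last d then c i else 0 with hu
  have huu : u * u = 0 := by
    ext i j
    rw [Matrix.mul_apply, Matrix.zero_apply]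
    refine Finset.sum_eq_zero fun l _ => ?_
    by_cases hl : l = Fin.last d <;> simp [hu, hc, hl]
  obtain ⟨χ, hχ, hχF⟩ := hF.exists_chowAct_eq_of_mul_eq_one hF0 (g := 1 - u) (h := 1 + u) (by
    rw [add_mul, mul_sub, mul_sub, huu]; simp)
  -- The scaled point after the row operation: only the last value survives, and it carries `t`.
  set v : ChowVar d n → Polynomial K := fun b =>
    if b = ChowVar.top d n then Polynomial.C (z b) * Polynomial.X else
      if b.2 = none then 0 else Polynomial.C (∑ i, (1 - u) b.1 i * z (i, b.2)) with hv
  have hq : Polynomial.C χ * p = aeval v F := by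
    apply Polynomial.funext
    intro t
    have h1 : eval (fun b => t ^ w b * z b) (chowAct (1 - u) F) =
        eval (fun b => (v b).eval t) F := by
      rw [eval_chowAct]
      congr 2
      ext ⟨i, o⟩
      simp only [Matrix.sub_apply, sub_mul, Finset.sum_sub_distrib, Matrix.one_apply, hu, hv, hw,
        Matrix.of_apply, ite_mul, zero_mul, one_mul, Finset.sum_ite_eq', Finset.sum_ite_eq,
        Finset.mem_univ, if_true]
      cases o with
      | some j => simp
      | none =>
        by_cases hi : i = Fin.last d
        · subst hi
          simp [hc, mul_comm (z _)]
        · have hne : ((i, none) : ChowVar d n) ≠ ChowVar.top d n := fun h => hi congr(($h).1)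
          rw [if_neg hne]
          simp only [hc, hi, if_true, if_false, pow_one, Polynomial.eval_zero]
          field_simp
          simp
    rw [hχF, map_mul, eval_C] at h1
    rw [Polynomial.eval_mul, Polynomial.eval_C, hp, eval_map_scaleHom, h1]
    have h2 : ((Polynomial.evalRingHom t).comp (aeval (R := K) v).toRingHom) =
        eval (fun b => (v b).eval t) := by
      apply ringHom_ext
      · intro r; simp
      · intro b; simp
    exact congr($h2 F).symm
  have hdeg : (aeval v F : Polynomial K).natDegree ≤ F.degreeOf (ChowVar.top d n) := by
    set v' : ChowVar' d n → K := fun b => (v b.1).coeff 0 with hv'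
    have h1 : ((aeval (R := K) v).comp (rename Subtype.val)).toRingHom =
        Polynomial.C.comp (eval v') := by
      apply ringHom_ext
      · intro r; simp
      · intro b
        have : v b.1 = Polynomial.C (v' b) := by
          simp only [hv', hv, if_neg b.2]
          split_ifs <;> simp
        simp [this]
    rw [← eval₂_toTop (aeval (R := K) v) F, h1, ← Polynomial.eval₂_map]
    have h2 : aeval (R := K) v (X (ChowVar.top d n)) =
        Polynomial.C (z (ChowVar.top d n)) * Polynomial.X := by
      simp [hv]
    rw [h2, ← natDegree_toTop]
    refine (Polynomial.natDegree_comp_le (p := (toTop K d n F).map (eval v'))).trans ?_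
    refine (Nat.mul_le_mul Polynomial.natDegree_map_le (Polynomial.natDegree_C_mul_le _ _)).trans ?_
    rw [Polynomial.natDegree_X, mul_one]
  rw [← hq, Polynomial.natDegree_C_mul hχ] at hdeg
  exact Polynomial.coeff_eq_zero_of_natDegree_lt (hdeg.trans_lt hlt)

end

end NoetherPrim

end

/-! ### Partial derivatives and degrees of determinants. -/

namespace MvPolynomial

variable {σ K : Type*} [Field K]

theorem natCast_eq_zero_of_pderiv_eq_zero {F : MvPolynomial σ K} {i : σ} (h : pderiv i F = 0)
    {m : σ →₀ ℕ} (hm : m ∈ F.support) : (m i : K) = 0 := by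
  classical
  rcases Nat.eq_zero_or_pos (m i) with h0 | h0
  · rw [h0, Nat.cast_zero]
  have h1 : m - Finsupp.single i 1 + Finsupp.single i 1 = m :=
    tsub_add_cancel_of_le (Finsupp.single_le_iff.2 h0)
  have h2 := coeff_pderiv (i := i) F (m - Finsupp.single i 1)
  rw [h, coeff_zero, h1] at h2
  have h3 := (mul_eq_zero.1 h2.symm).resolve_left (mem_support_iff.1 hm)
  have h4 : (m - Finsupp.single i 1 : σ →₀ ℕ) i + 1 = m i := by
    simp; omega
  rw [← h4]
  exact_mod_cast h3

/-- If all partial derivatives vanish, then in characteristic `p` all exponents are divisible by `p`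
and all coefficients are `p`-th powers, so the polynomial is a `p`-th power; in characteristic zero
it is constant. -/
theorem exists_pderiv_ne_zero_of_irreducible [IsAlgClosed K] {F : MvPolynomial σ K}
    (hF : Irreducible F) : ∃ i, pderiv i F ≠ 0 := by
  classical
  by_contra! h
  have hcast : ∀ m ∈ F.support, ∀ i, (m i : K) = 0 := fun m hm i =>
    natCast_eq_zero_of_pderiv_eq_zero (h i) hm
  obtain ⟨p, hp⟩ := CharP.exists K
  rcases CharP.char_is_prime_or_zero K p with hprime | rfl
  · have hp' : Fact p.Prime := ⟨hprime⟩
    choose root hroot using fun x : K => IsAlgClosed.exists_pow_nat_eq x hprime.pos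
    set G : MvPolynomial σ K := ∑ m ∈ F.support,
      monomial (m.mapRange (· / p) (Nat.zero_div p)) (root (coeff m F)) with hG
    have hFG : F = G ^ p := by
      rw [hG, sum_pow_char]
      conv_lhs => rw [F.as_sum]
      refine Finset.sum_congr rfl fun m hm => ?_
      have h1 : p • m.mapRange (· / p) (Nat.zero_div p) = m := by
        ext i
        have : p ∣ m i := (CharP.cast_eq_zero_iff K p (m i)).1 (hcast m hm i)
        simp [Nat.mul_div_cancel' this]
      rw [monomial_pow, hroot, h1]
    rw [hFG] at hF
    exact not_irreducible_pow hprime.ne_one hF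
  · have : CharZero K := CharP.charP_to_charZero K
    have h1 : F = C (coeff 0 F) := by
      ext m
      rw [coeff_C]
      split_ifs with h0
      · rw [h0]
      · by_contra hm
        refine h0 ?_
        ext i
        exact (Nat.cast_eq_zero.1 (hcast m (mem_support_iff.2 hm) i)).symm
    have h2 : coeff 0 F ≠ 0 := by
      intro h0
      rw [h0, C_0] at h1
      exact hF.ne_zero h1
    refine hF.not_isUnit ?_
    rw [h1]
    exact (IsUnit.mk0 _ h2).map C

theorem pderiv_eq_zero_of_dvd {F : MvPolynomial σ K} {i : σ} (h : F ∣ pderiv i F) :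
    pderiv i F = 0 := by
  classical
  by_contra h0
  have h1 := totalDegree_le_of_dvd_of_isDomain h h0
  obtain ⟨m, hm, hdeg⟩ := Finset.exists_mem_eq_sup (pderiv i F).support
    (support_nonempty.2 h0) (fun s => s.sum fun _ e => e)
  have h2 : m + Finsupp.single i 1 ∈ F.support := by
    rw [mem_support_iff] at hm ⊢
    rw [coeff_pderiv] at hm
    exact left_ne_zero_of_mul hm
  have h3 := le_totalDegree h2
  rw [Finsupp.sum_add_index' (fun _ => rfl) (fun _ _ _ => rfl), Finsupp.sum_single_index rfl] at h3
  have h4 : (pderiv i F).totalDegree = m.sum fun _ e => e := hdeg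
  omega

theorem derivative_aeval [Fintype σ]
    (v : σ → Polynomial K) (P : MvPolynomial σ K) :
    Polynomial.derivative (aeval v P) =
      ∑ b, aeval v (pderiv b P) * Polynomial.derivative (v b) := by
  classical
  induction P using MvPolynomial.induction_on with
  | C a => simp
  | add p q hp hq => simp [hp, hq, add_mul, Finset.sum_add_distrib]
  | mul_X p i hp =>
    have h1 : ∀ b, aeval v (pderiv b (p * X i)) * Polynomial.derivative (v b) =
        aeval v (pderiv b p) * Polynomial.derivative (v b) * v i +
          if b = i then aeval v p * Polynomial.derivative (v i) else 0 := by
      intro b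
      rw [pderiv_mul, map_add, map_mul, map_mul, aeval_X, pderiv_X]
      by_cases hb : b = i
      · subst hb
        rw [Pi.single_eq_same, map_one, if_pos rfl]
        ring
      · rw [Pi.single_eq_of_ne (fun h => hb h.symm), map_zero, if_neg hb]
        ring
    rw [map_mul, aeval_X, Polynomial.derivative_mul, hp, Finset.sum_congr rfl fun b _ => h1 b,
      Finset.sum_add_distrib, Finset.sum_mul, Finset.sum_ite_eq', if_pos (Finset.mem_univ i)]

theorem totalDegree_det_le {ι : Type*} [Fintype ι] [DecidableEq ι]
    (M : Matrix ι ι (MvPolynomial σ K)) (D : ℕ) (hM : ∀ i j, (M i j).totalDegree ≤ D) :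
    M.det.totalDegree ≤ Fintype.card ι * D := by
  rw [Matrix.det_apply]
  refine totalDegree_finsetSum_le fun π _ => ?_
  refine (totalDegree_smul_le _ _).trans ?_
  refine (totalDegree_finsetProd _ _).trans ?_
  refine (Finset.sum_le_card_nsmul _ _ D fun i _ => hM _ _).trans ?_
  simp

end MvPolynomial

/-! ### Derivatives and discriminant of a Chow form. -/

noncomputable section

namespace NoetherPrim

open MvPolynomial

section

variable {K : Type*} [Field K] {d n : ℕ}

open Matrix in
-- Differentiate the identity `P(λ, λx) = 0` in the entry `λ_{i,j}`, along the line `λ + t E_{i,j}`: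
-- the value of row `i` moves with speed `x_j`. This is the formula that recovers `x_j` from the
-- Chow form.
theorem eval_pderiv_of_mem_chowIdeal [Infinite K] {V : Set (Fin n → K)}
    {P : MvPolynomial (ChowVar d n) K} (hP : P ∈ chowIdeal d V)
    (lam : Matrix (Fin (d + 1)) (Fin n) K) {x : Fin n → K} (hx : x ∈ V)
    (i : Fin (d + 1)) (j : Fin n) :
    eval (chowCoord lam (lam *ᵥ x)) (pderiv (i, some j) P) +
      x j * eval (chowCoord lam (lam *ᵥ x)) (pderiv (i, none) P) = 0 := by
  classical
  set δ : ChowVar d n → K := Pi.single (i, some j) 1 + x j • Pi.single (i, none) 1 with hδ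
  set v : ChowVar d n → Polynomial K := fun b =>
    Polynomial.C (chowCoord lam (lam *ᵥ x) b) + Polynomial.C (δ b) * Polynomial.X with hv
  have hv0 : aeval v P = 0 := by
    apply Polynomial.funext
    intro t
    have h1 : (Polynomial.evalRingHom t).comp (aeval (R := K) v).toRingHom =
        eval (chowCoord (lam + t • Matrix.single i j 1)
          ((lam + t • Matrix.single i j 1) *ᵥ x)) := by
      apply ringHom_ext
      · intro r; simp
      · rintro ⟨i', o⟩
        cases o with
        | none =>
          by_cases h : i' = i
          · subst h
            simp [hv, hδ, add_mulVec, Matrix.single_mulVec, mul_comm (x _)]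
          · have h' : i ≠ i' := fun h0 => h h0.symm
            simp [hv, hδ, add_mulVec, Matrix.single_mulVec, h]
        | some j' =>
          by_cases h : i = i' ∧ j = j'
          · obtain ⟨rfl, rfl⟩ := h
            simp [hv, hδ]
          · have h' : ¬ (i' = i ∧ j' = j) := fun h0 => h ⟨h0.1.symm, h0.2.symm⟩
            simp [hv, hδ, Pi.single_apply, h, h']
    rw [Polynomial.eval_zero, ← mem_chowIdeal.1 hP (lam + t • Matrix.single i j 1) x hx]
    exact congr($h1 P)
  have h2 := derivative_aeval v P
  rw [hv0, Polynomial.derivative_zero] at h2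
  have h3 : (Polynomial.evalRingHom 0).comp (aeval (R := K) v).toRingHom =
      eval (chowCoord lam (lam *ᵥ x)) := by
    apply ringHom_ext
    · intro r; simp
    · intro b; simp [hv]
  have h4 : ∀ Q, Polynomial.eval 0 (aeval v Q) = eval (chowCoord lam (lam *ᵥ x)) Q :=
    fun Q => congr($h3 Q)
  have h5 := congr(Polynomial.eval 0 $h2)
  rw [Polynomial.eval_zero, Polynomial.eval_finsetSum] at h5
  have h6 : ∀ b, Polynomial.eval 0 (aeval v (pderiv b P) * Polynomial.derivative (v b)) =
      eval (chowCoord lam (lam *ᵥ x)) (pderiv b P) * δ b := by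
    intro b
    rw [Polynomial.eval_mul, h4]
    simp [hv]
  simp only [h6, hδ, Pi.add_apply, Pi.smul_apply, mul_add, Finset.sum_add_distrib,
    Pi.single_apply, smul_eq_mul, mul_ite, mul_one, mul_zero, Finset.sum_ite_eq',
    Finset.mem_univ, if_true] at h5
  rw [h5, mul_comm]

theorem mem_chowIdeal_of_pow_mem {V : Set (Fin n → K)} {P : MvPolynomial (ChowVar d n) K} {e : ℕ}
    (hP : P ^ e ∈ chowIdeal d V) : P ∈ chowIdeal d V := by
  rw [mem_chowIdeal] at hP ⊢
  intro lam x hx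
  have := hP lam x hx
  rw [map_pow] at this
  exact eq_zero_of_pow_eq_zero this

variable [IsAlgClosed K]

theorem isPure_zeroLocus (q : Ideal (MvPolynomial (Fin n) K)) [q.IsPrime]
    (hq : Algebra.trdeg K (MvPolynomial (Fin n) K ⧸ q) = d) : IsPure d (zeroLocus K q) := by
  have h := IsPrime.vanishingIdeal_zeroLocus (K := K) q
  refine ⟨by rw [h], fun q' hq' => ?_⟩
  rw [h, Ideal.minimalPrimes_eq_subsingleton_self, Set.mem_singleton_iff] at hq'
  rw [hq', hq]

theorem IsChowForm.prime {q : Ideal (MvPolynomial (Fin n) K)} [q.IsPrime]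
    (hq : Algebra.trdeg K (MvPolynomial (Fin n) K ⧸ q) = d)
    {F : MvPolynomial (ChowVar d n) K} (hF : IsChowForm (zeroLocus K q) F) : Prime F := by
  have h := chowIdeal_isPrime (d := d) q
  rw [hF] at h
  exact (Ideal.span_singleton_prime (hF.ne_zero (isPure_zeroLocus q hq))).1 h

/-- If it vanished, the differential relation would put the derivatives in the last row's
coefficients into the ideal; being divisible by `F`, they vanish for degree reasons. Symmetry under
row permutations would then kill all partial derivatives of an irreducible polynomial. -/
theorem IsChowForm.pderiv_top_ne_zero {q : Ideal (MvPolynomial (Fin n) K)} [q.IsPrime]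
    (hq : Algebra.trdeg K (MvPolynomial (Fin n) K ⧸ q) = d)
    {F : MvPolynomial (ChowVar d n) K} (hF : IsChowForm (zeroLocus K q) F) :
    pderiv (ChowVar.top d n) F ≠ 0 := by
  have := IsAlgClosed.instInfinite (K := K)
  intro h0
  have hF0 := hF.ne_zero (isPure_zeroLocus q hq)
  have hlast : ∀ o, pderiv (Fin.last d, o) F = 0 := by
    intro o
    cases o with
    | none => exact h0
    | some j =>
      refine pderiv_eq_zero_of_dvd (hF.mem_iff.1 (mem_chowIdeal.2 fun lam x hx => ?_))
      have := eval_pderiv_of_mem_chowIdeal (hF.mem_iff.2 dvd_rfl) lam hx (Fin.last d) j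
      rwa [h0, map_zero, mul_zero, add_zero] at this
  obtain ⟨⟨i, o⟩, hio⟩ := exists_pderiv_ne_zero_of_irreducible (hF.prime hq).irreducible
  set π : Equiv.Perm (Fin (d + 1)) := Equiv.swap i (Fin.last d)
  obtain ⟨c, hc, hcF⟩ := hF.exists_rename_eq hF0 π
  have hinj : Function.Injective (Prod.map π (id : Option (Fin n) → _)) :=
    π.injective.prodMap Function.injective_id
  have h1 := pderiv_rename hinj (Fin.last d, o) F
  have h2 : Prod.map π id (Fin.last d, o) = (i, o) := by simp [π]
  rw [hlast, map_zero, hcF, h2, pderiv_C_mul] at h1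
  exact hio ((mul_eq_zero.1 h1).resolve_left (by simpa using hc))

/-- A prime factor of `F` is, up to a unit, the form `f` of a component, and `f` does not divide its
own derivative. So `z ∣ ∂F/∂T` would force `F = f² g`; then `(f g)²` is a multiple of `F`, and `f g`
lies in the radical ideal generated by `F`, which is absurd. -/
theorem IsChowForm.not_dvd_pderiv {V : Set (Fin n → K)} (hV : IsPure d V)
    {F : MvPolynomial (ChowVar d n) K} (hF : IsChowForm V F)
    {z : MvPolynomial (ChowVar d n) K} (hz : Prime z) (hzF : z ∣ F) :
    ¬ z ∣ pderiv (ChowVar.top d n) F := by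
  classical
  have hfin : (vanishingIdeal K V).minimalPrimes.Finite :=
    Ideal.finite_minimalPrimes_of_isNoetherianRing _ _
  have hex : ∀ q : hfin.toFinset, ∃ f : MvPolynomial (ChowVar d n) K,
      f ∈ chowIdeal d (zeroLocus K q.1) ∧ Prime f ∧ pderiv (ChowVar.top d n) f ≠ 0 := by
    rintro ⟨q, hq⟩
    rw [Set.Finite.mem_toFinset] at hq
    have := hq.1.1
    obtain ⟨f, hf⟩ := exists_chowIdeal_eq_span (isPure_zeroLocus q (hV.trdeg_eq q hq))
    have hf : IsChowForm (zeroLocus K q) f := hf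
    exact ⟨f, hf.mem_iff.2 dvd_rfl, hf.prime (hV.trdeg_eq q hq),
      hf.pderiv_top_ne_zero (hV.trdeg_eq q hq)⟩
  choose f hf hfp hfd using hex
  have hprod : F ∣ ∏ q, f q := by
    rw [← hF.mem_iff, mem_chowIdeal_iff_forall_minimalPrimes hV.zeroLocus_eq]
    intro q hq
    exact Ideal.mem_of_dvd _ (Finset.dvd_prod_of_mem f
      (Finset.mem_univ (⟨q, hfin.mem_toFinset.2 hq⟩ : hfin.toFinset)))
      (hf ⟨q, hfin.mem_toFinset.2 hq⟩)
  obtain ⟨q, -, hq⟩ := (Prime.dvd_finsetProd_iff hz _).1 (hzF.trans hprod)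
  have hassoc : Associated z (f q) := hz.associated_of_dvd (hfp q) hq
  intro hzd
  obtain ⟨h, hh⟩ := hassoc.symm.dvd.trans hzF
  have h1 : f q ∣ pderiv (ChowVar.top d n) (f q) * h := by
    have h2 := hassoc.symm.dvd.trans hzd
    rw [hh, pderiv_mul] at h2
    exact (dvd_add_left (dvd_mul_right _ _)).1 h2
  rcases (hfp q).dvd_or_dvd h1 with h2 | ⟨g, rfl⟩
  · exact hfd q (pderiv_eq_zero_of_dvd h2)
  · have h3 : f q * g ∈ chowIdeal d V := by
      refine mem_chowIdeal_of_pow_mem (e := 2) (hF.mem_iff.2 ⟨g, ?_⟩)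
      rw [hh]; ring
    rw [hF.mem_iff] at h3
    obtain ⟨u, hu⟩ := h3
    have hF0 := hF.ne_zero hV
    have h4 : F * 1 = F * (f q * u) := by
      calc F * 1 = f q * (f q * g) := by rw [mul_one, ← hh]
        _ = F * (f q * u) := by conv_lhs => rw [hu]
                                ring
    exact (hfp q).not_isUnit (IsUnit.of_mul_eq_one u (mul_left_cancel₀ hF0 h4).symm)

end

section resultant

variable {R : Type*} [CommRing R] {d n : ℕ}

theorem topExp_add_single (e : ℕ) (t : ChowVar' d n →₀ ℕ) :
    topExp e t + Finsupp.single (ChowVar.top d n) 1 = topExp (e + 1) t := by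
  classical
  ext b
  by_cases hb : b = ChowVar.top d n
  · subst hb
    simp
  · rw [Finsupp.add_apply, topExp_of_ne e t ⟨b, hb⟩, topExp_of_ne (e + 1) t ⟨b, hb⟩,
      Finsupp.single_apply, if_neg (fun h => hb h.symm), add_zero]

theorem derivative_toTop (P : MvPolynomial (ChowVar d n) R) :
    Polynomial.derivative (toTop R d n P) = toTop R d n (pderiv (ChowVar.top d n) P) := by
  ext e t
  rw [Polynomial.coeff_derivative, coeff_coeff_toTop, coeff_pderiv, topExp_add_single,
    ← coeff_coeff_toTop, topExp_top]
  have : ((e : MvPolynomial (ChowVar' d n) R) + 1) = C ((e : R) + 1) := by simp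
  rw [this, mul_comm, coeff_C_mul, mul_comm]

/-- The discriminant resultant of a Chow form. -/
def chowDisc (P : MvPolynomial (ChowVar d n) R) : MvPolynomial (ChowVar' d n) R :=
  (toTop R d n P).resultant (Polynomial.derivative (toTop R d n P))
    (P.degreeOf (ChowVar.top d n)) (P.degreeOf (ChowVar.top d n) - 1)

theorem IsChowForm.chowDisc_ne_zero {K : Type*} [Field K] [IsAlgClosed K]
    {V : Set (Fin n → K)} (hV : IsPure d V)
    {F : MvPolynomial (ChowVar d n) K} (hF : IsChowForm V F) : chowDisc F ≠ 0 := by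
  have hF0 := hF.ne_zero hV
  set f := toTop K d n F with hf
  have hf0 : f ≠ 0 := by simpa [hf] using hF0
  set A := MvPolynomial (ChowVar' d n) K
  set Q := FractionRing A
  have hφ : Function.Injective (algebraMap A Q) := IsFractionRing.injective A Q
  have hcop : IsCoprime (f.map (algebraMap A Q)) ((Polynomial.derivative f).map (algebraMap A Q)) := by
    refine Polynomial.isCoprime_map_of_forall_prime Q hf0 fun z hz hzf hzf' => ?_
    have h1 : Prime ((toTop K d n).symm z) :=
      (MulEquiv.prime_iff (toTop K d n).symm.toMulEquiv).2 hz
    refine hF.not_dvd_pderiv hV h1 ?_ ?_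
    · have := map_dvd (toTop K d n).symm hzf
      rwa [hf, AlgEquiv.symm_apply_apply] at this
    · have := map_dvd (toTop K d n).symm hzf'
      rwa [hf, derivative_toTop, AlgEquiv.symm_apply_apply] at this
  have hres : f.resultant (Polynomial.derivative f) ≠ 0 := by
    intro h0
    have h1 := Polynomial.resultant_map_map f (Polynomial.derivative f) f.natDegree
      (Polynomial.derivative f).natDegree (algebraMap A Q)
    rw [h0, map_zero] at h1
    have h2 := Polynomial.resultant_eq_zero_iff (f := f.map (algebraMap A Q))
      (g := (Polynomial.derivative f).map (algebraMap A Q))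
    rw [Polynomial.natDegree_map_eq_of_injective hφ,
      Polynomial.natDegree_map_eq_of_injective hφ] at h2
    exact (h2.1 h1).2 hcop
  have hdeg : (Polynomial.derivative f).natDegree ≤ F.degreeOf (ChowVar.top d n) - 1 := by
    rw [← natDegree_toTop]
    exact Polynomial.natDegree_derivative_le f
  -- In positive characteristic the derivative may have degree below `e - 1`; the larger formal
  -- degree only contributes a power of the leading coefficient.
  obtain ⟨l, hl⟩ := Nat.exists_eq_add_of_le hdeg
  rw [chowDisc, ← hf, hl, Polynomial.resultant_add_right_deg _ _ _ _ _ le_rfl, ← natDegree_toTop, ← hf]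
  exact mul_ne_zero (pow_ne_zero _ (by simpa using hf0)) hres

theorem totalDegree_coeff_toTop_le (P : MvPolynomial (ChowVar d n) R) (e : ℕ) :
    ((toTop R d n P).coeff e).totalDegree ≤ P.totalDegree := by
  classical
  refine Finset.sup_le fun t ht => ?_
  rw [mem_support_iff, coeff_coeff_toTop] at ht
  refine le_trans ?_ (le_totalDegree (mem_support_iff.2 ht))
  rw [Finsupp.sum_fintype _ _ (fun _ => rfl), Finsupp.sum_fintype _ _ (fun _ => rfl),
    ← Finset.add_sum_erase _ _ (Finset.mem_univ (ChowVar.top d n))]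
  refine le_add_left ?_
  rw [Finset.sum_subtype (p := fun b => b ≠ ChowVar.top d n) (Finset.univ.erase _) (by simp)
    (fun b => topExp e t b)]
  exact (Finset.sum_congr rfl fun b _ => (topExp_of_ne e t b).symm).le

theorem totalDegree_chowDisc_le {K : Type*} [Field K] (P : MvPolynomial (ChowVar d n) K) :
    (chowDisc P).totalDegree ≤
      (P.degreeOf (ChowVar.top d n) + (P.degreeOf (ChowVar.top d n) - 1)) * P.totalDegree := by
  rw [chowDisc, Polynomial.resultant]
  refine (totalDegree_det_le _ P.totalDegree fun i j => ?_).trans (by simp)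
  have h1 : ∀ e, ((Polynomial.derivative (toTop K d n P)).coeff e).totalDegree ≤
      P.totalDegree := by
    intro e
    rw [Polynomial.coeff_derivative]
    refine (totalDegree_mul _ _).trans ?_
    have : ((e : MvPolynomial (ChowVar' d n) K) + 1) = C ((e : K) + 1) := by simp
    rw [this, totalDegree_C, add_zero]
    exact totalDegree_coeff_toTop_le P _
  rw [Polynomial.sylvester, Matrix.of_apply]
  induction j using Fin.addCases with
  | left j =>
    rw [Fin.addCases_left]
    split_ifs
    · exact h1 _
    · simp
  | right j =>
    rw [Fin.addCases_right]
    split_ifs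
    · exact totalDegree_coeff_toTop_le P _
    · simp

end resultant

end NoetherPrim

end

/-! ### Zeros of the Chow form come from points of the variety. -/

noncomputable section

namespace NoetherPrim

open MvPolynomial

/-- Choose a prime of the integral closure over the kernel of `ev`. Its residue ring is a domain
integral over the algebraically closed field `K`, hence equal to `K`. -/
theorem exists_ringHom_integralClosure {S B K : Type*} [CommRing S] [CommRing B] [Field K]
    [IsAlgClosed K] [Algebra S B] (c : K →+* S) (ev : S →+* K) (hc : ∀ r, ev (c r) = r)
    (hker : ∀ s, algebraMap S B s = 0 → ev s = 0) :
    ∃ ev' : integralClosure S B →+* K, ∀ s, ev' (algebraMap S (integralClosure S B) s) = ev s := by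
  have hPprime : (RingHom.ker ev).IsPrime := RingHom.ker_isPrime _
  obtain ⟨Q, -, hQ, hQP⟩ := Ideal.exists_ideal_over_prime_of_isIntegral
    (S := integralClosure S B) (RingHom.ker ev) ⊥ (by
    intro s hs
    exact hker s congr(Subtype.val $((Submodule.mem_bot (integralClosure S B)).1
      (Ideal.mem_comap.1 hs))))
  let ι : K →+* integralClosure S B ⧸ Q :=
    (Ideal.Quotient.mk Q).comp ((algebraMap S (integralClosure S B)).comp c)
  let _ : Algebra K (integralClosure S B ⧸ Q) := ι.toAlgebra
  have hmk : ∀ s : S, Ideal.Quotient.mk Q (algebraMap S (integralClosure S B) s) = ι (ev s) := by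
    intro s
    change _ = Ideal.Quotient.mk Q (algebraMap S (integralClosure S B) (c (ev s)))
    rw [Ideal.Quotient.eq, ← map_sub, ← Ideal.mem_comap, hQP, RingHom.mem_ker, map_sub, hc,
      sub_self]
  have hintQ : Algebra.IsIntegral K (integralClosure S B ⧸ Q) := by
    constructor
    intro b
    obtain ⟨b, rfl⟩ := Ideal.Quotient.mk_surjective b
    obtain ⟨p, hp, hp0⟩ := Algebra.IsIntegral.isIntegral (R := S) b
    refine ⟨p.map ev, hp.map _, ?_⟩
    rw [Polynomial.eval₂_map]
    have h1 : (algebraMap K (integralClosure S B ⧸ Q)).comp ev =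
        (Ideal.Quotient.mk Q).comp (algebraMap S (integralClosure S B)) :=
      RingHom.ext fun s => (hmk s).symm
    rw [h1, ← Polynomial.hom_eval₂, hp0, map_zero]
  have hbij : Function.Bijective (algebraMap K (integralClosure S B ⧸ Q)) :=
    IsAlgClosed.algebraMap_bijective_of_isIntegral
  let e : K ≃+* integralClosure S B ⧸ Q := RingEquiv.ofBijective _ hbij
  refine ⟨e.symm.toRingHom.comp (Ideal.Quotient.mk Q), fun s => ?_⟩
  change e.symm (Ideal.Quotient.mk Q (algebraMap S (integralClosure S B) s)) = _
  rw [hmk]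
  exact e.symm_apply_apply _

/-- The evaluation extends to the integral elements `a u_k`, and `x_k` is the image divided by `ev
a`. A relation between the `u_k` specializes after multiplication by a power of `a`. -/
theorem exists_specialization {S B K ι : Type*} [CommRing S] [CommRing B] [Field K]
    [IsAlgClosed K] (φ : S →+* B) (c : K →+* S) (ev : S →+* K) (hc : ∀ r, ev (c r) = r)
    (hker : ∀ s, φ s = 0 → ev s = 0) (a : S) (ha : ev a ≠ 0) (u : ι → B)
    (hu : ∀ k, φ.IsIntegralElem (φ a * u k)) :
    ∃ x : ι → K, ∀ P : MvPolynomial ι S, P.eval₂ φ u = 0 → P.eval₂ ev x = 0 := by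
  let _ : Algebra S B := φ.toAlgebra
  obtain ⟨ev', hev'⟩ := exists_ringHom_integralClosure (B := B) c ev hc hker
  let w : ι → integralClosure S B := fun k => ⟨φ a * u k, hu k⟩
  let x : ι → K := fun k => ev' (w k) / ev a
  have hw : ∀ k, ev' (w k) = ev a * x k := fun k => (mul_div_cancel₀ _ ha).symm
  have key : ∀ P : MvPolynomial ι S, ∃ N : ℕ, ∃ b : integralClosure S B,
      (b : B) = φ a ^ N * P.eval₂ φ u ∧ ev' b = ev a ^ N * P.eval₂ ev x := by
    intro P
    induction P using MvPolynomial.induction_on with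
    | C r =>
      refine ⟨0, algebraMap S (integralClosure S B) r, ?_, ?_⟩
      · rw [pow_zero, one_mul, eval₂_C]
        rfl
      · rw [hev', pow_zero, one_mul, eval₂_C]
    | add p q hp hq =>
      obtain ⟨N, b, hb, hb'⟩ := hp
      obtain ⟨M, c, hc, hc'⟩ := hq
      refine ⟨N + M, algebraMap S (integralClosure S B) a ^ M * b +
        algebraMap S (integralClosure S B) a ^ N * c, ?_, ?_⟩
      · change φ a ^ M * (b : B) + φ a ^ N * (c : B) = _
        rw [hb, hc, eval₂_add]
        ring
      · rw [map_add, map_mul, map_mul, map_pow, map_pow, hev', hb', hc', eval₂_add]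
        ring
    | mul_X p k hp =>
      obtain ⟨N, b, hb, hb'⟩ := hp
      refine ⟨N + 1, b * w k, ?_, ?_⟩
      · change (b : B) * (φ a * u k) = _
        rw [hb, eval₂_mul, eval₂_X]
        ring
      · rw [map_mul, hw, hb', eval₂_mul, eval₂_X]
        ring
  refine ⟨x, fun P hP => ?_⟩
  obtain ⟨N, b, hb, hb'⟩ := key P
  rw [hP, mul_zero] at hb
  have hb0 : b = 0 := Subtype.ext hb
  rw [hb0, map_zero] at hb'
  exact (mul_eq_zero.1 hb'.symm).resolve_left (pow_ne_zero _ ha)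

section coordinate

variable {K : Type*} [Field K] {d n : ℕ}

/-- The substitution of the `k`-th coordinate for the last linear form. -/
def lastRowHom (d : ℕ) (k : Fin n) :
    MvPolynomial (ChowVar' d n) K →ₐ[K] MvPolynomial (ChowVar' d n) K :=
  aeval fun b => if b.1.1 = Fin.last d then C (if b.1.2 = some k then 1 else 0) else X b

/-- The relation satisfied by the `k`-th coordinate. -/
def coordRelation (F : MvPolynomial (ChowVar d n) K) (k : Fin n) :
    Polynomial (MvPolynomial (ChowVar' d n) K) :=
  (toTop K d n F).map (lastRowHom d k).toRingHom

variable [IsAlgClosed K]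

/-- The leading coefficient is free of the last row, so putting a unit vector there neither changes
it nor lowers the degree. -/
theorem IsChowForm.leadingCoeff_coordRelation {V : Set (Fin n → K)} (hV : IsPure d V)
    {F : MvPolynomial (ChowVar d n) K} (hF : IsChowForm V F) (k : Fin n) :
    (coordRelation F k).leadingCoeff = (toTop K d n F).leadingCoeff := by
  have h1 : lastRowHom d k (toTop K d n F).leadingCoeff = (toTop K d n F).leadingCoeff := by
    have : (toTop K d n F).leadingCoeff =
        AlgHom.id K _ (toTop K d n F).leadingCoeff := rfl
    conv_rhs => rw [this]
    refine hom_congr_vars (f₁ := (lastRowHom d k).toRingHom)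
      (f₂ := (AlgHom.id K (MvPolynomial (ChowVar' d n) K)).toRingHom) ?_ ?_ rfl
    · ext r; simp
    · intro b hb _
      have hlast : b.1.1 ≠ Fin.last d := by
        intro h
        have h2 := hF.degreeOf_leadingCoeff hV b h
        classical
        rw [degreeOf_def, Multiset.count_eq_zero, ← Multiset.mem_toFinset, ← vars_def] at h2
        exact h2 hb
      simp [lastRowHom, hlast]
  have h0 : (toTop K d n F).leadingCoeff ≠ 0 := by simpa using hF.ne_zero hV
  rw [coordRelation, Polynomial.leadingCoeff_map_of_leadingCoeff_ne_zero]
  · exact h1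
  · exact fun h => h0 (h1.symm.trans h)

theorem IsChowForm.eval₂_coordRelation {V : Set (Fin n → K)} (hV : IsPure d V)
    {F : MvPolynomial (ChowVar d n) K} (hF : IsChowForm V F) (k : Fin n) :
    (coordRelation F k).eval₂
      ((chowHom d (vanishingIdeal K V)).comp (rename Subtype.val)).toRingHom
      (C (Ideal.Quotient.mk (vanishingIdeal K V) (X k))) = 0 := by
  classical
  have := IsAlgClosed.instInfinite (K := K)
  set J := vanishingIdeal K V
  have hJ : vanishingIdeal K (zeroLocus K J) = J := by rw [hV.zeroLocus_eq]
  set η : MvPolynomial (Fin (d + 1) × Fin n) (MvPolynomial (Fin n) K ⧸ J) →ₐ[K]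
      MvPolynomial (Fin (d + 1) × Fin n) (MvPolynomial (Fin n) K ⧸ J) :=
    (aeval (R := MvPolynomial (Fin n) K ⧸ J) (fun b : Fin (d + 1) × Fin n =>
      if b.1 = Fin.last d then if b.2 = k then 1 else 0 else
        (X b : MvPolynomial (Fin (d + 1) × Fin n) (MvPolynomial (Fin n) K ⧸ J)))).restrictScalars K
    with hη
  have h1 := eval₂_toTop (R := K) (S := MvPolynomial (Fin (d + 1) × Fin n)
    (MvPolynomial (Fin n) K ⧸ J)) (η.comp (chowHom d J)) F
  have h2 : chowHom d J F = 0 := by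
    rw [← RingHom.mem_ker, ker_chowHom J hJ, hV.zeroLocus_eq]
    exact hF.mem_iff.2 dvd_rfl
  have h3 : η (chowHom d J (X (ChowVar.top d n))) = C (Ideal.Quotient.mk J (X k)) := by
    rw [chowHom_X_none, map_sum]
    simp only [map_mul]
    rw [Finset.sum_eq_single k]
    · simp [hη, algebraMap_eq]
    · intro j _ hj
      simp [hη, hj]
    · simp
  have h4 : ((chowHom d J).comp (rename Subtype.val)).comp (lastRowHom d k) =
      (η.comp (chowHom d J)).comp (rename Subtype.val) := by
    apply algHom_ext
    rintro ⟨⟨i, o⟩, hb⟩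
    simp only [AlgHom.comp_apply, lastRowHom, aeval_X, rename_X]
    by_cases hi : i = Fin.last d
    · subst hi
      cases o with
      | none => exact absurd rfl hb
      | some j =>
        rw [chowHom_X_some]
        by_cases hj : j = k <;> simp [hη, hj]
    · cases o with
      | none =>
        simp [hi, chowHom_X_none, hη, algebraMap_eq]
      | some j => simp [hi, chowHom_X_some, hη]
  rw [AlgHom.comp_apply η _ F, h2, map_zero, AlgHom.comp_apply, h3, ← h4] at h1
  rw [coordRelation, Polynomial.eval₂_map]
  exact h1

theorem IsChowForm.isIntegralElem_leadingCoeff_mul {V : Set (Fin n → K)} (hV : IsPure d V)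
    {F : MvPolynomial (ChowVar d n) K} (hF : IsChowForm V F) (k : Fin n) :
    (chowHom d (vanishingIdeal K V)).toRingHom.IsIntegralElem
      (chowHom d (vanishingIdeal K V) (rename Subtype.val (toTop K d n F).leadingCoeff) *
        C (Ideal.Quotient.mk (vanishingIdeal K V) (X k))) := by
  obtain ⟨p, hp, hp0⟩ := RingHom.isIntegralElem_leadingCoeff_mul _ (coordRelation F k)
    (C (Ideal.Quotient.mk (vanishingIdeal K V) (X k))) (hF.eval₂_coordRelation hV k)
  rw [hF.leadingCoeff_coordRelation hV] at hp0
  refine ⟨p.map (rename Subtype.val).toRingHom, hp.map _, ?_⟩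
  rw [Polynomial.eval₂_map]
  exact hp0

open Matrix in
-- A zero of `F` defines an evaluation killing the kernel of `chowHom`. Coordinates are integral up
-- to the leading coefficient, so when that is nonzero the evaluation lifts to a point, and the
-- lifted relations say that it lies in `V` with the given values.
theorem IsChowForm.exists_mem_of_eval_eq_zero {V : Set (Fin n → K)} (hV : IsPure d V)
    {F : MvPolynomial (ChowVar d n) K} (hF : IsChowForm V F)
    (lam : Matrix (Fin (d + 1)) (Fin n) K) (y : Fin (d + 1) → K)
    (ha : eval (fun b : ChowVar' d n => chowCoord lam y b.1) (toTop K d n F).leadingCoeff ≠ 0)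
    (h : eval (chowCoord lam y) F = 0) : ∃ x ∈ V, lam *ᵥ x = y := by
  have := IsAlgClosed.instInfinite (K := K)
  have hJ : vanishingIdeal K (zeroLocus K (vanishingIdeal K V)) = vanishingIdeal K V := by
    rw [hV.zeroLocus_eq]
  obtain ⟨x, hx⟩ := exists_specialization (S := MvPolynomial (ChowVar d n) K)
    (B := MvPolynomial (Fin (d + 1) × Fin n) (MvPolynomial (Fin n) K ⧸ vanishingIdeal K V))
    (chowHom d (vanishingIdeal K V)).toRingHom C (eval (chowCoord lam y)) (by simp)
    (by
      intro s hs
      have h2 : s ∈ RingHom.ker (chowHom d (vanishingIdeal K V)) := hs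
      rw [ker_chowHom _ hJ, hV.zeroLocus_eq, hF.mem_iff] at h2
      obtain ⟨g, rfl⟩ := h2
      rw [map_mul, h, zero_mul])
    (rename Subtype.val (toTop K d n F).leadingCoeff) (by rw [eval_rename]; exact ha)
    (fun k => C (Ideal.Quotient.mk (vanishingIdeal K V) (X k)))
    (hF.isIntegralElem_leadingCoeff_mul hV)
  refine ⟨x, ?_, ?_⟩
  · rw [← hV.zeroLocus_eq]
    intro f hf
    have h1 := hx (map C f) (by
      rw [eval₂_map]
      have h3 : eval₂Hom (((chowHom d (vanishingIdeal K V)).toRingHom).comp C)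
          (fun k => C (Ideal.Quotient.mk (vanishingIdeal K V) (X k))) =
          C.comp (Ideal.Quotient.mk (vanishingIdeal K V)) := by
        apply ringHom_ext
        · intro r
          simp
          rfl
        · intro i
          simp
      refine congr($h3 f).trans ?_
      rw [RingHom.comp_apply, Ideal.Quotient.eq_zero_iff_mem.2 hf, C_0])
    rw [eval₂_map] at h1
    have h3 : (eval (chowCoord lam y)).comp C = RingHom.id K := by ext r; simp
    rw [h3] at h1
    exact h1
  · ext i
    have h1 := hx (∑ j, C (X (i, some j)) * X j - C (X (i, none))) (by
      refine (map_sub (eval₂Hom (chowHom d (vanishingIdeal K V)).toRingHom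
        fun k => C (Ideal.Quotient.mk (vanishingIdeal K V) (X k))) _ _).trans ?_
      rw [map_sum, eval₂Hom_C, sub_eq_zero]
      refine Eq.trans ?_ (chowHom_X_none (vanishingIdeal K V) i).symm
      refine Finset.sum_congr rfl fun j _ => ?_
      rw [map_mul, eval₂Hom_C, eval₂Hom_X']
      exact congrArg (· * _) (chowHom_X_some (vanishingIdeal K V) i j))
    simp only [eval₂_sub, eval₂_sum, eval₂_mul, eval₂_C, eval₂_X, eval_X, chowCoord_some,
      chowCoord_none, sub_eq_zero] at h1
    exact h1

end coordinate

theorem totalDegree_map_le' {σ R S : Type*} [CommRing R] [CommRing S] (f : R →+* S)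
    (P : MvPolynomial σ R) : (map f P).totalDegree ≤ P.totalDegree :=
  Finset.sup_mono (support_map_subset f P)

/-! ### Galois descent of the Chow form to the perfect field. -/

section descent

variable {k K : Type*} [Field k] [PerfectField k] [Field K] [Algebra k K] [IsAlgClosure k K]

theorem exists_map_eq_of_forall_map_eq {σ : Type*} (P : MvPolynomial σ K)
    (hP : ∀ τ : K ≃ₐ[k] K, map (τ : K →+* K) P = P) : ∃ P₀ : MvPolynomial σ k,
      map (algebraMap k K) P₀ = P := by
  have : IsAlgClosed K := IsAlgClosure.isAlgClosed k
  have : Algebra.IsAlgebraic k K := IsAlgClosure.isAlgebraic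
  have : IsSepClosure k K := ⟨inferInstance, inferInstance⟩
  have : IsGalois k K := inferInstance
  have hmem : P ∈ Set.range (map (σ := σ) (algebraMap k K)) := by
    rw [mem_range_map_iff_coeffs_subset]
    intro c hc
    obtain ⟨m, hm, rfl⟩ := mem_coeffs_iff.1 hc
    refine (InfiniteGalois.mem_range_algebraMap_iff_fixed _).2 fun τ => ?_
    have := congr(coeff m $(hP τ))
    rwa [coeff_map] at this
  exact hmem

/-- A Galois conjugate is a constant multiple for degree reasons; normalizing one coefficient to `1`
makes it invariant. Perfectness makes `K` Galois over `k`. -/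
theorem exists_C_mul_map_eq {σ : Type*} (P : MvPolynomial σ K) (hP0 : P ≠ 0)
    (hP : ∀ τ : K ≃ₐ[k] K, P ∣ map (τ : K →+* K) P) : ∃ P₀ : MvPolynomial σ k, ∃ c : K, c ≠ 0 ∧
      map (algebraMap k K) P₀ = C c * P := by
  obtain ⟨m, hm⟩ := ne_zero_iff.1 hP0
  have h1 : ∀ τ : K ≃ₐ[k] K, map (τ : K →+* K) (C (coeff m P)⁻¹ * P) = C (coeff m P)⁻¹ * P := by
    intro τ
    obtain ⟨c, hc⟩ := eq_C_mul_of_dvd_of_totalDegree_le (hP τ) (totalDegree_map_le' _ _)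
    have h2 := congr(coeff m $hc)
    rw [coeff_map, coeff_C_mul] at h2
    rw [map_mul, hc, map_C, ← mul_assoc, ← C_mul, map_inv₀, h2]
    congr 2
    have : c ≠ 0 := by
      rintro rfl
      rw [zero_mul] at h2
      exact hm ((map_eq_zero (τ : K →+* K)).1 h2)
    field_simp
  obtain ⟨P₀, hP₀⟩ := exists_map_eq_of_forall_map_eq _ h1
  exact ⟨P₀, _, inv_ne_zero hm, hP₀⟩

theorem comp_mem_closedVariety {n r : ℕ} (F : Fin r → MvPolynomial (Fin n) k)
    (G : MvPolynomial (Fin n) k) (s : ℕ) (τ : K ≃ₐ[k] K) {x : Fin n → K}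
    (hx : x ∈ closedVariety K F G s) : (fun i => τ (x i)) ∈ closedVariety K F G s := by
  intro f hf
  have h1 : ∀ (τ : K ≃ₐ[k] K) (y : Fin n → K) (p : MvPolynomial (Fin n) k),
      aeval (fun i => τ (y i)) p = τ (aeval y p) := by
    intro τ y p
    exact congr($(comp_aeval (R := k) y τ.toAlgHom) p).symm
  have h2 : ∀ (τ : K ≃ₐ[k] K) (y : Fin n → K) (p : MvPolynomial (Fin n) K),
      eval (fun i => τ (y i)) (map (τ : K →+* K) p) = τ (eval y p) := by
    intro τ y p
    rw [eval_map]
    exact (eval₂_comp_left (τ : K →+* K) (RingHom.id K) y p).symm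
  have h3 : map (τ.symm : K →+* K) f ∈ (vanishingIdeal K {x : Fin n → K |
      (∀ i : Fin r, (i : ℕ) < s → aeval x (F i) = 0) ∧ aeval x G ≠ 0}) := by
    rintro y ⟨hy, hyG⟩
    have h4 := hf (fun i => τ (y i)) ⟨fun i hi => by rw [h1, hy i hi, map_zero], by
      rw [h1, Ne, map_eq_zero]; exact hyG⟩
    have h5 := h2 τ.symm (fun i => τ (y i)) f
    simp only [AlgEquiv.symm_apply_apply] at h5
    rw [aeval_eq_eval] at h4 ⊢
    rw [h5, h4, map_zero]
  have h6 := hx _ h3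
  have h7 := h2 τ x (map (τ.symm : K →+* K) f)
  rw [aeval_eq_eval] at h6 ⊢
  rw [h6, map_zero, map_map] at h7
  have h8 : (τ : K →+* K).comp (τ.symm : K →+* K) = RingHom.id K := by
    ext r; simp
  rwa [h8, map_id] at h7

open Matrix in
theorem exists_isChowForm_map {n r d : ℕ} (F : Fin r → MvPolynomial (Fin n) k)
    (G : MvPolynomial (Fin n) k) (s : ℕ) (hV : IsPure d (closedVariety K F G s)) :
    ∃ P : MvPolynomial (ChowVar d n) k,
      IsChowForm (closedVariety K F G s) (map (algebraMap k K) P) := by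
  have : IsAlgClosed K := IsAlgClosure.isAlgClosed k
  obtain ⟨P, hP⟩ := exists_chowIdeal_eq_span hV
  have hP : IsChowForm (closedVariety K F G s) P := hP
  obtain ⟨P₀, c, hc, hP₀⟩ := exists_C_mul_map_eq (k := k) P (hP.ne_zero hV) (by
    intro τ
    rw [← hP.mem_iff, mem_chowIdeal]
    intro lam x hx
    have h1 := hP.eval_eq_zero (lam.map τ.symm) (comp_mem_closedVariety F G s τ.symm hx)
    have h2 := eval₂_comp_left (τ : K →+* K) (RingHom.id K)
      (chowCoord (lam.map τ.symm) (lam.map τ.symm *ᵥ fun i => τ.symm (x i))) P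
    rw [eval_map]
    have h3 : (τ : K →+* K) ∘ (chowCoord (lam.map τ.symm)
        (lam.map τ.symm *ᵥ fun i => τ.symm (x i))) = chowCoord lam (lam *ᵥ x) := by
      ext ⟨i, o⟩
      cases o <;> simp [mulVec, dotProduct]
    rw [h3] at h2
    refine h2.symm.trans ?_
    change τ (eval _ P) = 0
    rw [h1, map_zero])
  refine ⟨P₀, ?_⟩
  rw [hP₀]
  change chowIdeal d _ = _
  rw [show chowIdeal d (closedVariety K F G s) = Ideal.span {P} from hP]
  rw [Ideal.span_singleton_mul_left_unit ((IsUnit.mk0 c hc).map C)]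

end descent

end NoetherPrim

end

/-! ### A primitive element criterion, and specialization of the coefficients. -/

noncomputable section

namespace NoetherPrim

open MvPolynomial

/-- Over the fraction field the generators `x_k` become polynomials in `b`, so the tensor product is
generated by the single algebraic element `1 ⊗ b`; its powers below the degree of the minimal
polynomial form a basis. -/
theorem inducesPrimitiveElement_of_forall {R B ι : Type*} [CommRing R] [IsDomain R] [CommRing B]
    (φ : R →+* B) (b : B) (x : ι → B)
    (hgen : ∀ S : Subring B, (∀ r, φ r ∈ S) → (∀ k, x k ∈ S) → ∀ β, β ∈ S)
    (hb : ∃ g : Polynomial R, g ≠ 0 ∧ g.eval₂ φ b = 0)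
    (hx : ∀ k, ∃ r : R, r ≠ 0 ∧ ∃ g : Polynomial R, φ r * x k = g.eval₂ φ b) :
    InducesPrimitiveElement φ b := by
  let _ : Algebra R B := φ.toAlgebra
  have hφ : algebraMap R B = φ := rfl
  let Q := FractionRing R
  change Module.Finite Q (Q ⊗[R] B) ∧ (minpoly Q ((1 : Q) ⊗ₜ[R] b)).natDegree =
    Module.finrank Q (Q ⊗[R] B)
  set y : Q ⊗[R] B := (1 : Q) ⊗ₜ[R] b with hy
  let inc : B →ₐ[R] Q ⊗[R] B := Algebra.TensorProduct.includeRight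
  have hinc : ∀ g : Polynomial R, inc (g.eval₂ φ b) =
      Polynomial.aeval y (g.map (algebraMap R Q)) := by
    intro g
    rw [Polynomial.aeval_map_algebraMap]
    exact (Polynomial.aeval_algHom_apply inc b g).symm
  have hsmul : ∀ (r : R) (β : B), inc (φ r * β) = algebraMap R Q r • inc β := by
    intro r β
    rw [← hφ, ← Algebra.smul_def, map_smul, algebraMap_smul]
  obtain ⟨g, hg, hgb⟩ := hb
  have hint : IsIntegral Q y := by
    rw [← isAlgebraic_iff_isIntegral]
    refine ⟨g.map (algebraMap R Q), ?_, ?_⟩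
    · rwa [Ne, Polynomial.map_eq_zero_iff (IsFractionRing.injective R Q)]
    · rw [← hinc, hgb, map_zero]
  have htop : Algebra.adjoin Q {y} = ⊤ := by
    have h1 : ∀ β : B, inc β ∈ Algebra.adjoin Q {y} := by
      refine hgen ((Algebra.adjoin Q {y}).toSubring.comap inc.toRingHom) ?_ ?_
      · intro r
        change inc (φ r) ∈ Algebra.adjoin Q {y}
        rw [← mul_one (φ r), hsmul, map_one]
        exact Subalgebra.smul_mem _ (Subalgebra.one_mem _) _
      · intro k
        change inc (x k) ∈ Algebra.adjoin Q {y}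
        obtain ⟨r, hr, g, hg⟩ := hx k
        have hr' : algebraMap R Q r ≠ 0 := by
          rwa [Ne, map_eq_zero_iff _ (IsFractionRing.injective R Q)]
        have h2 : inc (x k) = (algebraMap R Q r)⁻¹ • Polynomial.aeval y (g.map (algebraMap R Q)) := by
          rw [← hinc, ← hg, hsmul, smul_smul, inv_mul_cancel₀ hr', one_smul]
        rw [h2]
        exact Subalgebra.smul_mem _ (Polynomial.aeval_mem_adjoin_singleton _ _) _
    rw [eq_top_iff]
    intro z _
    induction z using TensorProduct.induction_on with
    | zero => exact Subalgebra.zero_mem _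
    | tmul q β =>
      have : q ⊗ₜ[R] β = q • inc β := by
        change _ = q • ((1 : Q) ⊗ₜ[R] β)
        rw [TensorProduct.smul_tmul', smul_eq_mul, mul_one]
      rw [this]
      exact Subalgebra.smul_mem _ (h1 β) _
    | add u v hu hv => exact Subalgebra.add_mem _ (hu trivial) (hv trivial)
  let pb := (Algebra.adjoin.powerBasis hint).map
    ((Subalgebra.equivOfEq _ _ htop).trans Subalgebra.topEquiv)
  refine ⟨pb.finite, ?_⟩
  rw [pb.finrank]
  exact (Algebra.adjoin.powerBasis_dim hint).symm

section extraction

variable {k K : Type*} [Field k] [Field K] [Algebra k K] {d n : ℕ}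

/-- Specialization of the coefficients of the linear forms, the values of all the linear forms but
the last one being kept as variables. -/
def specHom (lam : Matrix (Fin (d + 1)) (Fin n) K) :
    MvPolynomial (ChowVar' d n) K →ₐ[K] MvPolynomial (Fin d) K :=
  aeval fun b => b.1.2.elim (Fin.lastCases 0 (fun i => X i) b.1.1) fun j => C (lam b.1.1 j)

/-- Separation of the coefficients and the values of the linear forms. -/
def separateHom (k : Type*) [Field k] (d n : ℕ) : MvPolynomial (ChowVar' d n) k →ₐ[k]
    MvPolynomial (Fin d) (MvPolynomial (Fin (d + 1) × Fin n) k) :=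
  aeval fun b => b.1.2.elim (Fin.lastCases 0 (fun i => X i) b.1.1) fun j => C (X (b.1.1, j))

theorem separateHom_injective : Function.Injective (separateHom k d n) := by
  let inv : MvPolynomial (Fin d) (MvPolynomial (Fin (d + 1) × Fin n) k) →+*
      MvPolynomial (ChowVar' d n) k :=
    eval₂Hom (aeval fun b : Fin (d + 1) × Fin n =>
      (X ⟨(b.1, some b.2), by simp⟩ : MvPolynomial (ChowVar' d n) k)).toRingHom
      fun i => X ⟨(i.castSucc, none), fun h => (Fin.castSucc_lt_last i).ne congr(($h).1)⟩
  have h : inv.comp (separateHom k d n).toRingHom = RingHom.id _ := by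
    apply ringHom_ext
    · intro r
      have : algebraMap k (MvPolynomial (Fin d) (MvPolynomial (Fin (d + 1) × Fin n) k)) r =
        C (C r) := rfl
      simp [separateHom, inv, this, algebraMap_eq]
    · rintro ⟨⟨i, _ | j⟩, hb⟩
      · induction i using Fin.lastCases with
        | last => exact absurd rfl hb
        | cast i => simp [separateHom, inv]
      · simp [separateHom, inv]
  exact Function.LeftInverse.injective (g := inv) fun x => DFunLike.congr_fun h x

theorem coeff_specHom_map (lam : Matrix (Fin (d + 1)) (Fin n) K)
    (Q : MvPolynomial (ChowVar' d n) k) (y : Fin d →₀ ℕ) :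
    coeff y (specHom lam (map (algebraMap k K) Q)) =
      aeval (fun ij : Fin (d + 1) × Fin n => lam ij.1 ij.2) (coeff y (separateHom k d n Q)) := by
  have h : (specHom lam).toRingHom.comp (map (algebraMap k K)) =
      (map (aeval fun ij : Fin (d + 1) × Fin n => lam ij.1 ij.2).toRingHom).comp
        (separateHom k d n).toRingHom := by
    apply ringHom_ext
    · intro r
      have : algebraMap k (MvPolynomial (Fin d) (MvPolynomial (Fin (d + 1) × Fin n) k)) r =
        C (C r) := rfl
      simp [separateHom, specHom, this, algebraMap_eq]
    · rintro ⟨⟨i, _ | j⟩, hb⟩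
      · induction i using Fin.lastCases with
        | last => exact absurd rfl hb
        | cast i => simp [separateHom, specHom]
      · simp [separateHom, specHom]
  have h2 := congr(coeff y ($h Q))
  rw [RingHom.comp_apply, RingHom.comp_apply, coeff_map] at h2
  exact h2

theorem totalDegree_coeff_prod_le {σ τ ι R : Type*} [CommRing R] (s : Finset ι)
    (f : ι → MvPolynomial σ (MvPolynomial τ R)) (N : ι → ℕ)
    (hf : ∀ i ∈ s, ∀ y, (coeff y (f i)).totalDegree ≤ N i) (y : σ →₀ ℕ) :
    (coeff y (∏ i ∈ s, f i)).totalDegree ≤ ∑ i ∈ s, N i := by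
  classical
  induction s using Finset.induction_on generalizing y with
  | empty =>
    rw [Finset.prod_empty, coeff_one]
    split_ifs <;> simp
  | insert a s ha ih =>
    rw [Finset.prod_insert ha, Finset.sum_insert ha, coeff_mul]
    refine totalDegree_finsetSum_le fun p _ => (totalDegree_mul _ _).trans ?_
    exact add_le_add (hf a (Finset.mem_insert_self a s) _)
      (ih (fun i hi => hf i (Finset.mem_insert_of_mem hi)) _)

theorem totalDegree_coeff_separateHom_le (Q : MvPolynomial (ChowVar' d n) k) (y : Fin d →₀ ℕ) :
    (coeff y (separateHom k d n Q)).totalDegree ≤ Q.totalDegree := by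
  classical
  rw [separateHom, aeval_def, eval₂_eq, coeff_sum]
  refine totalDegree_finsetSum_le fun m hm => ?_
  have h0 : algebraMap k (MvPolynomial (Fin d) (MvPolynomial (Fin (d + 1) × Fin n) k))
      (coeff m Q) = C (C (coeff m Q)) := rfl
  rw [h0, coeff_C_mul]
  refine (totalDegree_mul _ _).trans ?_
  rw [totalDegree_C, zero_add]
  refine le_trans ?_ (le_totalDegree hm)
  refine totalDegree_coeff_prod_le _ _ _ (fun b _ y => ?_) y
  rw [← Finset.card_range (m b), ← Finset.prod_const, Finset.card_eq_sum_ones]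
  refine totalDegree_coeff_prod_le _ _ _ (fun _ _ y => ?_) y
  obtain ⟨⟨i, _ | j⟩, hb⟩ := b
  · induction i using Fin.lastCases with
    | last => exact absurd rfl hb
    | cast i =>
      simp only [Option.elim_none, Fin.lastCases_castSucc, coeff_X]
      split_ifs <;> simp
  · simp only [Option.elim_some, coeff_C]
    split_ifs <;> simp

/-- A nonzero polynomial whose non-vanishing implies that of a given polynomial in all variables. -/
theorem exists_specHom_ne_zero (Q : MvPolynomial (ChowVar' d n) k) (hQ : Q ≠ 0) :
    ∃ b : MvPolynomial (Fin (d + 1) × Fin n) k, b ≠ 0 ∧ b.totalDegree ≤ Q.totalDegree ∧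
      ∀ lam : Matrix (Fin (d + 1)) (Fin n) K,
        aeval (fun ij : Fin (d + 1) × Fin n => lam ij.1 ij.2) b ≠ 0 →
        specHom lam (map (algebraMap k K) Q) ≠ 0 := by
  have h : separateHom k d n Q ≠ 0 := by
    rwa [Ne, map_eq_zero_iff _ separateHom_injective]
  -- Any one nonzero coefficient with respect to the values serves: it depends on the matrix alone,
  -- and its nonvanishing keeps the specialized polynomial nonzero.
  obtain ⟨y, hy⟩ := ne_zero_iff.1 h
  refine ⟨_, hy, totalDegree_coeff_separateHom_le Q y, fun lam hlam h0 => hlam ?_⟩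
  rw [← coeff_specHom_map, h0, coeff_zero]

end extraction

section generic

variable {K : Type*} [Field K] {d n : ℕ}

/-- Substitution of given linear forms. -/
def substHom (lam : Matrix (Fin (d + 1)) (Fin n) K) :
    MvPolynomial (ChowVar d n) K →ₐ[K] MvPolynomial (Fin n) K :=
  aeval (chowCoord (.of fun i j => C (lam i j)) (linForm lam))

theorem eval_linForm (lam : Matrix (Fin (d + 1)) (Fin n) K) (i : Fin (d + 1)) (x : Fin n → K) :
    eval x (linForm lam i) = (lam.mulVec x) i := by
  simp [linForm, Matrix.mulVec, dotProduct]

open Matrix in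
theorem eval_substHom (lam : Matrix (Fin (d + 1)) (Fin n) K) (x : Fin n → K)
    (P : MvPolynomial (ChowVar d n) K) :
    eval x (substHom lam P) = eval (chowCoord lam (lam *ᵥ x)) P := by
  have : (aeval (R := K) x).comp (substHom lam) = aeval (chowCoord lam (lam *ᵥ x)) := by
    apply algHom_ext
    rintro ⟨i, _ | j⟩
    · simp [substHom, ← eval_linForm]
    · simp [substHom]
  exact congr($this P)

theorem substHom_mem_vanishingIdeal {V : Set (Fin n → K)} {P : MvPolynomial (ChowVar d n) K}
    (hP : P ∈ chowIdeal d V) (lam : Matrix (Fin (d + 1)) (Fin n) K) :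
    substHom lam P ∈ vanishingIdeal K V := by
  intro x hx
  rw [aeval_eq_eval, eval_substHom, mem_chowIdeal.1 hP lam x hx]

theorem comorphism_specHom (V : Set (Fin n → K)) (lam : Matrix (Fin (d + 1)) (Fin n) K)
    (Q : MvPolynomial (ChowVar' d n) K) :
    comorphism V (fun i : Fin d => linForm lam i.castSucc) (specHom lam Q) =
      Ideal.Quotient.mk (vanishingIdeal K V) (substHom lam (rename Subtype.val Q)) := by
  have : (comorphism V (fun i : Fin d => linForm lam i.castSucc)).comp (specHom lam) =
      (Ideal.Quotient.mkₐ K (vanishingIdeal K V)).comp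
        ((substHom lam).comp (rename Subtype.val)) := by
    apply algHom_ext
    rintro ⟨⟨i, _ | j⟩, hb⟩
    · induction i using Fin.lastCases with
      | last => exact absurd rfl hb
      | cast i => simp [comorphism, specHom, substHom]
    · simp [comorphism, specHom, substHom]
      rfl
  exact congr($this Q)

theorem eval₂_comorphism_map_specHom (V : Set (Fin n → K)) (lam : Matrix (Fin (d + 1)) (Fin n) K)
    (P : MvPolynomial (ChowVar d n) K) :
    ((toTop K d n P).map (specHom lam).toRingHom).eval₂
      (comorphism V (fun i : Fin d => linForm lam i.castSucc)).toRingHom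
      (Ideal.Quotient.mk (vanishingIdeal K V) (linForm lam (Fin.last d))) =
      Ideal.Quotient.mk (vanishingIdeal K V) (substHom lam P) := by
  have h1 := eval₂_toTop (R := K) ((Ideal.Quotient.mkₐ K (vanishingIdeal K V)).comp (substHom lam)) P
  rw [Polynomial.eval₂_map]
  refine Eq.trans ?_ h1
  congr 1
  · exact RingHom.ext fun Q => comorphism_specHom V lam Q
  · simp [substHom]

end generic

end NoetherPrim

end

/-! ### Finiteness and primitivity from the Chow form. -/

noncomputable section

namespace NoetherPrim

open MvPolynomial

section

variable {K : Type*} [Field K] [IsAlgClosed K] {d n : ℕ} {V : Set (Fin n → K)}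
  {F : MvPolynomial (ChowVar d n) K}

/-- In a leading monomial the last value alone exhausts the bound on the total degree in the values.
-/
theorem IsChowForm.degreeOf_none_leadingCoeff (hV : IsPure d V) (hF : IsChowForm V F)
    (b : ChowVar' d n) (hb : b.1.2 = none) : ((toTop K d n F).leadingCoeff).degreeOf b = 0 := by
  classical
  refine Nat.eq_zero_of_le_zero ?_
  rw [degreeOf_le_iff]
  intro t ht
  have h1 : topExp (F.degreeOf (ChowVar.top d n)) t ∈ F.support := by
    rw [mem_support_iff] at ht ⊢
    rwa [Polynomial.leadingCoeff, natDegree_toTop, coeff_coeff_toTop] at ht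
  have h2 := hF.sum_none_le hV h1
  obtain ⟨⟨i, o⟩, hbt⟩ := b
  obtain rfl : o = none := hb
  have hi : i ∈ Finset.univ.erase (Fin.last d) :=
    Finset.mem_erase.2 ⟨fun h => hbt (by rw [h]), Finset.mem_univ _⟩
  rw [← Finset.add_sum_erase _ _ (Finset.mem_univ (Fin.last d)), topExp_top,
    ← Finset.add_sum_erase _ _ hi, topExp_of_ne _ t ⟨(i, none), hbt⟩] at h2
  omega

theorem IsChowForm.specHom_leadingCoeff (hV : IsPure d V) (hF : IsChowForm V F)
    (lam : Matrix (Fin (d + 1)) (Fin n) K) (y : Fin (d + 1) → K) :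
    specHom lam (toTop K d n F).leadingCoeff =
      C (eval (fun b : ChowVar' d n => chowCoord lam y b.1) (toTop K d n F).leadingCoeff) := by
  classical
  refine hom_congr_vars (f₁ := (specHom lam).toRingHom)
    (f₂ := C.comp (eval fun b : ChowVar' d n => chowCoord lam y b.1)) ?_ ?_ rfl
  · ext r; simp [algebraMap_eq]
  · rintro ⟨⟨i, _ | j⟩, hb⟩ hvars _
    · have := hF.degreeOf_none_leadingCoeff hV ⟨(i, none), hb⟩ rfl
      rw [degreeOf_def, Multiset.count_eq_zero, ← Multiset.mem_toFinset, ← vars_def] at this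
      exact absurd hvars this
    · simp [specHom]

theorem eval₂_map_specHom_eq_zero (V : Set (Fin n → K)) (lam : Matrix (Fin (d + 1)) (Fin n) K)
    {p : Polynomial (MvPolynomial (ChowVar' d n) K)} {β : CoordRing K V}
    (h : p.eval₂ ((chowHom d (vanishingIdeal K V)).comp (rename Subtype.val)).toRingHom (C β) = 0) :
    (p.map (specHom lam).toRingHom).eval₂
      (comorphism V (fun i : Fin d => linForm lam i.castSucc)).toRingHom β = 0 := by
  set sp : MvPolynomial (Fin (d + 1) × Fin n) (CoordRing K V) →+* CoordRing K V :=
    eval (fun ij => Ideal.Quotient.mk (vanishingIdeal K V) (C (lam ij.1 ij.2))) with hsp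
  have h1 : sp.comp ((chowHom d (vanishingIdeal K V)).comp (rename Subtype.val)).toRingHom =
      (comorphism V (fun i : Fin d => linForm lam i.castSucc)).toRingHom.comp
        (specHom lam).toRingHom := by
    have h2 : sp.comp (chowHom d (vanishingIdeal K V)).toRingHom =
        (Ideal.Quotient.mk (vanishingIdeal K V)).comp (substHom lam).toRingHom := by
      apply ringHom_ext
      · intro r
        have e1 : chowHom d (vanishingIdeal K V) (C r) =
          C (Ideal.Quotient.mk (vanishingIdeal K V) (C r)) := (chowHom d _).commutes r
        have e2 : substHom lam (C r : MvPolynomial (ChowVar d n) K) = C r :=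
          (substHom lam).commutes r
        change sp (chowHom d (vanishingIdeal K V) (C r)) =
          Ideal.Quotient.mk (vanishingIdeal K V) (substHom lam (C r))
        rw [e1, e2, hsp, eval_C]
      · rintro ⟨i, _ | j⟩
        · change sp (chowHom d (vanishingIdeal K V) (X (i, none))) =
            Ideal.Quotient.mk (vanishingIdeal K V) (substHom lam (X (i, none)))
          rw [chowHom_X_none]
          simp [hsp, substHom, linForm]
        · change sp (chowHom d (vanishingIdeal K V) (X (i, some j))) =
            Ideal.Quotient.mk (vanishingIdeal K V) (substHom lam (X (i, some j)))
          rw [chowHom_X_some]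
          simp [hsp, substHom]
    refine RingHom.ext fun Q => ?_
    refine (DFunLike.congr_fun h2 (rename Subtype.val Q)).trans ?_
    exact (comorphism_specHom V lam Q).symm
  have h3 := congrArg sp h
  rw [Polynomial.hom_eval₂, map_zero, h1, hsp, eval_C] at h3
  rw [Polynomial.eval₂_map]
  exact h3

/-- After specialization the relation for each coordinate has leading coefficient in `K`, because no
values occur in it; when nonzero it can be inverted. -/
theorem IsChowForm.comorphism_isIntegral (hV : IsPure d V) (hF : IsChowForm V F)
    {lam : Matrix (Fin (d + 1)) (Fin n) K}
    (hlam : specHom lam (toTop K d n F).leadingCoeff ≠ 0) :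
    (comorphism V (fun i : Fin d => linForm lam i.castSucc)).toRingHom.IsIntegral := by
  set φ := comorphism V (fun i : Fin d => linForm lam i.castSucc) with hφ
  set c := eval (fun b : ChowVar' d n => chowCoord lam 0 b.1) (toTop K d n F).leadingCoeff
  have hc : specHom lam (toTop K d n F).leadingCoeff = C c := hF.specHom_leadingCoeff hV lam 0
  have hc0 : c ≠ 0 := by
    rintro h
    rw [hc, h, C_0] at hlam
    exact hlam rfl
  have hx : ∀ j, φ.toRingHom.IsIntegralElem (Ideal.Quotient.mk (vanishingIdeal K V) (X j)) := by
    intro j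
    have h1 := RingHom.isIntegralElem_leadingCoeff_mul _ _ _
      (eval₂_map_specHom_eq_zero V lam (hF.eval₂_coordRelation hV j))
    rw [Polynomial.leadingCoeff_map_of_leadingCoeff_ne_zero _ (by
      rw [hF.leadingCoeff_coordRelation hV]; exact hlam), hF.leadingCoeff_coordRelation hV] at h1
    change φ.toRingHom.IsIntegralElem (φ (specHom lam _) * _) at h1
    rw [hc] at h1
    have h2 := RingHom.IsIntegralElem.mul (R := MvPolynomial (Fin d) K) (S := CoordRing K V)
      φ.toRingHom (RingHom.isIntegralElem_map _ (x := C c⁻¹)) h1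
    have h3 : φ.toRingHom (C c⁻¹) * (φ (C c) * Ideal.Quotient.mk (vanishingIdeal K V) (X j)) =
        Ideal.Quotient.mk (vanishingIdeal K V) (X j) := by
      change φ (C c⁻¹) * _ = _
      rw [← mul_assoc, ← map_mul, ← C_mul, inv_mul_cancel₀ hc0, C_1, map_one, one_mul]
    rwa [h3] at h2
  intro β
  obtain ⟨p, rfl⟩ := Ideal.Quotient.mk_surjective β
  induction p using MvPolynomial.induction_on with
  | C r =>
    have : Ideal.Quotient.mk (vanishingIdeal K V) (C r) = φ.toRingHom (C r) :=
      (φ.commutes r).symm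
    rw [this]
    exact RingHom.isIntegralElem_map _
  | add p q hp hq =>
    rw [map_add]
    exact RingHom.IsIntegralElem.add (R := MvPolynomial (Fin d) K) (S := CoordRing K V) _ hp hq
  | mul_X p j hp =>
    rw [map_mul]
    exact RingHom.IsIntegralElem.mul (R := MvPolynomial (Fin d) K) (S := CoordRing K V) _ hp (hx j)

theorem IsChowForm.isFiniteMorphism (hV : IsPure d V) (hF : IsChowForm V F)
    {lam : Matrix (Fin (d + 1)) (Fin n) K}
    (hlam : specHom lam (toTop K d n F).leadingCoeff ≠ 0) :
    IsFiniteMorphism V (fun i : Fin d => linForm lam i.castSucc) := by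
  rintro C ⟨q, hq, rfl⟩
  have hqp := hq.1.1
  have hqv : vanishingIdeal K (zeroLocus K q) = q := IsPrime.vanishingIdeal_zeroLocus (K := K) q
  have hle : vanishingIdeal K V ≤ vanishingIdeal K (zeroLocus K q) := by
    rw [hqv]; exact hq.1.2
  have hint : (comorphism (zeroLocus K q)
      (fun i : Fin d => linForm lam i.castSucc)).toRingHom.IsIntegral := by
    have h1 := (hF.comorphism_isIntegral hV hlam)
    have h2 : (comorphism (zeroLocus K q) (fun i : Fin d => linForm lam i.castSucc)) =
        (Ideal.Quotient.factorₐ K hle).comp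
          (comorphism V (fun i : Fin d => linForm lam i.castSucc)) := by
      apply algHom_ext
      intro i
      simp [comorphism]
    rw [h2]
    exact h1.trans _ _ (RingHom.isIntegral_of_surjective _ (Ideal.Quotient.factor_surjective hle))
  refine ⟨?_, hint⟩
  have hprime : (vanishingIdeal K (zeroLocus K q)).IsPrime := by rwa [hqv]
  have hinj : Function.Injective (comorphism (zeroLocus K q)
      (fun i : Fin d => linForm lam i.castSucc)) := by
    set φ := comorphism (zeroLocus K q) (fun i : Fin d => linForm lam i.castSucc) with hφ
    set y : Fin d → CoordRing K (zeroLocus K q) := fun i =>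
      Ideal.Quotient.mk (vanishingIdeal K (zeroLocus K q)) (linForm lam i.castSucc) with hy
    have hφy : φ = aeval y := rfl
    have : Algebra.IsAlgebraic (Algebra.adjoin K (Set.range y)) (CoordRing K (zeroLocus K q)) := by
      constructor
      intro β
      obtain ⟨p, hp, hp0⟩ := hint β
      have hmem : ∀ r, φ r ∈ Algebra.adjoin K (Set.range y) := by
        intro r
        rw [hφy, Algebra.adjoin_range_eq_range_aeval]
        exact ⟨r, rfl⟩
      let ψ : MvPolynomial (Fin d) K →+* Algebra.adjoin K (Set.range y) :=
        (φ.codRestrict _ hmem).toRingHom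
      refine IsIntegral.isAlgebraic ⟨p.map ψ, hp.map _, ?_⟩
      rw [Polynomial.eval₂_map]
      exact hp0
    have htr : Algebra.trdeg K (CoordRing K (zeroLocus K q)) = d := by
      have := hV.trdeg_eq q hq
      change Algebra.trdeg K (_ ⧸ vanishingIdeal K (zeroLocus K q)) = d
      rwa [hqv]
    -- The component has dimension `d` and is algebraic over the `d` forms, which are therefore
    -- independent; injectivity of the comorphism is dominance.
    have h3 := Algebra.IsAlgebraic.isTranscendenceBasis_of_lift_le_trdeg_of_finite K y
      (by rw [htr]; simp)
    exact h3.1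
  refine Set.eq_univ_of_univ_subset fun z _ g hg => ?_
  have hg0 : comorphism (zeroLocus K q) (fun i : Fin d => linForm lam i.castSucc) g = 0 := by
    have h4 : comorphism (zeroLocus K q) (fun i : Fin d => linForm lam i.castSucc) g =
        Ideal.Quotient.mk (vanishingIdeal K (zeroLocus K q))
          (aeval (fun i : Fin d => linForm lam i.castSucc) g) := by
      have : comorphism (zeroLocus K q) (fun i : Fin d => linForm lam i.castSucc) =
          (Ideal.Quotient.mkₐ K _).comp (aeval fun i : Fin d => linForm lam i.castSucc) := by
        apply algHom_ext
        intro i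
        simp [comorphism]
      exact congr($this g)
    rw [h4, Ideal.Quotient.eq_zero_iff_mem]
    intro x hx
    have h5 := hg _ ⟨x, hx, rfl⟩
    have h6 : (aeval (R := K) x).comp (aeval fun i : Fin d => linForm lam i.castSucc) =
        aeval (polyMap (fun i : Fin d => linForm lam i.castSucc) x) := by
      apply algHom_ext
      intro i
      simp [polyMap]
    exact (congr($h6 g)).trans h5
  rw [map_eq_zero_iff _ hinj] at hg0
  rw [hg0, map_zero]

/-- Bézout for `f` and `f'`, read at the root `b`, gives `r = f'(b) q(b)` with `r ≠ 0`, and the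
differential relation rewrites `f'(b) x_j` as a polynomial in `b`. Hence `r x_j` is a polynomial in
`b`. -/
theorem IsChowForm.inducesPrimitiveElement (hF : IsChowForm V F)
    {lam : Matrix (Fin (d + 1)) (Fin n) K}
    (hlam : specHom lam (toTop K d n F).leadingCoeff ≠ 0)
    (hdisc : specHom lam (chowDisc F) ≠ 0) :
    InducesPrimitiveElement
      (comorphism V (fun i : Fin d => linForm lam i.castSucc)).toRingHom
      (Ideal.Quotient.mk (vanishingIdeal K V) (linForm lam (Fin.last d))) := by
  have := IsAlgClosed.instInfinite (K := K)
  set φ := comorphism V (fun i : Fin d => linForm lam i.castSucc) with hφ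
  set b := Ideal.Quotient.mk (vanishingIdeal K V) (linForm lam (Fin.last d)) with hb
  set f := (toTop K d n F).map (specHom lam).toRingHom with hf
  have hFmem : F ∈ chowIdeal d V := hF.mem_iff.2 dvd_rfl
  have hf0 : f ≠ 0 := by
    intro h0
    have h1 := congr(Polynomial.coeff $h0 (toTop K d n F).natDegree)
    rw [hf, Polynomial.coeff_map, Polynomial.coeff_zero] at h1
    exact hlam h1
  have hfb : f.eval₂ φ.toRingHom b = 0 := by
    rw [hf, hφ, hb, eval₂_comorphism_map_specHom, Ideal.Quotient.eq_zero_iff_mem]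
    exact substHom_mem_vanishingIdeal hFmem lam
  have hbez : ∃ p q : Polynomial (MvPolynomial (Fin d) K), ∃ r, r ≠ 0 ∧
      f * p + Polynomial.derivative f * q = Polynomial.C r := by
    have hdeg : f.natDegree ≤ F.degreeOf (ChowVar.top d n) := by
      rw [← natDegree_toTop]
      exact Polynomial.natDegree_map_le
    -- In degree zero the resultant identity is not available, but `f` is itself a nonzero constant.
    rcases Nat.eq_zero_or_pos (F.degreeOf (ChowVar.top d n)) with h0 | h0
    · rw [h0] at hdeg
      have h1 := Polynomial.eq_C_of_natDegree_le_zero hdeg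
      refine ⟨1, 0, f.coeff 0, fun h2 => hf0 (by rw [h1, h2, Polynomial.C_0]), ?_⟩
      rw [mul_one, mul_zero, add_zero, ← h1]
    · obtain ⟨p, q, -, -, hpq⟩ := Polynomial.exists_mul_add_mul_eq_C_resultant f
        (Polynomial.derivative f) hdeg ((Polynomial.natDegree_derivative_le f).trans
          (Nat.sub_le_sub_right hdeg 1)) (Or.inl h0.ne')
      refine ⟨p, q, _, ?_, hpq⟩
      rw [hf, Polynomial.derivative_map, Polynomial.resultant_map_map]
      exact hdisc
  obtain ⟨p, q, r, hr, hpq⟩ := hbez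
  refine inducesPrimitiveElement_of_forall φ.toRingHom b
    (fun j => Ideal.Quotient.mk (vanishingIdeal K V) (X j)) ?_ ⟨f, hf0, hfb⟩ ?_
  · intro S hS hX β
    obtain ⟨P, rfl⟩ := Ideal.Quotient.mk_surjective β
    induction P using MvPolynomial.induction_on with
    | C c =>
      have : Ideal.Quotient.mk (vanishingIdeal K V) (C c) = φ.toRingHom (C c) :=
        (φ.commutes c).symm
      rw [this]
      exact hS _
    | add P Q hP hQ =>
      rw [map_add]
      exact S.add_mem hP hQ
    | mul_X P j hP =>
      rw [map_mul]
      exact S.mul_mem hP (hX j)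
  · intro j
    refine ⟨r, hr, -(q * (toTop K d n (pderiv (Fin.last d, some j) F)).map
      (specHom lam).toRingHom), ?_⟩
    have h1 : φ.toRingHom r = (Polynomial.derivative f).eval₂ φ.toRingHom b *
        q.eval₂ φ.toRingHom b := by
      have := congr(Polynomial.eval₂ φ.toRingHom b $hpq)
      rw [Polynomial.eval₂_add, Polynomial.eval₂_mul, hfb, zero_mul, zero_add,
        Polynomial.eval₂_mul, Polynomial.eval₂_C] at this
      exact this.symm
    have h2 : (Polynomial.derivative f).eval₂ φ.toRingHom b =
        Ideal.Quotient.mk (vanishingIdeal K V) (substHom lam (pderiv (ChowVar.top d n) F)) := by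
      rw [hf, Polynomial.derivative_map, derivative_toTop, hφ, hb, eval₂_comorphism_map_specHom]
    have h3 : Ideal.Quotient.mk (vanishingIdeal K V)
        (substHom lam (pderiv (Fin.last d, some j) F)) +
        Ideal.Quotient.mk (vanishingIdeal K V) (X j) *
        Ideal.Quotient.mk (vanishingIdeal K V) (substHom lam (pderiv (ChowVar.top d n) F)) = 0 := by
      rw [← map_mul, ← map_add, Ideal.Quotient.eq_zero_iff_mem]
      intro x hx
      have h4 := eval_pderiv_of_mem_chowIdeal hFmem lam hx (Fin.last d) j
      rw [aeval_eq_eval, map_add, map_mul, eval_X, eval_substHom, eval_substHom]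
      exact h4
    rw [Polynomial.eval₂_neg, Polynomial.eval₂_mul, hφ, hb, eval₂_comorphism_map_specHom, ← hφ,
      ← hb, h1, h2]
    linear_combination (q.eval₂ φ.toRingHom b) * h3

end

end NoetherPrim

end

/-! ### Uniform bounds for finite linear sections, from Zariski's main theorem. -/

/-- The function `g` isolates the point in its fibre, so the algebra is quasi-finite there and
Zariski's main theorem applies. -/
theorem Algebra.ZariskisMainProperty.of_notMem {R S K : Type*} [CommRing R] [CommRing S] [Field K]
    [Algebra R S] [Algebra.FiniteType R S] (h : S →+* K) (g : S) (hg : h g ≠ 0)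
    (H : ∀ q : Ideal S, q.IsPrime → q.comap (algebraMap R S) =
      (RingHom.ker h).comap (algebraMap R S) → g ∉ q → q = RingHom.ker h) :
    Algebra.ZariskisMainProperty R (RingHom.ker h) := by
  have hprime : (RingHom.ker h).IsPrime := RingHom.ker_isPrime h
  have : Algebra.QuasiFiniteAt R (RingHom.ker h) := by
    refine Algebra.QuasiFiniteAt.of_isOpen_singleton_fiber ⟨RingHom.ker h, hprime⟩ ?_
    rw [isOpen_induced_iff]
    refine ⟨PrimeSpectrum.basicOpen g, (PrimeSpectrum.basicOpen g).isOpen, ?_⟩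
    ext q
    rw [Set.mem_preimage, SetLike.mem_coe, PrimeSpectrum.mem_basicOpen, Set.mem_singleton_iff]
    constructor
    · intro hgq
      have hq : PrimeSpectrum.comap (algebraMap R S) q.1 = _ := q.2
      have h1 : q.1.asIdeal = RingHom.ker h :=
        H q.1.asIdeal q.1.isPrime congr(PrimeSpectrum.asIdeal $hq) hgq
      exact Subtype.ext (PrimeSpectrum.ext h1)
    · intro hq
      rw [hq]
      exact hg
  exact .of_finiteType _

/-- Call `r` good if it is integral and every element becomes integral after multiplication by a
power of `r`. Where `r ≠ 0`, a point is determined by the values of `r` and `r ^ m k * x k`, roots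
of fixed monic polynomials specialized by `ρ`; this bounds such points independently of `ρ`. Each
point of `T` has a nonvanishing good element, and finitely many of them suffice by noetherianity. -/
theorem Algebra.exists_ncard_le_of_zariskisMainProperty {R S K ι X : Type*} [CommRing R]
    [CommRing S] [Field K] [Algebra R S] [IsNoetherianRing S] [Fintype ι] (x : ι → S)
    (h : X → S →+* K) :
    ∃ N : ℕ, ∀ (ρ : R →+* K) (T : Set X),
      (∀ t ∈ T, (h t).comp (algebraMap R S) = ρ) →
      (∀ t ∈ T, Algebra.ZariskisMainProperty R (RingHom.ker (h t))) →
      (∀ t ∈ T, ∀ t' ∈ T, (∀ k, h t (x k) = h t' (x k)) → t = t') → T.Finite ∧ T.ncard ≤ N := by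
  classical
  let good : Set S := {r | IsIntegral R r ∧ ∀ s, ∃ m, IsIntegral R (r ^ m * s)}
  have hbound : ∀ r ∈ good, ∃ N : ℕ, ∀ (ρ : R →+* K) (T : Set X),
      (∀ t ∈ T, (h t).comp (algebraMap R S) = ρ) → (∀ t ∈ T, h t r ≠ 0) →
      (∀ t ∈ T, ∀ t' ∈ T, (∀ k, h t (x k) = h t' (x k)) → t = t') →
      T.Finite ∧ T.ncard ≤ N := by
    rintro r ⟨hr, hr'⟩
    choose m hm using fun k => hr' (x k)
    let u : Option ι → S := fun o => o.elim r fun k => r ^ m k * x k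
    have hu : ∀ o, IsIntegral R (u o) := by
      rintro (_ | k)
      · exact hr
      · exact hm k
    choose p hp hp0 using hu
    refine ⟨∏ o, (p o).natDegree, fun ρ T hρ hT hinj => ?_⟩
    let Z : Finset (Option ι → K) := Fintype.piFinset fun o => ((p o).map ρ).roots.toFinset
    have hmem : ∀ t ∈ T, (fun o => h t (u o)) ∈ (Z : Set (Option ι → K)) := by
      intro t ht
      rw [Finset.mem_coe, Fintype.mem_piFinset]
      intro o
      rw [Multiset.mem_toFinset, Polynomial.mem_roots ((hp o).map ρ).ne_zero, Polynomial.IsRoot.def,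
        Polynomial.eval_map, ← hρ t ht, ← Polynomial.hom_eval₂, hp0, map_zero]
    have hinjOn : Set.InjOn (fun t => fun o => h t (u o)) T := by
      intro t ht t' ht' heq
      refine hinj t ht t' ht' fun k => ?_
      have h1 : h t r = h t' r := congr_fun heq none
      have h2 : h t (r ^ m k * x k) = h t' (r ^ m k * x k) := congr_fun heq (some k)
      rw [map_mul, map_mul, map_pow, map_pow, h1] at h2
      exact mul_left_cancel₀ (pow_ne_zero _ (hT t' ht')) h2
    refine ⟨Set.Finite.of_finite_image (Z.finite_toSet.subset (Set.image_subset_iff.2 hmem)) hinjOn,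
      ?_⟩
    refine (Set.ncard_le_ncard_of_injOn _ hmem hinjOn Z.finite_toSet).trans ?_
    rw [Set.ncard_coe_finset, Fintype.card_piFinset]
    refine Finset.prod_le_prod' fun o _ => ?_
    refine (Multiset.toFinset_card_le _).trans ((Polynomial.card_roots' _).trans ?_)
    exact Polynomial.natDegree_map_le
  obtain ⟨G, hG, hspan⟩ := (Submodule.fg_span_iff_fg_span_finset_subset good).1
    (IsNoetherian.noetherian (Ideal.span good))
  choose! N hN using hbound
  refine ⟨∑ r ∈ G, N r, fun ρ T hρ hT hinj => ?_⟩
  have hcover : T = ⋃ r ∈ G, {t ∈ T | h t r ≠ 0} := by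
    ext t
    simp only [Set.mem_iUnion, Set.mem_ofPred_eq, exists_prop]
    constructor
    · intro ht
      obtain ⟨r, hr, hr1, hr2⟩ := Algebra.zariskisMainProperty_iff.1 (hT t ht)
      by_contra! hcon
      have hle : Ideal.span (G : Set S) ≤ RingHom.ker (h t) := by
        rw [Ideal.span_le]
        intro g hg
        exact hcon g hg ht
      refine hr (hle ?_)
      have h3 : r ∈ Ideal.span good := Ideal.subset_span ⟨hr1, hr2⟩
      have h4 : Ideal.span good = Ideal.span (G : Set S) := hspan
      rwa [h4] at h3
    · rintro ⟨r, -, ht, -⟩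
      exact ht
  have hr : ∀ r ∈ G, ({t ∈ T | h t r ≠ 0}).Finite ∧ ({t ∈ T | h t r ≠ 0}).ncard ≤ N r :=
    fun r hr => hN r (hG hr) ρ _ (fun t ht => hρ t ht.1) (fun t ht => ht.2)
      fun t ht t' ht' => hinj t ht.1 t' ht'.1
  refine ⟨?_, ?_⟩
  · rw [hcover]
    exact G.finite_toSet.biUnion fun r hr' => (hr r hr').1
  · calc T.ncard = (⋃ r ∈ G, {t ∈ T | h t r ≠ 0}).ncard := by rw [← hcover]
      _ ≤ ∑ r ∈ G, ({t ∈ T | h t r ≠ 0}).ncard := Finset.set_ncard_biUnion_le _ _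
      _ ≤ ∑ r ∈ G, N r := Finset.sum_le_sum fun r hr' => (hr r hr').2

noncomputable section

namespace NoetherPrim

open MvPolynomial

section

variable {K : Type*} [Field K] {d n : ℕ}

/-- Evaluation of the universal family of linear sections at a point. -/
def pointHom (lam : Matrix (Fin (d + 1)) (Fin n) K) (J : Ideal (MvPolynomial (Fin n) K))
    (x : zeroLocus K J) :
    MvPolynomial (Fin (d + 1) × Fin n) (MvPolynomial (Fin n) K ⧸ J) →+* K :=
  (eval fun ij => lam ij.1 ij.2).comp (map (evalQuot J x.1 x.2).toRingHom)

theorem pointHom_C (lam : Matrix (Fin (d + 1)) (Fin n) K) (J : Ideal (MvPolynomial (Fin n) K))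
    (x : zeroLocus K J) (f : MvPolynomial (Fin n) K) :
    pointHom lam J x (C (Ideal.Quotient.mk J f)) = eval x.1 f := by
  simp [pointHom]

open Matrix in
theorem pointHom_chowHom (lam : Matrix (Fin (d + 1)) (Fin n) K)
    (J : Ideal (MvPolynomial (Fin n) K)) (x : zeroLocus K J) (P : MvPolynomial (ChowVar d n) K) :
    pointHom lam J x (chowHom d J P) = eval (chowCoord lam (lam *ᵥ x.1)) P :=
  eval_map_chowHom J x.1 x.2 lam P

/-- The surjection onto the coordinate ring of the universal family. -/
def universalHom (d : ℕ) (J : Ideal (MvPolynomial (Fin n) K)) :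
    MvPolynomial (Fin n ⊕ Fin (d + 1) × Fin n) K →ₐ[K]
      MvPolynomial (Fin (d + 1) × Fin n) (MvPolynomial (Fin n) K ⧸ J) :=
  aeval (Sum.elim (fun j => C (Ideal.Quotient.mk J (X j))) fun b => X b)

theorem universalHom_rename (J : Ideal (MvPolynomial (Fin n) K)) (f : MvPolynomial (Fin n) K) :
    universalHom d J (rename Sum.inl f) = C (Ideal.Quotient.mk J f) := by
  have : (universalHom d J).comp (rename Sum.inl) =
      (((Algebra.ofId (MvPolynomial (Fin n) K ⧸ J)
        (MvPolynomial (Fin (d + 1) × Fin n) (MvPolynomial (Fin n) K ⧸ J))).restrictScalars K).comp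
        (Ideal.Quotient.mkₐ K J)) := by
    apply algHom_ext
    intro i
    simp [universalHom]
  exact congr($this f)

theorem universalHom_surjective (J : Ideal (MvPolynomial (Fin n) K)) :
    Function.Surjective (universalHom d J) := by
  intro b
  induction b using MvPolynomial.induction_on with
  | C a =>
    obtain ⟨f, rfl⟩ := Ideal.Quotient.mk_surjective a
    exact ⟨rename Sum.inl f, universalHom_rename J f⟩
  | add p q hp hq =>
    obtain ⟨a, rfl⟩ := hp
    obtain ⟨b, rfl⟩ := hq
    exact ⟨a + b, map_add _ _ _⟩
  | mul_X p i hp =>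
    obtain ⟨a, rfl⟩ := hp
    exact ⟨a * X (Sum.inr i), by rw [map_mul]; simp [universalHom]⟩

open Matrix in
theorem exists_separating {s : Set (Fin n → K)} (hs : s.Finite) (x : Fin n → K) :
    ∃ g : MvPolynomial (Fin n) K, eval x g ≠ 0 ∧ ∀ x' ∈ s, eval x' g ≠ 0 → x' = x := by
  classical
  have hex : ∀ x' : Fin n → K, ∃ l : MvPolynomial (Fin n) K, eval x' l = 0 ∧
      (x' ≠ x → eval x l ≠ 0) := by
    intro x'
    by_cases h : x' = x
    · exact ⟨0, by simp, fun h' => absurd h h'⟩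
    · obtain ⟨i, hi⟩ := Function.ne_iff.1 h
      exact ⟨X i - C (x' i), by simp, fun _ => by simpa [sub_eq_zero] using hi.symm⟩
  choose l hl hl' using hex
  refine ⟨∏ x' ∈ hs.toFinset.erase x, l x', ?_, ?_⟩
  · rw [map_prod, Finset.prod_ne_zero_iff]
    intro x' hx'
    exact hl' x' (Finset.ne_of_mem_erase hx')
  · intro x' hx' h
    by_contra hne
    rw [map_prod, Finset.prod_ne_zero_iff] at h
    exact h x' (Finset.mem_erase.2 ⟨hne, hs.mem_toFinset.2 hx'⟩) (hl x')

open Matrix in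
-- The only `K`-point of the zero locus of `q` with `g ≠ 0` is `x`. So if `u` vanishes at `x`, then
-- `u g` vanishes on that locus and lies in `q` by the Nullstellensatz, whence `u ∈ q`. The other
-- inclusion follows by subtracting constants.
theorem eq_ker_pointHom_of_isPrime [IsAlgClosed K] (lam : Matrix (Fin (d + 1)) (Fin n) K)
    (J : Ideal (MvPolynomial (Fin n) K)) (x : zeroLocus K J) (g : MvPolynomial (Fin n) K)
    (hg : ∀ x' ∈ zeroLocus K J, lam *ᵥ x' = lam *ᵥ x.1 → eval x' g ≠ 0 → x' = x.1)
    (q : Ideal (MvPolynomial (Fin (d + 1) × Fin n) (MvPolynomial (Fin n) K ⧸ J))) (hq : q.IsPrime)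
    (hcomap : ∀ P : MvPolynomial (ChowVar d n) K, eval (chowCoord lam (lam *ᵥ x.1)) P = 0 →
      chowHom d J P ∈ q)
    (hcomap' : ∀ P : MvPolynomial (ChowVar d n) K, chowHom d J P ∈ q →
      eval (chowCoord lam (lam *ᵥ x.1)) P = 0)
    (hgq : C (Ideal.Quotient.mk J g) ∉ q) : q = RingHom.ker (pointHom lam J x) := by
  have hle : RingHom.ker (pointHom lam J x) ≤ q := by
    intro u hu
    by_contra huq
    obtain ⟨u', hu'⟩ := universalHom_surjective (d := d) J u
    obtain ⟨g', hg'⟩ := universalHom_surjective (d := d) J (C (Ideal.Quotient.mk J g))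
    have hq' : (q.comap (universalHom d J)).IsPrime := Ideal.IsPrime.comap _
    have hnot : u' * g' ∉ q.comap (universalHom d J) := by
      rw [Ideal.mem_comap, map_mul, hu', hg']
      exact fun h => (hq.mem_or_mem h).elim huq hgq
    rw [← IsPrime.vanishingIdeal_zeroLocus (K := K) (q.comap (universalHom d J)),
      mem_vanishingIdeal_iff] at hnot
    push Not at hnot
    obtain ⟨z, hz, hzu⟩ := hnot
    rw [aeval_eq_eval, map_mul] at hzu
    set x' : Fin n → K := fun j => z (Sum.inl j) with hx'
    have hx'J : x' ∈ zeroLocus K J := by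
      intro f hf
      have h1 := hz (rename Sum.inl f) (by
        rw [Ideal.mem_comap, universalHom_rename, Ideal.Quotient.eq_zero_iff_mem.2 hf, C_0]
        exact q.zero_mem)
      rwa [aeval_rename] at h1
    have hzlam : ∀ b, z (Sum.inr b) = lam b.1 b.2 := by
      intro b
      have h1 := hz (X (Sum.inr b) - C (lam b.1 b.2)) (by
        rw [Ideal.mem_comap]
        have h2 := hcomap (X (b.1, some b.2) - C (lam b.1 b.2)) (by simp)
        rw [map_sub, chowHom_X_some] at h2
        rw [map_sub]
        convert h2 using 2
        · simp [universalHom]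
        · exact ((universalHom d J).commutes _).trans ((chowHom d J).commutes _).symm)
      rw [aeval_eq_eval, map_sub, eval_X, eval_C, sub_eq_zero] at h1
      exact h1
    have heval : ∀ w, eval z w = pointHom lam J ⟨x', hx'J⟩ (universalHom d J w) := by
      intro w
      have : (eval z) = (pointHom lam J ⟨x', hx'J⟩).comp (universalHom d J).toRingHom := by
        apply ringHom_ext
        · intro r
          have h3 : universalHom d J (C r) = C (Ideal.Quotient.mk J (C r)) :=
            (universalHom d J).commutes r
          change _ = pointHom lam J ⟨x', hx'J⟩ (universalHom d J (C r))
          rw [h3, pointHom_C, eval_C, eval_C]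
        · rintro (j | b)
          · change _ = pointHom lam J ⟨x', hx'J⟩ (universalHom d J (X (Sum.inl j)))
            have h3 : universalHom d J (X (Sum.inl j)) = C (Ideal.Quotient.mk J (X j)) := by
              simp [universalHom]
            rw [h3, pointHom_C, eval_X, eval_X]
          · change _ = pointHom lam J ⟨x', hx'J⟩ (universalHom d J (X (Sum.inr b)))
            have h3 : universalHom d J (X (Sum.inr b)) = X b := by
              simp [universalHom]
            rw [h3, eval_X, hzlam]
            simp [pointHom]
      exact congr($this w)
    rw [heval, heval, hu', hg', pointHom_C] at hzu
    have hlam : lam *ᵥ x' = lam *ᵥ x.1 := by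
      ext i
      have h1 := hcomap (X (i, none) - C ((lam *ᵥ x.1) i)) (by simp)
      obtain ⟨w, hw⟩ := universalHom_surjective (d := d) J
        (chowHom d J (X (i, none) - C ((lam *ᵥ x.1) i)))
      have h2 := hz w (by rw [Ideal.mem_comap, hw]; exact h1)
      rw [aeval_eq_eval, heval, hw, pointHom_chowHom] at h2
      simpa [sub_eq_zero] using h2
    have hxx : x' = x.1 := hg x' hx'J hlam (right_ne_zero_of_mul hzu)
    have hxx' : (⟨x', hx'J⟩ : zeroLocus K J) = x := Subtype.ext hxx
    rw [hxx'] at hzu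
    exact left_ne_zero_of_mul hzu hu
  refine le_antisymm ?_ hle
  intro u hu
  obtain ⟨w, hw⟩ : ∃ c : K, pointHom lam J x u = c := ⟨_, rfl⟩
  have h1 : u - chowHom d J (C w) ∈ q := hle (by
    rw [RingHom.mem_ker, map_sub, hw, pointHom_chowHom, eval_C, sub_self])
  have h2 : chowHom d J (C w) ∈ q := by
    have h4 := Ideal.sub_mem (α := MvPolynomial (Fin (d + 1) × Fin n) (MvPolynomial (Fin n) K ⧸ J))
      q hu h1
    have h5 : u - (u - chowHom d J (C w)) = chowHom d J (C w) := by ring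
    exact (congrArg (· ∈ q) h5).mp h4
  have h3 := hcomap' _ h2
  rw [eval_C] at h3
  rw [RingHom.mem_ker, hw, h3]

open Matrix in
/-- The cardinalities of the finite linear sections of a closed set are bounded. -/
theorem exists_ncard_le [IsAlgClosed K] (d : ℕ) (J : Ideal (MvPolynomial (Fin n) K)) :
    ∃ N : ℕ, ∀ (lam : Matrix (Fin (d + 1)) (Fin n) K) (y : Fin (d + 1) → K),
      ({x ∈ zeroLocus K J | lam *ᵥ x = y}).Finite →
      ({x ∈ zeroLocus K J | lam *ᵥ x = y}).ncard ≤ N := by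
  let _ : Algebra (MvPolynomial (ChowVar d n) K)
    (MvPolynomial (Fin (d + 1) × Fin n) (MvPolynomial (Fin n) K ⧸ J)) :=
    (chowHom d J).toRingHom.toAlgebra
  have : IsScalarTower K (MvPolynomial (ChowVar d n) K)
      (MvPolynomial (Fin (d + 1) × Fin n) (MvPolynomial (Fin n) K ⧸ J)) :=
    IsScalarTower.of_algebraMap_eq fun r => ((chowHom d J).commutes r).symm
  have hft : Algebra.FiniteType K
      (MvPolynomial (Fin (d + 1) × Fin n) (MvPolynomial (Fin n) K ⧸ J)) :=
    Algebra.FiniteType.of_surjective (universalHom d J) (universalHom_surjective J)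
  have : Algebra.FiniteType (MvPolynomial (ChowVar d n) K)
      (MvPolynomial (Fin (d + 1) × Fin n) (MvPolynomial (Fin n) K ⧸ J)) :=
    Algebra.FiniteType.of_restrictScalars_finiteType K _ _
  obtain ⟨N, hN⟩ := Algebra.exists_ncard_le_of_zariskisMainProperty
    (R := MvPolynomial (ChowVar d n) K)
    (fun j : Fin n => (C (Ideal.Quotient.mk J (X j)) :
      MvPolynomial (Fin (d + 1) × Fin n) (MvPolynomial (Fin n) K ⧸ J)))
    (fun t : Matrix (Fin (d + 1)) (Fin n) K × zeroLocus K J => pointHom t.1 J t.2)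
  refine ⟨N, fun lam y hfin => ?_⟩
  set T : Set (Matrix (Fin (d + 1)) (Fin n) K × zeroLocus K J) :=
    {t | t.1 = lam ∧ lam *ᵥ t.2.1 = y} with hT
  have hmain := hN (eval (chowCoord lam y)) T ?_ ?_ ?_
  · have himg : {x ∈ zeroLocus K J | lam *ᵥ x = y} = (fun t => t.2.1) '' T := by
      ext x
      constructor
      · rintro ⟨hx, hxy⟩
        exact ⟨(lam, ⟨x, hx⟩), ⟨rfl, hxy⟩, rfl⟩
      · rintro ⟨t, ⟨-, ht⟩, rfl⟩
        exact ⟨t.2.2, ht⟩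
    rw [himg]
    exact (Set.ncard_image_le hmain.1).trans hmain.2
  · rintro ⟨lam', x⟩ ⟨h1, hx⟩
    change lam' = lam at h1
    change lam *ᵥ x.1 = y at hx
    refine RingHom.ext fun P => ?_
    change pointHom lam' J x (chowHom d J P) = _
    rw [h1, pointHom_chowHom, hx]
  · rintro ⟨lam', x⟩ ⟨h1, hx⟩
    change lam' = lam at h1
    change lam *ᵥ x.1 = y at hx
    have h2 : (lam', x) = (lam, x) := by rw [h1]
    rw [h2]
    obtain ⟨g, hg, hg'⟩ := exists_separating hfin x.1
    refine Algebra.ZariskisMainProperty.of_notMem (R := MvPolynomial (ChowVar d n) K)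
      (S := MvPolynomial (Fin (d + 1) × Fin n) (MvPolynomial (Fin n) K ⧸ J))
      (pointHom lam J x) (C (Ideal.Quotient.mk J g)) ?_ ?_
    · exact fun h => hg ((pointHom_C lam J x g).symm.trans h)
    · intro q hq hcomap hgq
      have hiff : ∀ P, chowHom d J P ∈ q ↔ eval (chowCoord lam (lam *ᵥ x.1)) P = 0 := by
        intro P
        rw [← pointHom_chowHom]
        exact (SetLike.ext_iff.1 hcomap P)
      exact eq_ker_pointHom_of_isPrime lam J x g
        (fun x' hx' h1 h2 => hg' x' ⟨hx', h1.trans hx⟩ h2) q hq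
        (fun P => (hiff P).2) (fun P => (hiff P).1) hgq
  · rintro ⟨lam', x⟩ ⟨h1, hx⟩ ⟨lam'', x'⟩ ⟨h1', hx'⟩ heq
    refine Prod.ext (h1.trans h1'.symm) (Subtype.ext (funext fun j => ?_))
    have := heq j
    rwa [pointHom_C, pointHom_C, eval_X, eval_X] at this

end

end NoetherPrim

end

/-! ### The degree of the Chow form and the degree of the variety. -/

noncomputable section

namespace NoetherPrim

open MvPolynomial

section degree

variable {k K : Type*} [Field k] [Field K] [Algebra k K] {d n : ℕ}

open Matrix in
theorem exists_matrix_mem_iff (L : AffineSubspace K (Fin n → K))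
    (hL : (L : Set (Fin n → K)).Nonempty) :
    ∃ (lam : Matrix (Fin (n + 1)) (Fin n) K) (y : Fin (n + 1) → K), ∀ x, x ∈ L ↔ lam *ᵥ x = y := by
  obtain ⟨x₀, hx₀⟩ := hL
  obtain ⟨W, hW⟩ := Submodule.exists_isCompl L.direction
  let f : (Fin n → K) →ₗ[K] (Fin n → K) :=
    W.subtype.comp (Submodule.projectionOnto W L.direction hW.symm)
  have hf : ∀ x, f x = 0 ↔ x ∈ L.direction := by
    intro x
    rw [← Submodule.ker_projectionOnto hW.symm, LinearMap.mem_ker]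
    simp [f]
  -- A zero row is appended only to match the `d + 1` rows of the uniform bound with `d = n`.
  let g : (Fin n → K) →ₗ[K] (Fin (n + 1) → K) :=
    LinearMap.pi (Fin.lastCases 0 fun i => (LinearMap.proj i).comp f)
  have hg : ∀ x, g x = 0 ↔ f x = 0 := by
    intro x
    constructor
    · intro h
      ext i
      simpa [g] using congr_fun h i.castSucc
    · intro h
      ext i
      induction i using Fin.lastCases with
      | last => simp [g]
      | cast i => simp [g, h]
  refine ⟨LinearMap.toMatrix' g, g x₀, fun x => ?_⟩
  rw [LinearMap.toMatrix'_mulVec, ← sub_eq_zero, ← map_sub, hg, hf, ← vsub_eq_sub,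
    AffineSubspace.vsub_right_mem_direction_iff_mem hx₀]

/-- The supremum of an unbounded set of naturals is `0` by convention, so boundedness must be known
first; the uniform bound on finite linear sections supplies it. -/
theorem ncard_inter_le_irreducibleDegree [IsAlgClosed K] {C : Set (Fin n → K)}
    (hC : zeroLocus K (vanishingIdeal K C) = C) (L : AffineSubspace K (Fin n → K))
    (hL : (L : Set (Fin n → K)).Nonempty)
    (hdim : (Module.finrank K L.direction : WithBot ℕ∞) + ringKrullDim (CoordRing k C) = n)
    (hfin : (C ∩ (L : Set (Fin n → K))).Finite) :
    (C ∩ (L : Set (Fin n → K))).ncard ≤ irreducibleDegree k C := by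
  refine le_csSup ?_ ⟨L, hL, hdim, hfin, rfl⟩
  obtain ⟨N, hN⟩ := exists_ncard_le n (vanishingIdeal K C)
  refine ⟨N, ?_⟩
  rintro _ ⟨L', hL', -, hfin', rfl⟩
  obtain ⟨lam, y, h⟩ := exists_matrix_mem_iff L' hL'
  have heq : C ∩ (L' : Set (Fin n → K)) =
      {x ∈ zeroLocus K (vanishingIdeal K C) | lam.mulVec x = y} := by
    rw [hC]
    ext x
    simp [h]
  rw [heq] at hfin' ⊢
  exact hN lam y hfin'

theorem zeroLocus_vanishingIdeal_zeroLocus (p : Ideal (MvPolynomial (Fin n) k)) :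
    zeroLocus K (vanishingIdeal K (zeroLocus K p)) = zeroLocus K p := by
  refine le_antisymm ?_ (zeroLocus_vanishingIdeal_le _)
  intro x hx f hf
  have h1 := hx (map (algebraMap k K) f) (fun y hy => by
    rw [aeval_map_algebraMap]
    exact hy f hf)
  rwa [aeval_map_algebraMap] at h1

theorem ncard_inter_le_varietyDegree [IsAlgClosed K] {V : Set (Fin n → K)}
    (hdim : ∀ p ∈ (vanishingIdeal k V : Ideal (MvPolynomial (Fin n) k)).minimalPrimes,
      ringKrullDim (MvPolynomial (Fin n) k ⧸ p) = d)
    (L : AffineSubspace K (Fin n → K)) (hL : (L : Set (Fin n → K)).Nonempty)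
    (hLd : Module.finrank K L.direction + d = n)
    (hfin : (zeroLocus K (vanishingIdeal k V : Ideal (MvPolynomial (Fin n) k)) ∩
      (L : Set (Fin n → K))).Finite) :
    (V ∩ (L : Set (Fin n → K))).ncard ≤ varietyDegree k V := by
  classical
  have hcf : (components k V).Finite :=
    (Ideal.finite_minimalPrimes_of_isNoetherianRing _ _).image _
  rw [varietyDegree, finsum_mem_eq_finite_toFinset_sum _ hcf]
  have hCfin : ∀ C ∈ hcf.toFinset, (C ∩ (L : Set (Fin n → K))).Finite := by
    intro C hC
    rw [hcf.mem_toFinset] at hC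
    obtain ⟨p, hp, rfl⟩ := hC
    exact hfin.subset (Set.inter_subset_inter_left _ (zeroLocus_anti_mono hp.1.2))
  have hsub : V ∩ (L : Set (Fin n → K)) ⊆ ⋃ C ∈ hcf.toFinset, C ∩ (L : Set (Fin n → K)) := by
    rintro x ⟨hxV, hxL⟩
    have : (RingHom.ker (aeval (R := k) x)).IsPrime := RingHom.ker_isPrime _
    obtain ⟨q, hq, hle⟩ := Ideal.exists_minimalPrimes_le
      (I := (vanishingIdeal k V : Ideal (MvPolynomial (Fin n) k)))
      (J := RingHom.ker (aeval (R := k) x)) (fun f hf => hf x hxV)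
    rw [Set.mem_iUnion₂]
    exact ⟨zeroLocus K q, hcf.mem_toFinset.2 ⟨q, hq, rfl⟩, fun f hf => hle hf, hxL⟩
  refine (Set.ncard_le_ncard hsub (hcf.toFinset.finite_toSet.biUnion hCfin)).trans ?_
  refine (Finset.set_ncard_biUnion_le _ _).trans (Finset.sum_le_sum fun C hC => ?_)
  have hf := hCfin C hC
  rw [hcf.mem_toFinset] at hC
  obtain ⟨p, hp, rfl⟩ := hC
  refine ncard_inter_le_irreducibleDegree (zeroLocus_vanishingIdeal_zeroLocus p) L hL ?_ hf
  have := hp.1.1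
  have hv : vanishingIdeal k (zeroLocus K p) = p := IsPrime.vanishingIdeal_zeroLocus (K := K) p
  change _ + ringKrullDim (MvPolynomial (Fin n) k ⧸ vanishingIdeal k (zeroLocus K p)) = _
  rw [hv, hdim p hp]
  exact_mod_cast hLd

open Matrix in
-- Expanding `P(Λ, ΛX)` in `Λ` gives coefficients in `k[X]` that vanish on `V`, hence on its closure
-- for the topology defined over `k`. The irreducible `k`-components live in that closure.
theorem eval_chowCoord_eq_zero_of_mem_zeroLocus [Infinite K] {V : Set (Fin n → K)}
    {P : MvPolynomial (ChowVar d n) k} (hP : map (algebraMap k K) P ∈ chowIdeal d V)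
    (lam : Matrix (Fin (d + 1)) (Fin n) K) {x : Fin n → K}
    (hx : x ∈ zeroLocus K (vanishingIdeal k V : Ideal (MvPolynomial (Fin n) k))) :
    eval (chowCoord lam (lam *ᵥ x)) (map (algebraMap k K) P) = 0 := by
  let Φ : MvPolynomial (ChowVar d n) k →ₐ[k]
      MvPolynomial (Fin (d + 1) × Fin n) (MvPolynomial (Fin n) k) :=
    aeval (chowCoord (.of fun i j => X (i, j)) (fun i => ∑ j, X (i, j) * C (X j)))
  have key : ∀ (lam : Matrix (Fin (d + 1)) (Fin n) K) (x : Fin n → K),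
      eval (fun ij => lam ij.1 ij.2) (map (aeval (R := k) x).toRingHom (Φ P)) =
        eval (chowCoord lam (lam *ᵥ x)) (map (algebraMap k K) P) := by
    intro lam x
    have : ((eval fun ij : Fin (d + 1) × Fin n => lam ij.1 ij.2).comp
        ((map (aeval (R := k) x).toRingHom).comp Φ.toRingHom)) =
        (eval (chowCoord lam (lam *ᵥ x))).comp (map (algebraMap k K)) := by
      apply MvPolynomial.ringHom_ext
      · intro r
        simp [Φ, MvPolynomial.algebraMap_eq, MvPolynomial.algebraMap_apply]
      · rintro ⟨i, _ | j⟩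
        · simp [Φ, mulVec, dotProduct]
        · simp [Φ]
    exact congr($this P)
  have hcoeff : ∀ m, coeff m (Φ P) ∈ (vanishingIdeal k V : Ideal (MvPolynomial (Fin n) k)) := by
    intro m y hy
    have h0 : map (aeval (R := k) y).toRingHom (Φ P) = 0 := by
      apply MvPolynomial.funext
      intro z
      rw [map_zero]
      exact (key (.of fun i j => z (i, j)) y).trans (mem_chowIdeal.1 hP _ y hy)
    have h1 := congr(coeff m $h0)
    rwa [coeff_map, coeff_zero] at h1
  rw [← key]
  have h0 : map (aeval (R := k) x).toRingHom (Φ P) = 0 := by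
    ext m
    rw [coeff_map, coeff_zero]
    exact hx _ (hcoeff m)
  rw [h0, map_zero]

theorem eval_map_eval_toTop (F : MvPolynomial (ChowVar d n) K) (z : ChowVar d n → K) :
    ((toTop K d n F).map (eval fun b : ChowVar' d n => z b.1)).eval (z (ChowVar.top d n)) =
      eval z F := by
  have h := eval₂_toTop (aeval (R := K) z) F
  rw [Polynomial.eval_map]
  have h1 : (eval fun b : ChowVar' d n => z b.1) =
      ((aeval (R := K) z).comp (rename Subtype.val)).toRingHom := by
    apply MvPolynomial.ringHom_ext <;> simp
  rw [h1]
  simpa using h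

theorem eval_map_eval_chowCoord_toTop (F : MvPolynomial (ChowVar d n) K)
    (lam : Matrix (Fin (d + 1)) (Fin n) K) (y : Fin (d + 1) → K) (τ : K) :
    ((toTop K d n F).map (eval fun b : ChowVar' d n => chowCoord lam y b.1)).eval τ =
      eval (chowCoord lam (Function.update y (Fin.last d) τ)) F := by
  rw [← eval_map_eval_toTop]
  congr 1
  · simp
  · congr 3
    ext ⟨⟨i, _ | j⟩, hb⟩
    · have : i ≠ Fin.last d := fun h => hb (by rw [h])
      simp [this]
    · simp

end degree

end NoetherPrim

end

noncomputable section

namespace NoetherPrim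

open MvPolynomial

section section_points

variable {k K : Type*} [Field k] [Field K] [IsAlgClosed K] [Algebra k K] {d n : ℕ}
  {V : Set (Fin n → K)} {F : MvPolynomial (ChowVar d n) K}

theorem IsChowForm.eval_leadingCoeff_congr (hV : IsPure d V) (hF : IsChowForm V F)
    {lam lam' : Matrix (Fin (d + 1)) (Fin n) K} (h : ∀ i : Fin d, lam i.castSucc = lam' i.castSucc)
    (y y' : Fin (d + 1) → K) :
    eval (fun b : ChowVar' d n => chowCoord lam y b.1) (toTop K d n F).leadingCoeff =
      eval (fun b : ChowVar' d n => chowCoord lam' y' b.1) (toTop K d n F).leadingCoeff := by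
  classical
  have hnot : ∀ b ∈ (toTop K d n F).leadingCoeff.vars,
      (toTop K d n F).leadingCoeff.degreeOf b ≠ 0 := by
    intro b hb
    rwa [degreeOf_def, Ne, Multiset.count_eq_zero, ← Multiset.mem_toFinset, ← vars_def, not_not]
  refine eval₂Hom_congr' rfl ?_ rfl
  rintro ⟨⟨i, j⟩, hb⟩ hvars -
  cases j with
  | none => exact absurd (hF.degreeOf_none_leadingCoeff hV _ rfl) (hnot _ hvars)
  | some j =>
    induction i using Fin.lastCases with
    | last => exact absurd (hF.degreeOf_leadingCoeff hV _ rfl) (hnot _ hvars)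
    | cast i => exact congr_fun (h i) j

theorem natDegree_map_eval_toTop {z : ChowVar' d n → K}
    (hz : eval z (toTop K d n F).leadingCoeff ≠ 0) :
    ((toTop K d n F).map (eval z)).natDegree = F.degreeOf (ChowVar.top d n) := by
  rw [Polynomial.natDegree_map_of_leadingCoeff_ne_zero _ hz, natDegree_toTop]

open Matrix in
theorem IsChowForm.exists_mem_mulVec_eq (hV : IsPure d V) (hF : IsChowForm V F)
    {lam : Matrix (Fin (d + 1)) (Fin n) K} {y : Fin (d + 1) → K}
    (hlam : eval (fun b : ChowVar' d n => chowCoord lam y b.1) (toTop K d n F).leadingCoeff ≠ 0)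
    {τ : K} (hτ : ((toTop K d n F).map
      (eval fun b : ChowVar' d n => chowCoord lam y b.1)).eval τ = 0) :
    ∃ x ∈ V, lam *ᵥ x = Function.update y (Fin.last d) τ := by
  rw [eval_map_eval_chowCoord_toTop] at hτ
  refine hF.exists_mem_of_eval_eq_zero hV lam _ ?_ hτ
  rwa [hF.eval_leadingCoeff_congr hV (lam' := lam) (fun _ => rfl) _ y]

open Matrix in
-- Taking a unit vector as last row makes each coordinate of such a point a root of a nonzero
-- polynomial in one variable.
theorem IsChowForm.finite_section {P : MvPolynomial (ChowVar d n) k} (hV : IsPure d V)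
    (hF : IsChowForm V (map (algebraMap k K) P)) {lam : Matrix (Fin (d + 1)) (Fin n) K}
    {y : Fin (d + 1) → K}
    (hlam : eval (fun b : ChowVar' d n => chowCoord lam y b.1)
      (toTop K d n (map (algebraMap k K) P)).leadingCoeff ≠ 0) :
    {x ∈ zeroLocus K (vanishingIdeal k V : Ideal (MvPolynomial (Fin n) k)) |
      ∀ i : Fin d, (lam *ᵥ x) i.castSucc = y i.castSucc}.Finite := by
  classical
  have := IsAlgClosed.instInfinite (K := K)
  set F := map (algebraMap k K) P with hFP
  let lam' : Fin n → Matrix (Fin (d + 1)) (Fin n) K := fun j =>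
    Function.update lam (Fin.last d) (Pi.single j 1)
  let f : Fin n → Polynomial K := fun j =>
    (toTop K d n F).map (eval fun b : ChowVar' d n => chowCoord (lam' j) y b.1)
  have hf : ∀ j, f j ≠ 0 := by
    intro j h0
    have h1 := congr(Polynomial.coeff $h0 (toTop K d n F).natDegree)
    rw [Polynomial.coeff_map, Polynomial.coeff_zero] at h1
    refine hlam ((hF.eval_leadingCoeff_congr hV (fun i => ?_) _ _).trans h1)
    exact (Function.update_of_ne (Fin.castSucc_lt_last i).ne _ _).symm
  refine (Set.Finite.pi' (t := fun j => ((f j).roots.toFinset : Set K))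
    fun j => Finset.finite_toSet _).subset ?_
  rintro x ⟨hx, hxy⟩ j
  rw [Finset.mem_coe, Multiset.mem_toFinset, Polynomial.mem_roots (hf j), Polynomial.IsRoot.def,
    eval_map_eval_chowCoord_toTop]
  have h1 : Function.update y (Fin.last d) (x j) = lam' j *ᵥ x := by
    ext i
    induction i using Fin.lastCases with
    | last =>
      have h2 : lam' j (Fin.last d) = Pi.single j 1 := Function.update_self ..
      rw [Function.update_self, mulVec, h2, single_one_dotProduct]
    | cast i =>
      have h2 : lam' j i.castSucc = lam i.castSucc :=
        Function.update_of_ne (Fin.castSucc_lt_last i).ne _ _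
      rw [Function.update_of_ne (Fin.castSucc_lt_last i).ne, ← hxy i, mulVec, mulVec, h2]
  rw [h1]
  exact eval_chowCoord_eq_zero_of_mem_zeroLocus (hF.mem_iff.2 dvd_rfl) (lam' j) hx

theorem nodup_roots_of_eval_chowDisc_ne_zero (hd : F.degreeOf (ChowVar.top d n) ≠ 0)
    {z : ChowVar' d n → K} (hdisc : eval z (chowDisc F) ≠ 0) :
    ((toTop K d n F).map (eval z)).roots.Nodup := by
  apply Polynomial.nodup_roots
  set f := (toTop K d n F).map (eval z) with hf
  have hdeg : f.natDegree ≤ F.degreeOf (ChowVar.top d n) := by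
    rw [← natDegree_toTop]
    exact Polynomial.natDegree_map_le
  obtain ⟨p, q, -, -, hpq⟩ := Polynomial.exists_mul_add_mul_eq_C_resultant f
    (Polynomial.derivative f) hdeg ((Polynomial.natDegree_derivative_le f).trans
      (Nat.sub_le_sub_right hdeg 1)) (Or.inl hd)
  rw [hf, Polynomial.derivative_map, Polynomial.resultant_map_map, ← hf] at hpq
  change _ = Polynomial.C (eval z (chowDisc F)) at hpq
  refine ⟨Polynomial.C (eval z (chowDisc F))⁻¹ * p, Polynomial.C (eval z (chowDisc F))⁻¹ * q, ?_⟩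
  rw [hf, Polynomial.derivative_map, ← hf]
  calc _ = Polynomial.C (eval z (chowDisc F))⁻¹ * (f * p +
        (Polynomial.derivative (toTop K d n F)).map (eval z) * q) := by ring
    _ = 1 := by rw [hpq, ← Polynomial.C_mul, inv_mul_cancel₀ hdisc, Polynomial.C_1]

open Matrix in
/-- The degree of a Chow form in the value of one linear form is at most the degree of the
variety. -/
theorem IsChowForm.degreeOf_le_varietyDegree {P : MvPolynomial (ChowVar d n) k}
    (hV : IsPure d V) (hF : IsChowForm V (map (algebraMap k K) P))
    (hdim : ∀ p ∈ (vanishingIdeal k V : Ideal (MvPolynomial (Fin n) k)).minimalPrimes,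
      ringKrullDim (MvPolynomial (Fin n) k ⧸ p) = d) :
    (map (algebraMap k K) P).degreeOf (ChowVar.top d n) ≤ varietyDegree k V := by
  classical
  have := IsAlgClosed.instInfinite (K := K)
  rcases eq_or_ne ((map (algebraMap k K) P).degreeOf (ChowVar.top d n)) 0 with he | he
  · rw [he]
    exact Nat.zero_le _
  have hne : (toTop K d n (map (algebraMap k K) P)).leadingCoeff *
      chowDisc (map (algebraMap k K) P) ≠ 0 := by
    refine mul_ne_zero ?_ (hF.chowDisc_ne_zero hV)
    rw [Polynomial.leadingCoeff_ne_zero, Ne, map_eq_zero_iff _ (toTop K d n).injective]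
    exact hF.ne_zero hV
  obtain ⟨z, hz⟩ : ∃ z, eval z ((toTop K d n (map (algebraMap k K) P)).leadingCoeff *
      chowDisc (map (algebraMap k K) P)) ≠ 0 := by
    by_contra! h
    exact hne (MvPolynomial.funext fun z => by rw [h z, map_zero])
  rw [map_mul] at hz
  obtain ⟨lam, y, rfl⟩ : ∃ (lam : Matrix (Fin (d + 1)) (Fin n) K) (y : Fin (d + 1) → K),
      (fun b : ChowVar' d n => chowCoord lam y b.1) = z := by
    let z' : ChowVar d n → K := fun b => if h : b ≠ ChowVar.top d n then z ⟨b, h⟩ else 0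
    refine ⟨_, _, funext fun b => (congr_fun (chowCoord_eta z') b.1).trans ?_⟩
    exact dif_pos b.2
  have hlam := left_ne_zero_of_mul hz
  have hdisc := right_ne_zero_of_mul hz
  let f : (Fin n → K) →ₗ[K] (Fin d → K) :=
    LinearMap.pi fun i => (LinearMap.proj i.castSucc).comp (Matrix.toLin' lam)
  have hfx : ∀ x i, f x i = (lam *ᵥ x) i.castSucc := fun x i => rfl
  -- For any prescribed values of the first `d` forms the specialized Chow form has positive degree,
  -- hence a root, hence a point over it. The forms are thus independent and `L` has codimension
  -- `d`.
  have hsurj : Function.Surjective f := by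
    intro w
    have hlam' : eval (fun b : ChowVar' d n =>
        chowCoord lam (Fin.lastCases (0 : K) w : Fin (d + 1) → K) b.1)
        (toTop K d n (map (algebraMap k K) P)).leadingCoeff ≠ 0 := by
      rwa [hF.eval_leadingCoeff_congr hV (lam' := lam) (fun _ => rfl) _ y]
    obtain ⟨τ, hτ⟩ := IsAlgClosed.exists_root ((toTop K d n (map (algebraMap k K) P)).map
      (eval fun b : ChowVar' d n =>
        chowCoord lam (Fin.lastCases (0 : K) w : Fin (d + 1) → K) b.1)) (fun h => he (by
        rw [← natDegree_map_eval_toTop hlam']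
        exact Polynomial.natDegree_eq_of_degree_eq_some h))
    obtain ⟨x, -, hx⟩ := hF.exists_mem_mulVec_eq hV hlam' hτ
    refine ⟨x, funext fun i => ?_⟩
    rw [hfx, hx]
    simp [(Fin.castSucc_lt_last i).ne]
  obtain ⟨x₀, hx₀⟩ := hsurj fun i => y i.castSucc
  let L : AffineSubspace K (Fin n → K) := AffineSubspace.mk' x₀ (LinearMap.ker f)
  have hL : ∀ x, x ∈ L ↔ ∀ i : Fin d, (lam *ᵥ x) i.castSucc = y i.castSucc := by
    intro x
    rw [AffineSubspace.mem_mk', vsub_eq_sub, LinearMap.mem_ker, map_sub, sub_eq_zero, hx₀,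
      funext_iff]
    rfl
  have hLd : Module.finrank K L.direction + d = n := by
    have h1 := LinearMap.finrank_range_add_finrank_ker f
    rw [LinearMap.range_eq_top.2 hsurj, finrank_top, Module.finrank_fin_fun,
      Module.finrank_fin_fun] at h1
    rw [AffineSubspace.direction_mk']
    omega
  have hfin : (zeroLocus K (vanishingIdeal k V : Ideal (MvPolynomial (Fin n) k)) ∩
      (L : Set (Fin n → K))).Finite := by
    refine (hF.finite_section hV hlam).subset ?_
    rintro x ⟨hx, hxL⟩
    exact ⟨hx, (hL x).1 hxL⟩
  refine le_trans ?_ (ncard_inter_le_varietyDegree hdim L ⟨x₀, AffineSubspace.self_mem_mk' _ _⟩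
    hLd hfin)
  set p := (toTop K d n (map (algebraMap k K) P)).map
    (eval fun b : ChowVar' d n => chowCoord lam y b.1) with hp
  have hcard : (map (algebraMap k K) P).degreeOf (ChowVar.top d n) = p.roots.toFinset.card := by
    rw [Multiset.toFinset_card_of_nodup (nodup_roots_of_eval_chowDisc_ne_zero he hdisc),
      IsAlgClosed.card_roots_eq_natDegree, natDegree_map_eval_toTop hlam]
  rw [hcard, ← Set.ncard_coe_finset]
  -- Each root is the value of the last form at a point of `V ∩ L`, so the section has at least as
  -- many points as there are distinct roots.
  have hex : (p.roots.toFinset : Set K) ⊆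
      (fun x => (lam *ᵥ x) (Fin.last d)) '' (V ∩ (L : Set (Fin n → K))) := by
    intro τ hτ
    rw [Finset.mem_coe, Multiset.mem_toFinset] at hτ
    obtain ⟨x, hxV, hx⟩ := hF.exists_mem_mulVec_eq hV hlam (Polynomial.isRoot_of_mem_roots hτ)
    refine ⟨x, ⟨hxV, (hL x).2 fun i => ?_⟩, ?_⟩
    · rw [hx]
      simp [(Fin.castSucc_lt_last i).ne]
    · simp [hx]
  have hVfin : (V ∩ (L : Set (Fin n → K))).Finite :=
    hfin.subset (Set.inter_subset_inter_left _ (zeroLocus_vanishingIdeal_le V))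
  exact (Set.ncard_le_ncard hex (hVfin.image _)).trans (Set.ncard_image_le hVfin)

end section_points

/-! ### Compatibility with extension of the coefficient ring. -/

section base_change

variable {R S : Type*} [CommRing R] [CommRing S] {d n : ℕ}

theorem toTop_map (f : R →+* S) (P : MvPolynomial (ChowVar d n) R) :
    toTop S d n (map f P) = (toTop R d n P).map (map f) := by
  ext e t
  rw [coeff_coeff_toTop, coeff_map, Polynomial.coeff_map, coeff_map, coeff_coeff_toTop]

theorem degreeOf_map_of_injective {σ : Type*} {f : R →+* S} (hf : Function.Injective f)
    (P : MvPolynomial σ R) (i : σ) : (map f P).degreeOf i = P.degreeOf i := by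
  classical
  rw [degreeOf_eq_sup, degreeOf_eq_sup, support_map_of_injective P hf]

theorem totalDegree_map_of_injective {σ : Type*} {f : R →+* S} (hf : Function.Injective f)
    (P : MvPolynomial σ R) : (map f P).totalDegree = P.totalDegree := by
  rw [totalDegree, totalDegree, support_map_of_injective P hf]

theorem leadingCoeff_toTop_map {f : R →+* S} (hf : Function.Injective f)
    (P : MvPolynomial (ChowVar d n) R) :
    (toTop S d n (map f P)).leadingCoeff = map f (toTop R d n P).leadingCoeff := by
  rw [toTop_map, Polynomial.leadingCoeff_map_of_injective (map_injective f hf)]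

theorem chowDisc_map {f : R →+* S} (hf : Function.Injective f)
    (P : MvPolynomial (ChowVar d n) R) : chowDisc (map f P) = map f (chowDisc P) := by
  rw [chowDisc, chowDisc, toTop_map, degreeOf_map_of_injective hf, Polynomial.derivative_map,
    Polynomial.resultant_map_map]

end base_change

end NoetherPrim

end

/-! ### Assembly and degree count. -/

theorem mainTheorem3 {k K : Type*} [Field k] [PerfectField k] [Field K] [Algebra k K]
    [IsAlgClosure k K] {n r : ℕ} (hrn : r ≤ n)
    (F : Fin r → MvPolynomial (Fin n) k) (G : MvPolynomial (Fin n) k)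
    (hFG : NoetherPrim.IsReducedRegularSequence F G)
    (s : ℕ) (hs : 1 ≤ s) (hsr : s ≤ r) :
    ∃ A : MvPolynomial (Fin (n - s + 1) × Fin n) k,
      A ≠ 0 ∧
      A.totalDegree ≤
        2 * (n - s + 1) * NoetherPrim.varietyDegree k (NoetherPrim.closedVariety K F G s) ^ 2 ∧
      ∀ lam : Matrix (Fin (n - s + 1)) (Fin n) K,
        MvPolynomial.aeval (fun ij : Fin (n - s + 1) × Fin n => lam ij.1 ij.2) A ≠ 0 →
        NoetherPrim.IsFiniteMorphism (NoetherPrim.closedVariety K F G s)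
            (fun i : Fin (n - s) => NoetherPrim.linForm lam i.castSucc) ∧
        NoetherPrim.InducesPrimitiveElement
            (NoetherPrim.comorphism (NoetherPrim.closedVariety K F G s)
              (fun i : Fin (n - s) => NoetherPrim.linForm lam i.castSucc)).toRingHom
            (Ideal.Quotient.mk (MvPolynomial.vanishingIdeal K (NoetherPrim.closedVariety K F G s))
              (NoetherPrim.linForm lam (Fin.last (n - s)))) := by
  have : IsAlgClosed K := IsAlgClosure.isAlgClosed k
  have : Algebra.IsAlgebraic k K := IsAlgClosure.isAlgebraic
  have hinj : Function.Injective (algebraMap k K) := (algebraMap k K).injective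
  have hV : NoetherPrim.IsPure (n - s) (NoetherPrim.closedVariety K F G s) :=
    ⟨NoetherPrim.zeroLocus_vanishingIdeal_closedVariety F G s, fun q hq =>
      NoetherPrim.trdeg_of_mem_minimalPrimes_vanishingIdeal' hFG hrn hsr hq⟩
  obtain ⟨P, hP⟩ := NoetherPrim.exists_isChowForm_map F G s hV
  have hdeg := hP.degreeOf_le_varietyDegree hV fun p hp =>
    NoetherPrim.ringKrullDim_of_mem_minimalPrimes_vanishingIdeal hFG hsr hp
  have htot := hP.totalDegree_le hV
  rw [NoetherPrim.degreeOf_map_of_injective hinj] at hdeg htot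
  rw [NoetherPrim.totalDegree_map_of_injective hinj] at htot
  have hlc : (NoetherPrim.toTop k (n - s) n P).leadingCoeff ≠ 0 := by
    intro h0
    have h1 := NoetherPrim.leadingCoeff_toTop_map hinj P
    rw [h0, map_zero, Polynomial.leadingCoeff_eq_zero,
      map_eq_zero_iff _ (NoetherPrim.toTop K (n - s) n).injective] at h1
    exact hP.ne_zero hV h1
  have hdisc : NoetherPrim.chowDisc P ≠ 0 := by
    intro h0
    have h1 := hP.chowDisc_ne_zero hV
    rw [NoetherPrim.chowDisc_map hinj, h0, map_zero] at h1
    exact h1 rfl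
  obtain ⟨a, ha, hadeg, ha'⟩ := NoetherPrim.exists_specHom_ne_zero (K := K) _ hlc
  obtain ⟨b, hb, hbdeg, hb'⟩ := NoetherPrim.exists_specHom_ne_zero (K := K) _ hdisc
  -- The factor `a` protects the leading coefficient, `b` the discriminant.
  refine ⟨a * b, mul_ne_zero ha hb, ?_, fun lam hlam => ?_⟩
  · have h1 : a.totalDegree ≤ P.totalDegree :=
      hadeg.trans (NoetherPrim.totalDegree_coeff_toTop_le P _)
    have h2 := hbdeg.trans (NoetherPrim.totalDegree_chowDisc_le P)
    set e := P.degreeOf (NoetherPrim.ChowVar.top (n - s) n)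
    set δ := NoetherPrim.varietyDegree k (NoetherPrim.closedVariety K F G s)
    -- Truncated subtraction makes the first factor `1` when `e = 0`, where the product vanishes
    -- anyway.
    have h3 : (1 + (e + (e - 1))) * e = 2 * e ^ 2 := by
      rcases Nat.eq_zero_or_pos e with h0 | h0
      · simp [h0]
      · rw [show 1 + (e + (e - 1)) = 2 * e by omega]
        ring
    calc (a * b).totalDegree ≤ a.totalDegree + b.totalDegree := MvPolynomial.totalDegree_mul _ _
      _ ≤ P.totalDegree + (e + (e - 1)) * P.totalDegree := Nat.add_le_add h1 h2
      _ = (1 + (e + (e - 1))) * P.totalDegree := by ring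
      _ ≤ (1 + (e + (e - 1))) * ((n - s + 1) * e) := Nat.mul_le_mul_left _ htot
      _ = (n - s + 1) * ((1 + (e + (e - 1))) * e) := by ring
      _ = 2 * (n - s + 1) * e ^ 2 := by rw [h3]; ring
      _ ≤ 2 * (n - s + 1) * δ ^ 2 := Nat.mul_le_mul_left _ (Nat.pow_le_pow_left hdeg 2)
  · rw [map_mul] at hlam
    have h1 := ha' lam (left_ne_zero_of_mul hlam)
    have h2 := hb' lam (right_ne_zero_of_mul hlam)
    rw [← NoetherPrim.leadingCoeff_toTop_map hinj] at h1
    rw [← NoetherPrim.chowDisc_map hinj] at h2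
    exact ⟨hP.isFiniteMorphism hV h1, hP.inducesPrimitiveElement h1 h2⟩
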